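/- Let $V$ be a complex polynomial of degree $N\ge 2$, put $\varphi=\operatorname{Re}V$, and let $\Gamma\subset\mathbb C$ be a closed set (in particular, any contour, i.e. a closed finite union of $C^1$ Jordan arcs, possibly extending to infinity) such that $\varphi(z)\to+\infty$ as $z\to\infty$, $z\in\Gamma$. For closed $F\subset\mathbb C$ let $\mathcal M_1^\varphi(F)$ be the set of Borel probability measures $\mu$ supported on $F$ with $\int\log(1+|x|)\,d\mu(x)<\infty$, finite logarithmic energy $I(\mu)=\iint\log\frac1{|x-y|}\,d\mu(x)\,d\mu(y)$, and $\varphi\in L^1(\mu)$. Put $I^\varphi(\mu)=I(\mu)+\int\varphi\,d\mu$ and $U^\mu(z)=\int\log\frac1{|z-y|}\,d\mu(y)$. An equilibrium measure of $F$ in the external field $\varphi$ is a measure $\mu\in\mathcal M_1^\varphi(F)$ that minimizes $I^\varphi$ over $\mathcal M_1^\varphi(F)$. A measure $\mu\in\mathcal M_1^\varphi(\mathbb C)$ is $\varphi$-critical if, for every compactly supported $C^2$ function $h:\mathbb C\to\mathbb C$ ($C^2$ in the real sense), $$\lim_{t\to0}\frac{I^\varphi(\mu^t)-I^\varphi(\mu)}{t}=0,$$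 where, for real $t$, $\mu^t$ is the pushforward of $\mu$ under $z\mapsto z+t\,h(z)$. Suppose that $\mu$ is an equilibrium measure of $\Gamma$ in the external field $\varphi$ and that $\mu$ is $\varphi$-critical. Then $\Gamma$ has the S-property in the external field $\varphi$: the growth condition above holds and $\Gamma$ has an equilibrium measure $\mu$ in the external field $\varphi$ for which there is a finite set $E$ such that at each point $z$ of $\operatorname{supp}\mu\setminus E$ the set $\operatorname{supp}\mu$ is locally an analytic arc with $z$ in its interior, $U^\mu(z)$ is finite, and the two one-sided normal derivatives $$\frac{\partial}{\partial n_\pm}\Big(U^\mu+\tfrac12\varphi\Big)(z)=\lim_{s\to0^+}\frac{\big(U^\mu+\tfrac12\varphi\big)(z+s\,n_\pm)-\big(U^\mu+\tfrac12\varphi\big)(z)}{s}$$ exist and are equal, where $n_+$ and $n_-=-n_+$ are the unit normal vectors to $\operatorname{supp}\mu$ at $z$. -/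

import Mathlib

open MeasureTheory Filter Topology

noncomputable section

namespace SCurve

/-- The external field `φ = Re V` of a complex polynomial `V`. -/
def field (V : Polynomial ℂ) (z : ℂ) : ℝ := (V.eval z).re

/-- The logarithmic potential `U^μ(z) = ∫ log (1 / |z - y|) dμ(y)`. -/
def logPotential (μ : Measure ℂ) (z : ℂ) : ℝ := ∫ y, Real.log (1 / ‖z - y‖) ∂μ

/-- The logarithmic energy `I(μ) = ∫ U^μ dμ`, meaningful when `HasFiniteLogEnergy μ`. -/
def logEnergy (μ : Measure ℂ) : ℝ := ∫ x, logPotential μ x ∂μ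

/-- The absolute value of the logarithmic kernel `log (1 / |x - y|)`, infinite on the diagonal. -/
def absLogKernel (x y : ℂ) : ENNReal :=
  if x = y then ⊤ else ENNReal.ofReal |Real.log (1 / ‖x - y‖)|

/-- `I(μ)` is finite. The kernel is `+∞` on the diagonal, so that measures with point masses
are excluded. (When `log (1 + |x|)` is integrable, the negative part of the kernel is always
integrable, so that only the value `+∞` is ruled out.) -/
def HasFiniteLogEnergy (μ : Measure ℂ) : Prop :=
  ∫⁻ x, ∫⁻ y, absLogKernel x y ∂μ ∂μ < ⊤

/-- `μ ∈ M₁(F)`: Borel probability measures supported on the closed set `F` for which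
`∫ log (1 + |x|) dμ(x) < ∞`. -/
structure MemM1 (F : Set ℂ) (μ : Measure ℂ) : Prop where
  isProbabilityMeasure : IsProbabilityMeasure μ
  compl_null : μ Fᶜ = 0
  integrable_log : Integrable (fun x : ℂ => Real.log (1 + ‖x‖)) μ

/-- `μ ∈ M₁^φ(F)`: in addition, `I(μ)` is finite and `φ ∈ L¹(μ)`. -/
structure MemM1Field (V : Polynomial ℂ) (F : Set ℂ) (μ : Measure ℂ) : Prop extends MemM1 F μ where
  finite_energy : HasFiniteLogEnergy μ
  integrable_field : Integrable (field V) μ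

/-- The weighted logarithmic energy `I^φ(μ) = I(μ) + ∫ φ dμ`. -/
def weightedEnergy (V : Polynomial ℂ) (μ : Measure ℂ) : ℝ :=
  logEnergy μ + ∫ x, field V x ∂μ

/-- `μ` is an equilibrium measure of `F` in the external field `φ`: it minimizes the weighted
energy over `M₁^φ(F)`. -/
def IsEquilibriumMeasure (V : Polynomial ℂ) (F : Set ℂ) (μ : Measure ℂ) : Prop :=
  MemM1Field V F μ ∧ ∀ ν : Measure ℂ, MemM1Field V F ν → weightedEnergy V μ ≤ weightedEnergy V ν

/-- The growth condition `φ(z) → +∞` as `z → ∞` along `Γ`. -/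
def GrowthCondition (V : Polynomial ℂ) (Γ : Set ℂ) : Prop :=
  Tendsto (field V) (cocompact ℂ ⊓ 𝓟 Γ) atTop

/-- The pushforward `μ^t` of `μ` under `h_t(z) = z + t h(z)`. -/
def variation (μ : Measure ℂ) (h : ℂ → ℂ) (t : ℝ) : Measure ℂ :=
  μ.map (fun z => z + (t : ℂ) * h z)

/-- `D_h I^φ(μ) = lim_{t → 0} (I^φ(μ^t) - I^φ(μ)) / t` exists and equals `d`. -/
def HasEnergyDeriv (V : Polynomial ℂ) (μ : Measure ℂ) (h : ℂ → ℂ) (d : ℝ) : Prop :=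
  Tendsto (fun t : ℝ => (weightedEnergy V (variation μ h t) - weightedEnergy V μ) / t)
    (𝓝[≠] 0) (𝓝 d)

/-- `μ` is `φ`-critical: `μ ∈ M₁^φ(ℂ)` and `D_h I^φ(μ) = 0` for every complex-valued
`h ∈ C²_c(ℂ)` (`C²` in the real sense). -/
def IsCriticalMeasure (V : Polynomial ℂ) (μ : Measure ℂ) : Prop :=
  MemM1Field V Set.univ μ ∧
    ∀ h : ℂ → ℂ, ContDiff ℝ 2 h → HasCompactSupport h → HasEnergyDeriv V μ h 0

/-- The set `S` is an analytic arc near its point `z`, with regular analytic parametrization `γ`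
and `z = γ 0` in its interior. Injectivity up to the endpoints of the compact parameter interval
makes `γ` a homeomorphism onto its image. -/
def IsLocalAnalyticArc (S : Set ℂ) (z : ℂ) (γ : ℝ → ℂ) : Prop :=
  γ 0 = z ∧ ∃ ε : ℝ, 0 < ε ∧
    AnalyticOnNhd ℝ γ (Set.Icc (-ε) ε) ∧
    (∀ t ∈ Set.Icc (-ε) ε, deriv γ t ≠ 0) ∧
    Set.InjOn γ (Set.Icc (-ε) ε) ∧
    ∃ G : Set ℂ, IsOpen G ∧ z ∈ G ∧ S ∩ G = γ '' Set.Ioo (-ε) ε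

/-- The unit normal vector `i γ'(0) / |γ'(0)|` to the arc `γ` at `γ 0`; the other one is its
negative. -/
def unitNormal (γ : ℝ → ℂ) : ℂ := Complex.I * deriv γ 0 / (‖deriv γ 0‖ : ℂ)

/-- The derivative of `f` at `z` in the direction `n`, taken from the side `n` points to, exists
and equals `d`. -/
def HasNormalDeriv (f : ℂ → ℝ) (z n : ℂ) (d : ℝ) : Prop :=
  Tendsto (fun s : ℝ => (f (z + (s : ℂ) * n) - f z) / s) (𝓝[>] 0) (𝓝 d)

/-- `Γ` has the S-property in the external field `φ = Re V`: `Γ` satisfies the growth condition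
and its equilibrium measure `μ` is such that, off a finite set `E`, the support of `μ` is locally
an analytic arc at each of its points, the potential `U^μ` is finite there, and the derivatives of
`U^μ + φ / 2` along the two unit normals exist and are equal. -/
def HasSProperty (V : Polynomial ℂ) (Γ : Set ℂ) : Prop :=
  GrowthCondition V Γ ∧
    ∃ μ : Measure ℂ, IsEquilibriumMeasure V Γ μ ∧
      ∃ E : Set ℂ, E.Finite ∧ ∀ z ∈ μ.support \ E, ∃ γ : ℝ → ℂ,
        IsLocalAnalyticArc μ.support z γ ∧
        Integrable (fun y => Real.log (1 / ‖z - y‖)) μ ∧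
        ∃ d : ℝ,
          HasNormalDeriv (fun w => logPotential μ w + field V w / 2) z (unitNormal γ) d ∧
          HasNormalDeriv (fun w => logPotential μ w + field V w / 2) z (-unitNormal γ) d

end SCurve

end

noncomputable section

namespace SCurve

open Complex Set Real Metric

/-! Let C(z) = ∫ dμ(x)/(x - z) and g = C + V'/2 (`gradientField`); the weak derivative of U^μ + φ/2
in a direction v is Re(v g). The crux is that g² is a polynomial.

Displacing μ by z + t h(z) adds -Re log(1 + t (h(x) - h(y))/(x - y)) to the kernel log(1/|x - y|).
Hence criticality is the identity ∬ (h(x) - h(y))/(x - y) dμ dμ = ∫ V' h dμ for every test function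
h (`integral_dividedDiff`). By Cauchy–Pompeiu, ∂̄C = -πμ as a distribution, and by partial fractions
∫ ∂̄h C² is -π times the left side of that identity. In ∂̄(g²) the square term and the cross term
therefore cancel (`integral_dbar_mul_sq`). Finite energy puts C in L² on discs with a polynomial
bound in the radius, so Weyl's lemma and Cauchy's estimates give g² = p almost everywhere for a
polynomial p. It is nonzero: g = 0 would make C holomorphic and so μ = 0
(`exists_polynomial_gradientField_sq`).

Near a point z₀ of the support with p(z₀) ≠ 0, take the flat coordinate e with e' = S, S² = p. Then
g = σS with σ = ±1 almost everywhere, and ∂̄g = -πμ says that σ does not depend on Im e and that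
-∂σ/∂(Re e) is 2π times the image of μ (`integral_sign_mul_fderiv`). A monotone function with values
±1 jumps at most once, and μ lives exactly on the jump. So the support is the analytic arc Re e = 0,
σ is minus the sign of Re e, and U^μ + φ/2 = c - |Re e| almost everywhere. Averaging over small
discs upgrades this to every nearby point and shows that U^μ is finite there
(`exists_potential_eq`). Along both normals the derivative of c - |Re e| at z₀ is -|S(z₀)|. The
exceptional set is the zero set of p. -/

/-! ### The operator ∂̄ and the Cauchy–Pompeiu formula. -/

theorem integral_fderiv_apply_eq_zero {E : Type*} [NormedAddCommGroup E] [NormedSpace ℝ E]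
    {G : ℂ → E} (hG : ContDiff ℝ 1 G) (hc : HasCompactSupport G) (v : ℂ) :
    ∫ z, fderiv ℝ G z v = 0 := by
  have h1 : Continuous fun z => fderiv ℝ G z v :=
    (hG.continuous_fderiv one_ne_zero).clm_apply continuous_const
  have h2 : HasCompactSupport fun z => fderiv ℝ G z v := hc.fderiv_apply ℝ v
  have := integral_smul_fderiv_eq_neg_fderiv_smul_of_integrable (μ := (volume : Measure ℂ))
    (f := fun _ : ℂ => (1 : ℝ)) (g := G) (v := v) (by simp)
    (by simpa using h1.integrable_of_hasCompactSupport h2)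
    (by simpa using hG.continuous.integrable_of_hasCompactSupport hc)
    (fun x _ => differentiableAt_const _) (fun x _ => hG.differentiable one_ne_zero x)
  simpa using this

/-- The Wirtinger derivative `∂h/∂z̄`. -/
def dbar (h : ℂ → ℂ) (z : ℂ) : ℂ := (fderiv ℝ h z 1 + I * fderiv ℝ h z I) / 2

theorem fderiv_real_apply (h : ℂ → ℂ) (z v : ℂ) :
    fderiv ℝ h z v = v.re * fderiv ℝ h z 1 + v.im * fderiv ℝ h z I := by
  have : v = v.re • (1 : ℂ) + v.im • I := by simp
  conv_lhs => rw [this, map_add, map_smul, map_smul]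
  simp

/-- The combination L v + i L(i v) kills the complex-linear part of a real-linear map L and doubles
its conjugate-linear part. -/
theorem fderiv_add_I_mul (h : ℂ → ℂ) (z v : ℂ) :
    fderiv ℝ h z v + I * fderiv ℝ h z (I * v) = 2 * dbar h z * (starRingEnd ℂ) v := by
  rw [fderiv_real_apply h z v, fderiv_real_apply h z (I * v)]
  have : (starRingEnd ℂ) v = v.re - v.im * I := by
    apply Complex.ext <;> simp
  rw [this, dbar]
  simp only [mul_re, I_re, zero_mul, I_im, one_mul, zero_sub, mul_im, zero_add, ofReal_neg]
  linear_combination ((fderiv ℝ h z I) * v.im) * I_mul_I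

theorem dbar_of_eventuallyEq {h k : ℂ → ℂ} {z : ℂ} (hk : h =ᶠ[𝓝 z] k) : dbar h z = dbar k z := by
  rw [dbar, dbar, hk.fderiv_eq]

theorem continuous_dbar {h : ℂ → ℂ} (hh : ContDiff ℝ 1 h) : Continuous (dbar h) := by
  have := hh.continuous_fderiv one_ne_zero
  unfold dbar
  fun_prop

theorem hasCompactSupport_dbar {h : ℂ → ℂ} (hc : HasCompactSupport h) :
    HasCompactSupport (dbar h) := by
  refine HasCompactSupport.mono (f := fderiv ℝ h) (hc.fderiv ℝ) ?_
  intro z hz hz'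
  apply hz
  simp [dbar, hz']

theorem integral_dbar {h : ℂ → ℂ} (hh : ContDiff ℝ 1 h) (hc : HasCompactSupport h) :
    ∫ z, dbar h z = 0 := by
  have h1 : ∀ v, Integrable fun z => fderiv ℝ h z v := fun v =>
    ((hh.continuous_fderiv one_ne_zero).clm_apply continuous_const).integrable_of_hasCompactSupport
      (hc.fderiv_apply ℝ v)
  simp only [dbar]
  rw [integral_div, integral_add (h1 1) ((h1 I).const_mul I), integral_const_mul,
    integral_fderiv_apply_eq_zero hh hc, integral_fderiv_apply_eq_zero hh hc]
  simp

theorem dbar_holomorphic_mul {F h : ℂ → ℂ} {z : ℂ} (hF : DifferentiableAt ℂ F z)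
    (hh : DifferentiableAt ℝ h z) : dbar (fun w => F w * h w) z = F z * dbar h z := by
  have h1 := (hF.hasDerivAt.hasFDerivAt.restrictScalars ℝ).mul hh.hasFDerivAt
  have h2 : fderiv ℝ (fun w => F w * h w) z = _ := h1.fderiv
  rw [dbar, dbar, h2]
  simp
  linear_combination (h z * deriv F z / 2) * I_mul_I

theorem dbar_comp_holomorphic {e ψ : ℂ → ℂ} {z e' : ℂ} (he : HasDerivAt e e' z)
    (hψ : DifferentiableAt ℝ ψ (e z)) :
    dbar (fun w => ψ (e w)) z = (starRingEnd ℂ) e' * dbar ψ (e z) := by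
  have h1 := hψ.hasFDerivAt.comp z (he.hasFDerivAt.restrictScalars ℝ)
  have h2 : fderiv ℝ (fun w => ψ (e w)) z = _ := h1.fderiv
  have := fderiv_add_I_mul ψ (e z) e'
  rw [dbar, h2]
  simp
  linear_combination this / 2

/-- Bound for compactly supported functions. -/
theorem exists_bound_support {E : Type*} [NormedAddCommGroup E] {f : ℂ → E}
    (hf : Continuous f) (hc : HasCompactSupport f) :
    ∃ M r : ℝ, 0 < M ∧ 1 ≤ r ∧ (∀ z, ‖f z‖ ≤ M) ∧ ∀ z, r ≤ ‖z‖ → f z = 0 := by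
  obtain ⟨M, hM⟩ := hc.exists_bound_of_continuous hf
  obtain ⟨r, hr⟩ := hc.isCompact.isBounded.subset_ball 0
  refine ⟨max M 1, max r 1, by positivity, by simp, fun z => (hM z).trans (le_max_left _ _), ?_⟩
  intro z hz
  by_contra hne
  have := hr (subset_tsupport _ hne)
  simp at this
  linarith [le_max_left r 1]

/-- The **Cauchy–Pompeiu formula** for compactly supported functions, at the origin. -/
theorem integral_dbar_div_self {h : ℂ → ℂ} (hh : ContDiff ℝ 1 h) (hc : HasCompactSupport h) :
    ∫ z, dbar h z / z = -(π * h 0) := by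
  rw [← Complex.integral_comp_polarCoord_symm]
  set P : ℝ × ℝ → ℂ := fun p => p.1 * Complex.exp (p.2 * I) with hP
  set A : ℝ × ℝ → ℂ := fun p => fderiv ℝ h (P p) (Complex.exp (p.2 * I)) with hA
  set B : ℝ × ℝ → ℂ := fun p => fderiv ℝ h (P p) (I * Complex.exp (p.2 * I)) with hB
  have hfd := hh.continuous_fderiv one_ne_zero
  have hPc : Continuous P := by fun_prop
  have hAc : Continuous A := by fun_prop
  have hBc : Continuous B := by fun_prop
  obtain ⟨M, r, hM0, hr1, hM, hr⟩ := exists_bound_support hfd (hc.fderiv ℝ)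
  have hnE : ∀ θ : ℝ, ‖Complex.exp (θ * I)‖ = 1 := fun θ => norm_exp_ofReal_mul_I θ
  have hPn : ∀ p : ℝ × ℝ, ‖P p‖ = |p.1| := by
    intro p; simp [hP, hnE]
  have hint : ∀ D : ℝ × ℝ → ℂ, Continuous D → (∀ p, r ≤ |p.1| → D p = 0) →
      IntegrableOn D (Ioi (0 : ℝ) ×ˢ Ioo (-π) π) := by
    intro D hD hD0
    have : IntegrableOn D (Icc (0 : ℝ) r ×ˢ Icc (-π) π) :=
      hD.continuousOn.integrableOn_compact (isCompact_Icc.prod isCompact_Icc)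
    refine this.of_forall_sdiff_eq_zero (measurableSet_Ioi.prod measurableSet_Ioo) ?_
    rintro ⟨a, b⟩ ⟨⟨h1, h2⟩, h3⟩
    apply hD0
    by_contra hlt
    push Not at hlt
    apply h3
    simp at h1 h2 hlt ⊢
    rw [abs_of_pos h1] at hlt
    exact ⟨⟨h1.le, h2.1.le⟩, hlt.le, h2.2.le⟩
  have hA0 : ∀ p, r ≤ |p.1| → A p = 0 := by
    intro p hp; simp only [hA]; rw [hr _ (by rwa [hPn])]; simp
  have hB0 : ∀ p, r ≤ |p.1| → B p = 0 := by
    intro p hp; simp only [hB]; rw [hr _ (by rwa [hPn])]; simp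
  have hAi := hint A hAc hA0
  have hBi := hint B hBc hB0
  -- The polar Jacobian cancels the modulus of 1/z, leaving e^{-iθ} ∂̄h = (∂_r h + (i/r) ∂_θ h)/2,
  -- where `A` is ∂_r h and `B` is (1/r) ∂_θ h.
  have e1 : ∀ p ∈ polarCoord.target, p.1 • (dbar h (Complex.polarCoord.symm p) /
      Complex.polarCoord.symm p) = (A p + I * B p) / 2 := by
    rintro ⟨a, b⟩ ⟨ha, hb⟩
    have ha' : (a : ℂ) ≠ 0 := by exact_mod_cast (ne_of_gt ha)
    have hexp : (Real.cos b + Real.sin b * I : ℂ) = Complex.exp (b * I) := by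
      rw [Complex.exp_mul_I]; push_cast; rfl
    simp only [Complex.polarCoord_symm_apply, hA, hB, hP]
    rw [hexp, fderiv_add_I_mul, ← Complex.exp_conj]
    have : (starRingEnd ℂ) (b * I) = -(b * I) := by simp
    rw [this, Complex.exp_neg]
    have := Complex.exp_ne_zero (b * I)
    simp only [real_smul]
    field_simp
  rw [setIntegral_congr_fun polarCoord.open_target.measurableSet e1, integral_div]
  have e2 : ∫ p in polarCoord.target, (A p + I * B p) =
      (∫ p in Ioi (0 : ℝ) ×ˢ Ioo (-π) π, A p) + I * ∫ p in Ioi (0 : ℝ) ×ˢ Ioo (-π) π, B p := by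
    rw [← integral_const_mul]
    exact integral_add hAi (hBi.const_mul I)
  rw [e2]
  have hdA : ∀ a b : ℝ, HasDerivAt (fun a : ℝ => h (P (a, b))) (A (a, b)) a := by
    intro a b
    have : HasDerivAt (fun a : ℝ => P (a, b)) (Complex.exp (b * I)) a := by
      simpa [hP] using (Complex.ofRealCLM.hasDerivAt (x := a)).mul_const (Complex.exp (b * I))
    exact (hh.differentiable one_ne_zero (P (a, b))).hasFDerivAt.comp_hasDerivAt a this
  have hdB : ∀ a b : ℝ, HasDerivAt (fun b : ℝ => h (P (a, b))) (a * B (a, b)) b := by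
    intro a b
    have : HasDerivAt (fun b : ℝ => P (a, b)) (a • (I * Complex.exp (b * I))) b := by
      have h1 : HasDerivAt (fun b : ℝ => (b : ℂ) * I) I b := by
        simpa using (Complex.ofRealCLM.hasDerivAt (x := b)).mul_const I
      have := (h1.cexp).const_mul (a : ℂ)
      rw [real_smul, mul_comm I]
      exact this
    have h2 := (hh.differentiable one_ne_zero (P (a, b))).hasFDerivAt.comp_hasDerivAt b this
    rw [map_smul] at h2
    rw [real_smul] at h2
    exact h2
  -- Every ray contributes h(∞) - h(0) = -h(0).
  have iA : ∫ p in Ioi (0 : ℝ) ×ˢ Ioo (-π) π, A p = -(2 * π * h 0) := by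
    rw [Measure.volume_eq_prod, ← Measure.prod_restrict, integral_prod_symm]
    · have : ∀ b : ℝ, ∫ a in Ioi (0 : ℝ), A (a, b) = - h 0 := by
        intro b
        have := integral_Ioi_of_hasDerivAt_of_tendsto' (f := fun a : ℝ => h (P (a, b)))
          (f' := fun a => A (a, b)) (a := 0) (m := 0) (fun x _ => hdA x b) ?_ ?_
        · rw [this]; simp [hP]
        · have : IntegrableOn (fun a => A (a, b)) (Icc 0 r) :=
            (by fun_prop : Continuous fun a => A (a, b)).continuousOn.integrableOn_compact
              isCompact_Icc
          refine this.of_forall_sdiff_eq_zero measurableSet_Ioi ?_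
          rintro a ⟨h1, h3⟩
          apply hA0
          by_contra hlt
          push Not at hlt
          rw [abs_of_pos h1] at hlt
          exact h3 ⟨le_of_lt h1, hlt.le⟩
        · obtain ⟨M', r', -, -, -, hr'⟩ := exists_bound_support hh.continuous hc
          refine tendsto_const_nhds.congr' ?_
          filter_upwards [eventually_ge_atTop (max r' 0)] with a ha
          rw [hr']
          rw [hPn, abs_of_nonneg ((le_max_right _ _).trans ha)]
          exact (le_max_left _ _).trans ha
      simp only [this]
      simp
      left
      rw [max_eq_left (by positivity)]
      push_cast; ring
    · rw [Measure.prod_restrict]; exact hAi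
  -- On the circle of radius a, a·B is the θ-derivative of a periodic function.
  have iB : ∫ p in Ioi (0 : ℝ) ×ˢ Ioo (-π) π, B p = 0 := by
    rw [Measure.volume_eq_prod, setIntegral_prod]
    · rw [← integral_zero ℝ ℂ (μ := volume.restrict (Ioi (0:ℝ)))]
      refine setIntegral_congr_fun measurableSet_Ioi ?_
      intro a ha
      have ha0 : (a : ℂ) ≠ 0 := by exact_mod_cast (ne_of_gt ha)
      have := intervalIntegral.integral_eq_sub_of_hasDerivAt (a := -π) (b := π)
        (f := fun b : ℝ => h (P (a, b)))
        (f' := fun b => a * B (a, b)) (fun b _ => hdB a b)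
        ((by fun_prop : Continuous fun b => a * B (a, b)).intervalIntegrable _ _)
      rw [intervalIntegral.integral_const_mul, intervalIntegral.integral_of_le (by linarith [pi_pos]),
        integral_Ioc_eq_integral_Ioo] at this
      have hz : P (a, π) = P (a, -π) := by
        simp [hP, Complex.exp_neg]
      rw [hz, sub_self] at this
      simpa [ha0] using this
    · exact hBi
  rw [iA, iB]
  ring

theorem dbar_comp_add (h : ℂ → ℂ) (a z : ℂ) : dbar (fun w => h (w + a)) z = dbar h (z + a) := by
  simp only [dbar, fderiv_comp_add_right]

/-- The **Cauchy–Pompeiu formula** for compactly supported functions. -/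
theorem cauchy_pompeiu {h : ℂ → ℂ} (hh : ContDiff ℝ 1 h) (hc : HasCompactSupport h) (x : ℂ) :
    ∫ z, dbar h z / (x - z) = π * h x := by
  have h1 := integral_dbar_div_self (h := fun w => h (w + x)) (by fun_prop)
    (hc.comp_homeomorph (Homeomorph.addRight x))
  have h2 := integral_add_right_eq_self (μ := (volume : Measure ℂ))
    (fun z => dbar h z / (x - z)) x
  rw [← h2]
  simp only [dbar_comp_add, zero_add] at h1
  have : (fun z => dbar h (z + x) / (x - (z + x))) = fun z => -(dbar h (z + x) / z) := by
    ext z; rw [sub_add_cancel_right, div_neg]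
  rw [this, integral_neg, h1, neg_neg]

/-! ### First variation of the weighted energy. -/

/-- The divided difference of `h`, with value `0` on the diagonal. -/
def dividedDiff (h : ℂ → ℂ) (p : ℂ × ℂ) : ℂ := (h p.1 - h p.2) / (p.1 - p.2)

theorem measurable_dividedDiff {h : ℂ → ℂ} (hh : Continuous h) : Measurable (dividedDiff h) := by
  have := hh.measurable
  unfold dividedDiff
  fun_prop

theorem exists_dividedDiff_bound {h : ℂ → ℂ} (hh : ContDiff ℝ 1 h) (hc : HasCompactSupport h) :
    ∃ K : ℝ, 0 < K ∧ ∀ p, ‖dividedDiff h p‖ ≤ K := by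
  obtain ⟨K, hK⟩ := hh.lipschitzWith_of_hasCompactSupport hc one_ne_zero
  refine ⟨K + 1, by positivity, fun p => ?_⟩
  rw [dividedDiff, norm_div]
  have := hK.norm_sub_le p.1 p.2
  refine div_le_of_le_mul₀ (norm_nonneg _) (by positivity) ?_
  nlinarith [norm_nonneg (p.1 - p.2)]

theorem measurable_absLogKernel : Measurable (fun p : ℂ × ℂ => absLogKernel p.1 p.2) := by
  unfold absLogKernel
  refine Measurable.ite (measurableSet_eq_fun measurable_fst measurable_snd) measurable_const ?_
  fun_prop

theorem ofReal_abs_log_le_absLogKernel (x y : ℂ) :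
    ENNReal.ofReal |Real.log ‖x - y‖| ≤ absLogKernel x y := by
  unfold absLogKernel
  split_ifs with h
  · exact le_top
  · simp

theorem integrable_log_prod {μ : Measure ℂ} [IsProbabilityMeasure μ] (hfin : HasFiniteLogEnergy μ) :
    Integrable (fun p : ℂ × ℂ => Real.log ‖p.1 - p.2‖) (μ.prod μ) := by
  refine ⟨Measurable.aestronglyMeasurable (by fun_prop), ?_⟩
  refine lt_of_le_of_lt ?_ hfin
  rw [← lintegral_prod (fun p : ℂ × ℂ => absLogKernel p.1 p.2)
    measurable_absLogKernel.aemeasurable]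
  refine lintegral_mono fun p => ?_
  rw [Real.enorm_eq_ofReal_abs]
  exact ofReal_abs_log_le_absLogKernel _ _

/-- The kernel is infinite on the diagonal, so finite energy makes the diagonal a null set. -/
theorem ae_prod_ne {μ : Measure ℂ} [IsProbabilityMeasure μ] (hfin : HasFiniteLogEnergy μ) :
    ∀ᵐ p ∂(μ.prod μ), p.1 ≠ p.2 := by
  have h1 : ∫⁻ p, absLogKernel p.1 p.2 ∂(μ.prod μ) ≠ ⊤ := by
    rw [lintegral_prod (fun p : ℂ × ℂ => absLogKernel p.1 p.2)
      measurable_absLogKernel.aemeasurable]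
    exact hfin.ne
  filter_upwards [ae_lt_top measurable_absLogKernel h1] with p hp h
  simp [absLogKernel, h] at hp

theorem continuous_displacement {h : ℂ → ℂ} (hh : Continuous h) (t : ℝ) :
    Continuous (fun z => z + (t : ℂ) * h z) := by fun_prop

theorem stronglyMeasurable_logPotential (μ : Measure ℂ) [SFinite μ] :
    StronglyMeasurable (logPotential μ) := by
  unfold logPotential
  have : Measurable fun p : ℂ × ℂ => Real.log (1 / ‖p.1 - p.2‖) := by fun_prop
  exact this.stronglyMeasurable.integral_prod_right

/-- The displaced difference factors as (x - y)(1 + t · divided difference), so the energy splits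
into a constant and a term smooth in t. The smallness of t keeps the second factor away from 0 and
bounds its logarithm. -/
theorem logEnergy_variation {μ : Measure ℂ} [IsProbabilityMeasure μ] (hfin : HasFiniteLogEnergy μ)
    {h : ℂ → ℂ} (hh : Continuous h) {K : ℝ} (hK : ∀ p, ‖dividedDiff h p‖ ≤ K) {t : ℝ}
    (ht : |t| * K < 1 / 2) :
    logEnergy (variation μ h t) =
      -(∫ p, Real.log ‖p.1 - p.2‖ ∂(μ.prod μ))
        - ∫ p, (Complex.log (1 + t * dividedDiff h p)).re ∂(μ.prod μ) := by
  have hT := continuous_displacement hh t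
  have hprob : IsProbabilityMeasure (variation μ h t) :=
    Measure.isProbabilityMeasure_map hT.measurable.aemeasurable
  have hsm : ∀ p, ‖(t : ℂ) * dividedDiff h p‖ ≤ 1 / 2 := fun p => by
    rw [norm_mul, norm_real, Real.norm_eq_abs]
    exact (mul_le_mul_of_nonneg_left (hK p) (abs_nonneg t)).trans ht.le
  have hne : ∀ p, 1 + (t : ℂ) * dividedDiff h p ≠ 0 := by
    intro p hp
    have : (t : ℂ) * dividedDiff h p = -1 := by linear_combination hp
    have h2 := hsm p
    rw [this] at h2
    norm_num at h2
  have hpt : ∀ p : ℂ × ℂ, Real.log (1 / ‖(p.1 + t * h p.1) - (p.2 + t * h p.2)‖) =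
      -(Real.log ‖p.1 - p.2‖) - (Complex.log (1 + t * dividedDiff h p)).re := by
    intro p
    rw [Complex.log_re, one_div, Real.log_inv]
    -- On the diagonal every term vanishes, by the conventions `Real.log 0 = 0` and `0 / 0 = 0`.
    by_cases hp : p.1 = p.2
    · simp [hp, dividedDiff]
    · have hp' : p.1 - p.2 ≠ 0 := sub_ne_zero.2 hp
      have : (p.1 + t * h p.1) - (p.2 + t * h p.2) =
          (p.1 - p.2) * (1 + t * dividedDiff h p) := by
        rw [dividedDiff]; field_simp; ring
      rw [this, norm_mul, Real.log_mul (norm_ne_zero_iff.2 hp') (norm_ne_zero_iff.2 (hne p))]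
      ring
  have hi1 : Integrable (fun p : ℂ × ℂ => -Real.log ‖p.1 - p.2‖) (μ.prod μ) :=
    (integrable_log_prod hfin).neg
  have hi2 : Integrable (fun p => (Complex.log (1 + t * dividedDiff h p)).re) (μ.prod μ) := by
    have hm := measurable_dividedDiff hh
    refine Integrable.of_bound (by fun_prop) 1 (ae_of_all _ fun p => ?_)
    have h1 := Complex.norm_log_one_add_half_le_self (hsm p)
    refine (Complex.abs_re_le_norm _).trans (h1.trans ?_)
    linarith [hsm p]
  have hi3 : Integrable (fun p : ℂ × ℂ =>
      Real.log (1 / ‖(p.1 + t * h p.1) - (p.2 + t * h p.2)‖)) (μ.prod μ) := by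
    simp only [hpt]; exact hi1.sub hi2
  have e1 : logEnergy (variation μ h t) =
      ∫ x, ∫ y, Real.log (1 / ‖(x + t * h x) - (y + t * h y)‖) ∂μ ∂μ := by
    have h0 : logEnergy (variation μ h t) = ∫ x, logPotential (variation μ h t) x
        ∂(μ.map (fun z => z + (t : ℂ) * h z)) := rfl
    rw [h0, integral_map hT.measurable.aemeasurable]
    · refine integral_congr_ae (ae_of_all _ fun x => ?_)
      simp only [logPotential]
      rw [variation, integral_map hT.measurable.aemeasurable]
      exact Measurable.aestronglyMeasurable (by fun_prop)
    · exact (stronglyMeasurable_logPotential _).aestronglyMeasurable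
  rw [e1, ← integral_prod (fun p : ℂ × ℂ =>
      Real.log (1 / ‖(p.1 + t * h p.1) - (p.2 + t * h p.2)‖)) hi3]
  simp only [hpt]
  rw [integral_sub hi1 hi2, integral_neg]

theorem hasDerivAt_integral_log_one_add {μ : Measure ℂ} [IsProbabilityMeasure μ] {h : ℂ → ℂ}
    (hh : Continuous h) {K : ℝ} (hK0 : 0 < K) (hK : ∀ p, ‖dividedDiff h p‖ ≤ K) :
    HasDerivAt (fun t : ℝ => ∫ p, (Complex.log (1 + t * dividedDiff h p)).re ∂(μ.prod μ))
      (∫ p, (dividedDiff h p).re ∂(μ.prod μ)) 0 := by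
  have hm := measurable_dividedDiff hh
  have hsm : ∀ t ∈ Metric.ball (0 : ℝ) (1 / (2 * K)), ∀ p, ‖(t : ℂ) * dividedDiff h p‖ ≤ 1 / 2 := by
    intro t ht p
    rw [mem_ball_zero_iff, Real.norm_eq_abs] at ht
    rw [norm_mul, norm_real, Real.norm_eq_abs]
    calc |t| * ‖dividedDiff h p‖ ≤ (1 / (2 * K)) * K := by gcongr; exact hK p
      _ = 1 / 2 := by field_simp
  have key := hasDerivAt_integral_of_dominated_loc_of_deriv_le (μ := μ.prod μ) (𝕜 := ℝ)
    (F := fun t p => (Complex.log (1 + t * dividedDiff h p)).re)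
    (F' := fun t p => (dividedDiff h p / (1 + t * dividedDiff h p)).re)
    (x₀ := (0 : ℝ)) (s := Metric.ball 0 (1 / (2 * K))) (bound := fun _ => 2 * K)
    (Metric.ball_mem_nhds _ (by positivity))
    (Eventually.of_forall fun t => Measurable.aestronglyMeasurable (by fun_prop))
    (by simp) (Measurable.aestronglyMeasurable (by fun_prop)) ?_ (integrable_const _) ?_
  · have := key.2
    simpa using this
  · refine ae_of_all _ fun p t ht => ?_
    refine (Complex.abs_re_le_norm _).trans ?_
    rw [norm_div]
    have h1 : 1 / 2 ≤ ‖1 + (t : ℂ) * dividedDiff h p‖ := by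
      have := norm_sub_le (1 + (t : ℂ) * dividedDiff h p) ((t : ℂ) * dividedDiff h p)
      rw [add_sub_cancel_right, norm_one] at this
      linarith [hsm t ht p]
    rw [div_le_iff₀ (by linarith)]
    have := hK p
    nlinarith
  · refine ae_of_all _ fun p t ht => ?_
    have h1 : HasDerivAt (fun t : ℝ => 1 + (t : ℂ) * dividedDiff h p) (dividedDiff h p) t := by
      simpa using ((Complex.ofRealCLM.hasDerivAt (x := t)).mul_const (dividedDiff h p)).const_add 1
    have h2 : 1 + (t : ℂ) * dividedDiff h p ∈ slitPlane := by
      apply Complex.mem_slitPlane_of_norm_lt_one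
      linarith [hsm t ht p]
    exact Complex.reCLM.hasFDerivAt.comp_hasDerivAt t (h1.clog_real h2)

/-- Points outside the support of h do not move, so V' only has to be bounded on a fixed disc that
contains all the displaced points. -/
theorem hasDerivAt_integral_field {μ : Measure ℂ} [IsProbabilityMeasure μ] (V : Polynomial ℂ)
    (hint : Integrable (field V) μ) {h : ℂ → ℂ} (hh : Continuous h) (hc : HasCompactSupport h) :
    HasDerivAt (fun t : ℝ => ∫ z, field V (z + t * h z) ∂μ)
      (∫ z, (V.derivative.eval z * h z).re ∂μ) 0 := by
  have hmeas : Continuous (field V) := by unfold field; fun_prop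
  obtain ⟨M, r, hM0, hr1, hM, hr⟩ := exists_bound_support hh hc
  obtain ⟨N, hN⟩ := (isCompact_closedBall (0 : ℂ) (r + M)).exists_bound_of_continuousOn
    (V.derivative.continuous.continuousOn)
  have key := hasDerivAt_integral_of_dominated_loc_of_deriv_le (μ := μ) (𝕜 := ℝ)
    (F := fun t z => field V (z + t * h z))
    (F' := fun t z => (V.derivative.eval (z + t * h z) * h z).re)
    (x₀ := (0 : ℝ)) (s := Metric.ball 0 1) (bound := fun _ => N * M)
    (Metric.ball_mem_nhds _ one_pos)
    (Eventually.of_forall fun t => Continuous.aestronglyMeasurable (by fun_prop))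
    (by simpa using hint) (Continuous.aestronglyMeasurable (by fun_prop)) ?_ (integrable_const _) ?_
  · simpa using key.2
  · refine ae_of_all _ fun z t ht => ?_
    refine (Complex.abs_re_le_norm _).trans ?_
    have hN0 : 0 ≤ N := (norm_nonneg _).trans (hN 0 (by simp; positivity))
    by_cases hz : r ≤ ‖z‖
    · rw [hr z hz]; simp; positivity
    · push Not at hz
      rw [mem_ball_zero_iff, Real.norm_eq_abs] at ht
      rw [norm_mul]
      gcongr
      · apply hN
        rw [mem_closedBall_zero_iff]
        refine (norm_add_le _ _).trans ?_
        rw [norm_mul, norm_real, Real.norm_eq_abs]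
        have := hM z
        nlinarith [norm_nonneg (h z), abs_nonneg t]
      · exact hM z
  · refine ae_of_all _ fun z t ht => ?_
    have h1 : HasDerivAt (fun t : ℝ => z + (t : ℂ) * h z) (h z) t := by
      simpa using ((Complex.ofRealCLM.hasDerivAt (x := t)).mul_const (h z)).const_add z
    have h2 := (V.hasDerivAt (z + t * h z)).comp_of_eq t h1 rfl
    exact Complex.reCLM.hasFDerivAt.comp_hasDerivAt t h2

/-- The two sides are the contributions of the energy and of the field to the derivative at t = 0,
which is zero by criticality. The explicit formula for the energy is needed for small t only. -/
theorem integral_re_dividedDiff {V : Polynomial ℂ} {μ : Measure ℂ} (hcrit : IsCriticalMeasure V μ)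
    {h : ℂ → ℂ} (hh : ContDiff ℝ 2 h) (hc : HasCompactSupport h) :
    ∫ p, (dividedDiff h p).re ∂(μ.prod μ) = ∫ z, (V.derivative.eval z * h z).re ∂μ := by
  have := hcrit.1.isProbabilityMeasure
  obtain ⟨K, hK0, hK⟩ := exists_dividedDiff_bound (hh.of_le one_le_two) hc
  have d1 := hasDerivAt_integral_log_one_add (μ := μ) hh.continuous hK0 hK
  have d2 := hasDerivAt_integral_field V hcrit.1.integrable_field hh.continuous hc
  have d3 := hasDerivAt_iff_tendsto_slope_zero.1 (d2.sub d1)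
  have d4 := hcrit.2 h hh hc
  unfold HasEnergyDeriv at d4
  have hw : ∀ t : ℝ, |t| * K < 1 / 2 → weightedEnergy V (variation μ h t) =
      -(∫ p, Real.log ‖p.1 - p.2‖ ∂(μ.prod μ))
        + ((∫ z, field V (z + t * h z) ∂μ)
        - ∫ p, (Complex.log (1 + t * dividedDiff h p)).re ∂(μ.prod μ)) := by
    intro t ht
    rw [weightedEnergy, logEnergy_variation hcrit.1.finite_energy hh.continuous hK ht, variation,
      integral_map (continuous_displacement hh.continuous t).measurable.aemeasurable]
    · ring
    · exact Continuous.aestronglyMeasurable (by unfold field; fun_prop)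
  have hw0 : weightedEnergy V μ = -(∫ p, Real.log ‖p.1 - p.2‖ ∂(μ.prod μ))
        + ((∫ z, field V (z + (0 : ℝ) * h z) ∂μ)
        - ∫ p, (Complex.log (1 + (0 : ℝ) * dividedDiff h p)).re ∂(μ.prod μ)) := by
    rw [← hw 0 (by simp)]
    simp [variation]
  have hlim := tendsto_nhds_unique (d3.congr' ?_) d4
  · linarith
  · have : ∀ᶠ t : ℝ in 𝓝[≠] 0, |t| * K < 1 / 2 := by
      apply eventually_nhdsWithin_of_eventually_nhds
      have : Tendsto (fun t : ℝ => |t| * K) (𝓝 0) (𝓝 (|0| * K)) :=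
        (continuous_abs.mul continuous_const).tendsto 0
      exact this.eventually_lt_const (by simp)
    filter_upwards [this] with t ht
    rw [hw t ht, hw0]
    simp only [Pi.sub_apply, smul_eq_mul, zero_add]
    rw [inv_mul_eq_div]
    ring

/-- The variational (Schiffer) identity satisfied by critical measures. -/
theorem integral_dividedDiff {V : Polynomial ℂ} {μ : Measure ℂ} (hcrit : IsCriticalMeasure V μ)
    {h : ℂ → ℂ} (hh : ContDiff ℝ 2 h) (hc : HasCompactSupport h) :
    ∫ p, dividedDiff h p ∂(μ.prod μ) = ∫ z, V.derivative.eval z * h z ∂μ := by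
  have := hcrit.1.isProbabilityMeasure
  have key : ∀ k : ℂ → ℂ, ContDiff ℝ 2 k → HasCompactSupport k →
      (∫ p, dividedDiff k p ∂(μ.prod μ)).re = (∫ z, V.derivative.eval z * k z ∂μ).re := by
    intro k hk hkc
    obtain ⟨K, hK0, hK⟩ := exists_dividedDiff_bound (hk.of_le one_le_two) hkc
    have i1 : Integrable (dividedDiff k) (μ.prod μ) :=
      Integrable.of_bound (measurable_dividedDiff hk.continuous).aestronglyMeasurable K
        (ae_of_all _ hK)
    have i2 : Integrable (fun z => V.derivative.eval z * k z) μ := by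
      have hck := hk.continuous
      exact Continuous.integrable_of_hasCompactSupport (by fun_prop) hkc.mul_left
    have := integral_re_dividedDiff hcrit hk hkc
    have e1 := Complex.reCLM.integral_comp_comm i1
    have e2 := Complex.reCLM.integral_comp_comm i2
    simp only [reCLM_apply] at e1 e2
    rw [← e1, ← e2, this]
  apply Complex.ext
  · exact key h hh hc
  -- The real identity applied in the direction i h supplies the imaginary part.
  · have := key (fun z => I * h z) (by fun_prop) hc.mul_left
    have e1 : dividedDiff (fun z => I * h z) = fun p => I * dividedDiff h p := by
      ext p; simp only [dividedDiff]; ring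
    have e2 : (fun z => V.derivative.eval z * (I * h z)) =
        fun z => I * (V.derivative.eval z * h z) := by ext z; ring
    rw [e1, e2, integral_const_mul, integral_const_mul] at this
    simpa using this

/-! ### Area integrals of singular kernels. -/

theorem lintegral_ball_norm {k : ℝ → ENNReal} (hk : Measurable k) (r : ℝ) :
    ∫⁻ z in ball (0 : ℂ) r, k ‖z‖ =
      ENNReal.ofReal (2 * π) * ∫⁻ a in Ioo 0 r, ENNReal.ofReal a * k a := by
  have h1 : ∀ z : ℂ, (ball (0 : ℂ) r).indicator (fun z => k ‖z‖) z = (Iio r).indicator k ‖z‖ := by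
    intro z; simp [indicator]
  have hk' : Measurable ((Iio r).indicator k) := hk.indicator measurableSet_Iio
  rw [← lintegral_indicator measurableSet_ball]
  simp only [h1]
  rw [← Complex.lintegral_comp_polarCoord_symm]
  simp only [Complex.norm_polarCoord_symm, smul_eq_mul]
  rw [polarCoord_target, Measure.volume_eq_prod, ← Measure.prod_restrict,
    lintegral_prod _ (Measurable.aemeasurable (by fun_prop))]
  simp only [lintegral_const, Measure.restrict_apply_univ, Real.volume_Ioo]
  rw [lintegral_mul_const _ (by fun_prop), mul_comm]
  congr 1
  · congr 1; ring
  rw [← lintegral_indicator measurableSet_Ioi, ← lintegral_indicator measurableSet_Ioo]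
  congr 1
  ext a
  by_cases ha : 0 < a
  · by_cases har : a < r <;> simp [indicator, ha, har, abs_of_pos ha]
  · simp [indicator, ha]

/-- The part of the disc within distance r of x is bounded by a radial integral after translation;
on the rest the decreasing kernel is at most k(r). The bound is uniform in x. -/
theorem lintegral_ball_sub_le {k : ℝ → ENNReal} (hk : Measurable k) (hanti : AntitoneOn k (Ioi 0))
    {r : ℝ} (hr : 0 < r) (x : ℂ) :
    ∫⁻ z in ball (0 : ℂ) r, k ‖x - z‖ ≤
      ENNReal.ofReal (2 * π) * (∫⁻ a in Ioo 0 r, ENNReal.ofReal a * k a)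
        + k r * ENNReal.ofReal (π * r ^ 2) := by
  have hk2 : Measurable fun z : ℂ => k ‖x - z‖ := by fun_prop
  have h1 : ∫⁻ z in ball x r, k ‖x - z‖ =
      ENNReal.ofReal (2 * π) * ∫⁻ a in Ioo 0 r, ENNReal.ofReal a * k a := by
    rw [← lintegral_ball_norm hk, ← lintegral_indicator measurableSet_ball,
      ← lintegral_indicator measurableSet_ball,
      ← lintegral_add_right_eq_self _ x]
    congr 1
    ext z
    simp [indicator, norm_neg]
  calc ∫⁻ z in ball (0 : ℂ) r, k ‖x - z‖
      ≤ ∫⁻ z in ball x r ∪ (ball 0 r \ ball x r), k ‖x - z‖ := by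
        apply lintegral_mono_set
        intro z hz
        by_cases h : z ∈ ball x r
        · exact Or.inl h
        · exact Or.inr ⟨hz, h⟩
    _ ≤ (∫⁻ z in ball x r, k ‖x - z‖) + ∫⁻ z in ball 0 r \ ball x r, k ‖x - z‖ :=
        lintegral_union_le _ _ _
    _ ≤ _ := by
        rw [h1]
        gcongr
        calc ∫⁻ z in ball 0 r \ ball x r, k ‖x - z‖ ≤ ∫⁻ z in ball 0 r \ ball x r, k r := by
              refine setLIntegral_mono measurable_const fun z hz => ?_
              have : r ≤ ‖x - z‖ := by
                have := hz.2; simp [dist_eq_norm] at this; rwa [norm_sub_rev]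
              exact hanti hr (hr.trans_le this) this
          _ ≤ ∫⁻ z in ball (0 : ℂ) r, k r := lintegral_mono_set sdiff_subset
          _ = _ := by
              rw [lintegral_const, Measure.restrict_apply_univ, Complex.volume_ball,
                mul_comm π, ENNReal.ofReal_mul (by positivity), ENNReal.ofReal_pow hr.le]
              congr 2
              exact (ENNReal.ofReal_coe_nnreal (p := NNReal.pi)).symm

theorem enorm_inv_eq (w : ℂ) : ‖w⁻¹‖ₑ = ENNReal.ofReal (‖w‖⁻¹) := by
  rw [← ofReal_norm, norm_inv]

theorem lintegral_inv_sub_le {r : ℝ} (hr : 0 < r) (x : ℂ) :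
    ∫⁻ z in ball (0 : ℂ) r, ‖(x - z)⁻¹‖ₑ ≤ ENNReal.ofReal (3 * π * r) := by
  simp only [enorm_inv_eq]
  refine (lintegral_ball_sub_le (k := fun a => ENNReal.ofReal a⁻¹) (by fun_prop) ?_ hr x).trans ?_
  · intro a ha b hb hab
    exact ENNReal.ofReal_le_ofReal (inv_anti₀ ha hab)
  · have : ∫⁻ a in Ioo 0 r, ENNReal.ofReal a * ENNReal.ofReal a⁻¹ = ENNReal.ofReal r := by
      rw [setLIntegral_congr_fun (g := fun _ => 1) measurableSet_Ioo]
      · simp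
      · intro a ha
        have : a ≠ 0 := ha.1.ne'
        simp only
        rw [← ENNReal.ofReal_mul ha.1.le, mul_inv_cancel₀ this, ENNReal.ofReal_one]
    rw [this, ← ENNReal.ofReal_mul (by positivity), ← ENNReal.ofReal_mul (by positivity),
      ← ENNReal.ofReal_add (by positivity) (by positivity)]
    apply ENNReal.ofReal_le_ofReal
    field_simp
    linarith

/-- In polar coordinates the integrand becomes 1/(a + d), whose integral log((r + d)/d) grows only
logarithmically as d → 0. -/
theorem lintegral_inv_mul_add_le {r d : ℝ} (hr : 0 < r) (hd : 0 < d) (x : ℂ) :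
    ∫⁻ z in ball (0 : ℂ) r, ENNReal.ofReal ((‖x - z‖ * (‖x - z‖ + d))⁻¹) ≤
      ENNReal.ofReal (2 * π * (r + 1 + |Real.log d|) + π) := by
  refine (lintegral_ball_sub_le (k := fun a => ENNReal.ofReal (a * (a + d))⁻¹) (by fun_prop)
    ?_ hr x).trans ?_
  · intro a ha b hb hab
    have ha : 0 < a := ha
    have hb : 0 ≤ b := le_of_lt hb
    refine ENNReal.ofReal_le_ofReal (inv_anti₀ (by positivity) ?_)
    gcongr
  · have : ∫⁻ a in Ioo 0 r, ENNReal.ofReal a * ENNReal.ofReal (a * (a + d))⁻¹ =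
        ENNReal.ofReal (Real.log (r + d) - Real.log d) := by
      rw [setLIntegral_congr_fun (g := fun a => ENNReal.ofReal (a + d)⁻¹) measurableSet_Ioo]
      · have hi : IntervalIntegrable (fun a => (a + d)⁻¹) volume 0 r := by
          apply ContinuousOn.intervalIntegrable
          intro a ha
          rw [uIcc_of_le hr.le] at ha
          have : a + d ≠ 0 := by linarith [ha.1]
          exact ContinuousAt.continuousWithinAt (by fun_prop (disch := assumption))
        have := intervalIntegral.integral_eq_sub_of_hasDerivAt (a := 0) (b := r)
          (f := fun a => Real.log (a + d)) (f' := fun a => (a + d)⁻¹) ?_ hi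
        · simp only [zero_add] at this
          rw [← this, intervalIntegral.integral_of_le hr.le, integral_Ioc_eq_integral_Ioo,
            ofReal_integral_eq_lintegral_ofReal]
          · exact (intervalIntegrable_iff_integrableOn_Ioo_of_le hr.le).1 hi
          · refine (ae_restrict_iff' measurableSet_Ioo).2 (ae_of_all _ fun a ha => ?_)
            have := ha.1
            simp only [Pi.zero_apply]
            positivity
        · intro a ha
          rw [uIcc_of_le hr.le] at ha
          have : a + d ≠ 0 := by linarith [ha.1]
          simpa using ((hasDerivAt_id a).add_const d).log this
      · intro a ha
        have h0 : 0 < a := ha.1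
        simp only
        rw [← ENNReal.ofReal_mul ha.1.le]
        congr 1
        field_simp
    rw [this, ← ENNReal.ofReal_mul (by positivity), ← ENNReal.ofReal_mul (by positivity)]
    have hlog : Real.log (r + d) - Real.log d ≤ r + 1 + |Real.log d| := by
      have h1 : Real.log (r + d) ≤ r + max (Real.log d) 0 := by
        have : r + d ≤ Real.exp r * Real.exp (max (Real.log d) 0) := by
          have h3 := Real.add_one_le_exp r
          have h4 : d ≤ Real.exp (max (Real.log d) 0) := by
            conv_lhs => rw [← Real.exp_log hd]
            exact Real.exp_le_exp.2 (le_max_left _ _)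
          have h5 : 1 ≤ Real.exp (max (Real.log d) 0) :=
            Real.one_le_exp (le_max_right _ _)
          nlinarith
        rw [← Real.exp_add] at this
        exact (Real.log_le_iff_le_exp (by positivity)).2 this
      rcases le_total 0 (Real.log d) with h | h
      · rw [max_eq_left h] at h1
        rw [abs_of_nonneg h]; linarith
      · rw [max_eq_right h] at h1
        rw [abs_of_nonpos h]; linarith
    have hlog0 : 0 ≤ Real.log (r + d) - Real.log d := by
      have := Real.log_le_log hd (by linarith : d ≤ r + d)
      linarith
    rw [← ENNReal.ofReal_add (by positivity) (by positivity)]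
    apply ENNReal.ofReal_le_ofReal
    have : (r * (r + d))⁻¹ * (π * r ^ 2) ≤ π := by
      rw [inv_mul_le_iff₀ (by positivity)]
      nlinarith [pi_pos, mul_pos pi_pos (mul_pos hr hd)]
    gcongr

/-- With a = |x - z|, b = |y - z|, split 1/(ab) = 1/(a(a + b)) + 1/(b(a + b)); the triangle
inequality a + b ≥ d lets d replace the other distance at the cost of a factor 2. The resulting
logarithm of |x - y| is what ties L² bounds to the energy. -/
theorem lintegral_inv_mul_inv_le {r : ℝ} (hr : 1 ≤ r) {x y : ℂ} (hxy : x ≠ y) :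
    ∫⁻ z in ball (0 : ℂ) r, ‖(x - z)⁻¹‖ₑ * ‖(y - z)⁻¹‖ₑ ≤
      ENNReal.ofReal (20 * π * r) + ENNReal.ofReal (8 * π) * ENNReal.ofReal |Real.log ‖x - y‖| := by
  set d := ‖x - y‖ with hd
  have hd0 : 0 < d := norm_pos_iff.2 (sub_ne_zero.2 hxy)
  have hr0 : 0 < r := by linarith
  have hpt : ∀ z, ‖(x - z)⁻¹‖ₑ * ‖(y - z)⁻¹‖ₑ ≤
      2 * ENNReal.ofReal ((‖x - z‖ * (‖x - z‖ + d))⁻¹) +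
      2 * ENNReal.ofReal ((‖y - z‖ * (‖y - z‖ + d))⁻¹) := by
    intro z
    rw [enorm_inv_eq, enorm_inv_eq, ← ENNReal.ofReal_mul (by positivity)]
    have h2 : (2 : ENNReal) = ENNReal.ofReal 2 := by simp
    rw [h2, ← ENNReal.ofReal_mul (by positivity), ← ENNReal.ofReal_mul (by positivity),
      ← ENNReal.ofReal_add (by positivity) (by positivity)]
    apply ENNReal.ofReal_le_ofReal
    have htri : d ≤ ‖x - z‖ + ‖y - z‖ := by
      rw [hd, norm_sub_rev y z]; exact norm_sub_le_norm_sub_add_norm_sub x z y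
    rcases (norm_nonneg (x - z)).eq_or_lt' with ha | ha
    · rw [ha]; simp; positivity
    rcases (norm_nonneg (y - z)).eq_or_lt' with hb | hb
    · rw [hb]; simp; positivity
    generalize ‖x - z‖ = a at *
    generalize ‖y - z‖ = b at *
    have e1 : a⁻¹ * b⁻¹ = (a * (a + b))⁻¹ + (b * (a + b))⁻¹ := by field_simp; ring
    rw [e1]
    have e2 : ∀ c > 0, (a + d) ≤ 2 * (a + b) → (c * (a + b))⁻¹ ≤ 2 * (c * (a + d))⁻¹ := by
      intro c hc h
      rw [← div_eq_mul_inv, le_div_iff₀ (by positivity), inv_mul_le_iff₀ (by positivity)]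
      nlinarith
    have e3 : ∀ c > 0, (b + d) ≤ 2 * (a + b) → (c * (a + b))⁻¹ ≤ 2 * (c * (b + d))⁻¹ := by
      intro c hc h
      rw [← div_eq_mul_inv, le_div_iff₀ (by positivity), inv_mul_le_iff₀ (by positivity)]
      nlinarith
    exact add_le_add (e2 a ha (by linarith)) (e3 b hb (by linarith))
  calc ∫⁻ z in ball (0 : ℂ) r, ‖(x - z)⁻¹‖ₑ * ‖(y - z)⁻¹‖ₑ
      ≤ ∫⁻ z in ball (0 : ℂ) r, (2 * ENNReal.ofReal ((‖x - z‖ * (‖x - z‖ + d))⁻¹) +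
      2 * ENNReal.ofReal ((‖y - z‖ * (‖y - z‖ + d))⁻¹)) := lintegral_mono fun z => hpt z
    _ = 2 * (∫⁻ z in ball (0 : ℂ) r, ENNReal.ofReal ((‖x - z‖ * (‖x - z‖ + d))⁻¹)) +
      2 * ∫⁻ z in ball (0 : ℂ) r, ENNReal.ofReal ((‖y - z‖ * (‖y - z‖ + d))⁻¹) := by
        rw [lintegral_add_left (by fun_prop), lintegral_const_mul _ (by fun_prop),
          lintegral_const_mul _ (by fun_prop)]
    _ ≤ 2 * ENNReal.ofReal (2 * π * (r + 1 + |Real.log d|) + π) +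
        2 * ENNReal.ofReal (2 * π * (r + 1 + |Real.log d|) + π) := by
        gcongr
        · exact lintegral_inv_mul_add_le hr0 hd0 x
        · exact lintegral_inv_mul_add_le hr0 hd0 y
    _ ≤ _ := by
        have h2 : (2 : ENNReal) = ENNReal.ofReal 2 := by simp
        rw [h2, ← ENNReal.ofReal_mul (by positivity), ← ENNReal.ofReal_mul (by positivity),
          ← ENNReal.ofReal_add (by positivity) (by positivity),
          ← ENNReal.ofReal_add (by positivity) (by positivity)]
        apply ENNReal.ofReal_le_ofReal
        nlinarith [pi_pos, mul_le_mul_of_nonneg_left hr pi_pos.le]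

/-! ### The Cauchy transform, its square, and their ∂̄-derivatives. -/

/-- The Cauchy transform `z ↦ ∫ dμ(x) / (x - z)`. -/
def cauchyTransform (μ : Measure ℂ) (z : ℂ) : ℂ := ∫ x, (x - z)⁻¹ ∂μ

/-- The potential `z ↦ ∫ dμ(x) / |x - z|`, with values in `[0, ∞]`. -/
def rieszPotential (μ : Measure ℂ) (z : ℂ) : ENNReal := ∫⁻ x, ‖(x - z)⁻¹‖ₑ ∂μ

theorem enorm_cauchyTransform_le (μ : Measure ℂ) (z : ℂ) :
    ‖cauchyTransform μ z‖ₑ ≤ rieszPotential μ z := enorm_integral_le_lintegral_enorm _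

theorem stronglyMeasurable_cauchyTransform (μ : Measure ℂ) [SFinite μ] :
    StronglyMeasurable (cauchyTransform μ) := by
  have : Measurable fun p : ℂ × ℂ => (p.2 - p.1)⁻¹ := by fun_prop
  exact this.stronglyMeasurable.integral_prod_right

theorem measurable_rieszPotential (μ : Measure ℂ) [SFinite μ] :
    Measurable (rieszPotential μ) := by
  have : Measurable fun p : ℂ × ℂ => ‖(p.2 - p.1)⁻¹‖ₑ := by fun_prop
  exact this.lintegral_prod_right'

section Probability

variable {μ : Measure ℂ} [IsProbabilityMeasure μ]

theorem lintegral_rieszPotential_le {r : ℝ} (hr : 0 < r) :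
    ∫⁻ z in ball (0 : ℂ) r, rieszPotential μ z ≤ ENNReal.ofReal (3 * π * r) := by
  unfold rieszPotential
  rw [lintegral_lintegral_swap (Measurable.aemeasurable (by fun_prop))]
  calc _ ≤ ∫⁻ x, ENNReal.ofReal (3 * π * r) ∂μ := lintegral_mono fun x => lintegral_inv_sub_le hr x
    _ = _ := by simp

theorem rieszPotential_sq (z : ℂ) : rieszPotential μ z ^ 2 =
    ∫⁻ p, ‖(p.1 - z)⁻¹‖ₑ * ‖(p.2 - z)⁻¹‖ₑ ∂(μ.prod μ) := by
  rw [lintegral_prod_mul (f := fun x => ‖(x - z)⁻¹‖ₑ) (g := fun x => ‖(x - z)⁻¹‖ₑ)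
    (by fun_prop) (by fun_prop), sq]
  rfl

/-- Expanding the square as a double integral and exchanging the order leaves the kernel estimate
integrated against μ × μ, which is finite by finiteness of the energy. The explicit dependence on r
later becomes polynomial growth. -/
theorem lintegral_rieszPotential_sq_le (hfin : HasFiniteLogEnergy μ) :
    ∃ E : ℝ, 0 ≤ E ∧ ∀ r : ℝ, 1 ≤ r →
      ∫⁻ z in ball (0 : ℂ) r, rieszPotential μ z ^ 2 ≤ ENNReal.ofReal (20 * π * r + E) := by
  have hE : ∫⁻ p : ℂ × ℂ, ENNReal.ofReal |Real.log ‖p.1 - p.2‖| ∂(μ.prod μ) < ⊤ := by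
    have := (integrable_log_prod hfin).2
    unfold HasFiniteIntegral at this
    simpa [Real.enorm_eq_ofReal_abs] using this
  set E := ∫⁻ p : ℂ × ℂ, ENNReal.ofReal |Real.log ‖p.1 - p.2‖| ∂(μ.prod μ) with hEdef
  refine ⟨(ENNReal.ofReal (8 * π) * E).toReal, ENNReal.toReal_nonneg, fun r hr => ?_⟩
  have hfinE : ENNReal.ofReal (8 * π) * E ≠ ⊤ := ENNReal.mul_ne_top ENNReal.ofReal_ne_top hE.ne
  rw [ENNReal.ofReal_add (by positivity) ENNReal.toReal_nonneg, ENNReal.ofReal_toReal hfinE]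
  simp only [rieszPotential_sq]
  rw [lintegral_lintegral_swap (Measurable.aemeasurable (by fun_prop))]
  calc _ ≤ ∫⁻ p : ℂ × ℂ, (ENNReal.ofReal (20 * π * r) +
          ENNReal.ofReal (8 * π) * ENNReal.ofReal |Real.log ‖p.1 - p.2‖|) ∂(μ.prod μ) := by
        refine lintegral_mono_ae ?_
        filter_upwards [ae_prod_ne hfin] with p hp
        exact lintegral_inv_mul_inv_le hr hp
    _ = _ := by
        rw [lintegral_add_left (by fun_prop), lintegral_const_mul _ (by fun_prop)]
        simp [hEdef]

theorem lintegral_enorm_mul_lt_top {D : ℂ → ℂ} (hD : Continuous D) (hDc : HasCompactSupport D)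
    {g : ℂ → ENNReal} (hg : ∀ r : ℝ, 1 ≤ r → ∫⁻ z in ball (0 : ℂ) r, g z < ⊤)
    (hgm : Measurable g) : ∫⁻ z, ‖D z‖ₑ * g z < ⊤ := by
  obtain ⟨M, r, hM0, hr1, hM, hr⟩ := exists_bound_support hD hDc
  calc ∫⁻ z, ‖D z‖ₑ * g z ≤ ∫⁻ z, (ball (0 : ℂ) r).indicator (fun z => ENNReal.ofReal M * g z) z := by
        refine lintegral_mono fun z => ?_
        by_cases hz : z ∈ ball (0 : ℂ) r
        · rw [indicator_of_mem hz]
          gcongr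
          rw [← ofReal_norm]
          exact ENNReal.ofReal_le_ofReal (hM z)
        · simp at hz
          simp [hr z hz]
    _ = ENNReal.ofReal M * ∫⁻ z in ball (0 : ℂ) r, g z := by
        rw [lintegral_indicator measurableSet_ball, lintegral_const_mul _ hgm]
    _ < ⊤ := ENNReal.mul_lt_top ENNReal.ofReal_lt_top (hg r hr1)

theorem integrable_mul_inv_prod {D : ℂ → ℂ} (hD : Continuous D) (hDc : HasCompactSupport D) :
    Integrable (fun p : ℂ × ℂ => D p.1 * (p.2 - p.1)⁻¹) (volume.prod μ) := by
  have hm : Measurable (fun p : ℂ × ℂ => D p.1 * (p.2 - p.1)⁻¹) := by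
    have := hD.measurable
    fun_prop
  refine ⟨hm.aestronglyMeasurable, ?_⟩
  unfold HasFiniteIntegral
  rw [lintegral_prod _ hm.enorm.aemeasurable]
  simp only [enorm_mul]
  have : ∀ z, ∫⁻ x, ‖D z‖ₑ * ‖(x - z)⁻¹‖ₑ ∂μ = ‖D z‖ₑ * rieszPotential μ z := fun z => by
    rw [lintegral_const_mul _ (by fun_prop)]; rfl
  simp only [this]
  exact lintegral_enorm_mul_lt_top hD hDc (fun r hr => (lintegral_rieszPotential_le
    (by linarith)).trans_lt ENNReal.ofReal_lt_top) (measurable_rieszPotential μ)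

theorem integrable_mul_inv_inv_prod (hfin : HasFiniteLogEnergy μ) {D : ℂ → ℂ}
    (hD : Continuous D) (hDc : HasCompactSupport D) :
    Integrable (fun p : ℂ × (ℂ × ℂ) => D p.1 * ((p.2.1 - p.1)⁻¹ * (p.2.2 - p.1)⁻¹))
      (volume.prod (μ.prod μ)) := by
  have hm : Measurable (fun p : ℂ × (ℂ × ℂ) => D p.1 * ((p.2.1 - p.1)⁻¹ * (p.2.2 - p.1)⁻¹)) := by
    have := hD.measurable
    fun_prop
  refine ⟨hm.aestronglyMeasurable, ?_⟩
  unfold HasFiniteIntegral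
  rw [lintegral_prod _ hm.enorm.aemeasurable]
  simp only [enorm_mul]
  have : ∀ z, ∫⁻ p : ℂ × ℂ, ‖D z‖ₑ * (‖(p.1 - z)⁻¹‖ₑ * ‖(p.2 - z)⁻¹‖ₑ) ∂(μ.prod μ) =
      ‖D z‖ₑ * rieszPotential μ z ^ 2 := fun z => by
    rw [lintegral_const_mul _ (by fun_prop), rieszPotential_sq]
  simp only [this]
  obtain ⟨E, -, hE⟩ := lintegral_rieszPotential_sq_le hfin
  exact lintegral_enorm_mul_lt_top hD hDc (fun r hr => (hE r hr).trans_lt ENNReal.ofReal_lt_top)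
    ((measurable_rieszPotential μ).pow_const 2)

theorem integral_mul_cauchyTransform {D : ℂ → ℂ} (hD : Continuous D) (hDc : HasCompactSupport D) :
    ∫ z, D z * cauchyTransform μ z = ∫ x, (∫ z, D z / (x - z)) ∂μ := by
  have := integral_integral_swap (f := fun z x => D z * (x - z)⁻¹) (integrable_mul_inv_prod (μ := μ)
    hD hDc)
  simp only [integral_const_mul] at this
  exact this

theorem integrable_mul_cauchyTransform {D : ℂ → ℂ} (hD : Continuous D)
    (hDc : HasCompactSupport D) : Integrable (fun z => D z * cauchyTransform μ z) := by
  have := (integrable_mul_inv_prod (μ := μ) hD hDc).integral_prod_left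
  simp only [integral_const_mul] at this
  exact this

theorem integral_inv_mul_inv (z : ℂ) :
    ∫ p, (p.1 - z)⁻¹ * (p.2 - z)⁻¹ ∂(μ.prod μ) = cauchyTransform μ z ^ 2 := by
  rw [integral_prod_mul (fun x => (x - z)⁻¹) (fun x => (x - z)⁻¹), sq]; rfl

theorem integral_mul_cauchyTransform_sq (hfin : HasFiniteLogEnergy μ) {D : ℂ → ℂ}
    (hD : Continuous D) (hDc : HasCompactSupport D) :
    ∫ z, D z * cauchyTransform μ z ^ 2 =
      ∫ p, (∫ z, D z * ((p.1 - z)⁻¹ * (p.2 - z)⁻¹)) ∂(μ.prod μ) := by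
  have := integral_integral_swap (f := fun z (p : ℂ × ℂ) => D z * ((p.1 - z)⁻¹ * (p.2 - z)⁻¹))
    (integrable_mul_inv_inv_prod hfin hD hDc)
  simp only [integral_const_mul, integral_inv_mul_inv] at this
  exact this

theorem integrable_mul_cauchyTransform_sq (hfin : HasFiniteLogEnergy μ) {D : ℂ → ℂ}
    (hD : Continuous D) (hDc : HasCompactSupport D) :
    Integrable (fun z => D z * cauchyTransform μ z ^ 2) := by
  have := (integrable_mul_inv_inv_prod hfin hD hDc).integral_prod_left
  simp only [integral_const_mul, integral_inv_mul_inv] at this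
  exact this

/-- The Cauchy kernel at x is the Cauchy transform of the Dirac mass at x. -/
theorem integrable_div_sub {D : ℂ → ℂ} (hD : Continuous D) (hDc : HasCompactSupport D) (x : ℂ) :
    Integrable (fun z => D z / (x - z)) := by
  have := integrable_mul_cauchyTransform (μ := Measure.dirac x) hD hDc
  simpa [cauchyTransform, div_eq_mul_inv] using this

/-- As a distribution, `∂/∂z̄` of the Cauchy transform of `μ` is `-π μ`. -/
theorem integral_dbar_mul_cauchyTransform {h : ℂ → ℂ} (hh : ContDiff ℝ 1 h)
    (hc : HasCompactSupport h) :
    ∫ z, dbar h z * cauchyTransform μ z = π * ∫ x, h x ∂μ := by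
  rw [integral_mul_cauchyTransform (continuous_dbar hh) (hasCompactSupport_dbar hc)]
  simp only [cauchy_pompeiu hh hc]
  rw [integral_const_mul]

/-- Partial fractions reduce the product to a difference of two Cauchy kernels, and Cauchy–Pompeiu
evaluates each of them. -/
theorem integral_dbar_mul_inv_inv {h : ℂ → ℂ} (hh : ContDiff ℝ 1 h)
    (hc : HasCompactSupport h) {x y : ℂ} (hxy : x ≠ y) :
    ∫ z, dbar h z * ((x - z)⁻¹ * (y - z)⁻¹) = -π * dividedDiff h (x, y) := by
  have hxy' : x - y ≠ 0 := sub_ne_zero.2 hxy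
  have h1 : ∀ᵐ z, dbar h z * ((x - z)⁻¹ * (y - z)⁻¹) =
      (-(x - y)⁻¹) * (dbar h z / (x - z) - dbar h z / (y - z)) := by
    have hfin : ({x, y} : Set ℂ).Countable := (Set.toFinite _).countable
    filter_upwards [hfin.ae_notMem volume] with z hz
    simp only [mem_insert_iff, mem_singleton_iff, not_or] at hz
    have h2 : x - z ≠ 0 := sub_ne_zero.2 (Ne.symm hz.1)
    have h3 : y - z ≠ 0 := sub_ne_zero.2 (Ne.symm hz.2)
    field_simp
    ring
  have hi := integrable_div_sub (continuous_dbar hh) (hasCompactSupport_dbar hc)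
  rw [integral_congr_ae h1, integral_const_mul, integral_sub (hi x) (hi y), cauchy_pompeiu hh hc,
    cauchy_pompeiu hh hc, dividedDiff]
  field_simp

end Probability

/-- The function `(∫ dμ(x)/(x-z) + V'(z)/2)²` attached to a critical measure is weakly
holomorphic. -/
theorem integral_dbar_mul_sq {V : Polynomial ℂ} {μ : Measure ℂ} (hcrit : IsCriticalMeasure V μ)
    {h : ℂ → ℂ} (hh : ContDiff ℝ 2 h) (hc : HasCompactSupport h) :
    ∫ z, dbar h z * (cauchyTransform μ z + V.derivative.eval z / 2) ^ 2 = 0 := by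
  have hprob := hcrit.1.isProbabilityMeasure
  have hfin := hcrit.1.finite_energy
  have hh1 := hh.of_le one_le_two
  have hVd : ∀ F : Polynomial ℂ, ∀ z, dbar (fun w => F.eval w * h w) z = F.eval z * dbar h z :=
    fun F z => dbar_holomorphic_mul F.differentiableAt (hh1.differentiable one_ne_zero z)
  have hF1 : ∀ F : Polynomial ℂ, ContDiff ℝ 1 (fun w => F.eval w * h w) := fun F =>
    (F.differentiable.contDiff.restrict_scalars ℝ).mul hh1
  have hF2 : ∀ F : Polynomial ℂ, HasCompactSupport (fun w => F.eval w * h w) :=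
    fun F => hc.mul_left
  set F := V.derivative with hF
  have hDc := continuous_dbar hh1
  have hDs := hasCompactSupport_dbar hc
  have hV1 : Continuous fun z => F.eval z * dbar h z := by fun_prop
  have hV2 : HasCompactSupport fun z => F.eval z * dbar h z := hDs.mul_left
  have i1 := integrable_mul_cauchyTransform_sq hfin hDc hDs
  have i2 := integrable_mul_cauchyTransform (μ := μ) hV1 hV2
  have i3 : Integrable fun z => (F * F).eval z * dbar h z / 4 := by
    refine Continuous.integrable_of_hasCompactSupport (by fun_prop) ?_
    simp only [div_eq_mul_inv]
    exact (hDs.mul_left).mul_right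
  have e0 : ∀ z, dbar h z * (cauchyTransform μ z + F.eval z / 2) ^ 2 =
      (dbar h z * cauchyTransform μ z ^ 2 + F.eval z * dbar h z * cauchyTransform μ z) +
        (F * F).eval z * dbar h z / 4 := by
    intro z; rw [Polynomial.eval_mul]; ring
  simp only [e0]
  -- Polynomial factors pass under ∂̄, so this is the integral of ∂̄ of a compactly supported
  -- function.
  have e3 : ∫ z, (F * F).eval z * dbar h z = 0 := by
    simp only [← hVd]; exact integral_dbar (hF1 _) (hF2 _)
  have e2 : ∫ z, F.eval z * dbar h z * cauchyTransform μ z = π * ∫ x, F.eval x * h x ∂μ := by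
    simp only [← hVd]; exact integral_dbar_mul_cauchyTransform (hF1 _) (hF2 _)
  have e1 : ∫ z, dbar h z * cauchyTransform μ z ^ 2 = -π * ∫ p, dividedDiff h p ∂(μ.prod μ) := by
    rw [integral_mul_cauchyTransform_sq hfin hDc hDs, ← integral_const_mul]
    refine integral_congr_ae ?_
    filter_upwards [ae_prod_ne hfin] with p hp
    exact integral_dbar_mul_inv_inv hh1 hc hp
  have i12 : Integrable (fun z => dbar h z * cauchyTransform μ z ^ 2 +
      F.eval z * dbar h z * cauchyTransform μ z) := i1.add i2
  -- The variational identity makes the cross term π∫V'h dμ cancel the square term.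
  rw [integral_add i12 i3, integral_add i1 i2, integral_div, e3, e2, e1,
    integral_dividedDiff hcrit hh hc]
  ring

/-! ### Radial integration, mollification and Weyl's lemma. -/

section Radial

variable {E : Type*} [NormedAddCommGroup E] [NormedSpace ℝ E]

theorem integral_Ioo_polar (f : ℂ → E) (a : ℝ) :
    ∫ θ in Ioo (-π) π, f (Complex.polarCoord.symm (a, θ)) = (2 * π) • circleAverage f 0 a := by
  have h1 : ∀ θ : ℝ, Complex.polarCoord.symm (a, θ) = circleMap 0 a θ := by
    intro θ
    rw [Complex.polarCoord_symm_apply, circleMap, zero_add, Complex.exp_mul_I]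
    push_cast; rfl
  simp only [h1]
  have hper : Function.Periodic (fun θ => f (circleMap 0 a θ)) (2 * π) :=
    (periodic_circleMap 0 a).comp f
  have h2 := hper.intervalIntegral_add_eq (-π) 0
  rw [zero_add, (by ring : -π + 2 * π = π), intervalIntegral.integral_of_le (by linarith [pi_pos]),
    integral_Ioc_eq_integral_Ioo] at h2
  rw [h2, circleAverage_def, smul_smul, mul_inv_cancel₀ (by positivity), one_smul]

/-- Integration of a radial weight against a function in terms of circle averages. -/
theorem integral_norm_smul {k : ℝ → ℝ} (hk : Measurable k) {f : ℂ → E}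
    (hf : StronglyMeasurable f) (hi : Integrable fun z => k ‖z‖ • f z) :
    ∫ z, k ‖z‖ • f z = ∫ a in Ioi (0 : ℝ), (2 * π * a * k a) • circleAverage f 0 a := by
  rw [← Complex.integral_comp_polarCoord_symm, polarCoord_target, Measure.volume_eq_prod,
    setIntegral_prod]
  · refine setIntegral_congr_fun measurableSet_Ioi fun a ha => ?_
    simp only [Complex.norm_polarCoord_symm, abs_of_pos (mem_Ioi.1 ha)]
    rw [integral_smul, integral_smul, integral_Ioo_polar, smul_smul, smul_smul]
    congr 1; ring
  · have hm : Measurable fun p : ℝ × ℝ => Complex.polarCoord.symm p := by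
      simp only [Complex.polarCoord_symm_apply]; fun_prop
    have hsm : StronglyMeasurable fun z => k ‖z‖ • f z :=
      (hk.comp measurable_norm).stronglyMeasurable.smul hf
    refine ⟨(measurable_fst.stronglyMeasurable.smul
      (hsm.comp_measurable hm)).aestronglyMeasurable, ?_⟩
    have h2 := hi.2
    unfold HasFiniteIntegral at h2 ⊢
    rw [← Complex.lintegral_comp_polarCoord_symm, polarCoord_target] at h2
    rw [← Measure.volume_eq_prod]
    refine lt_of_eq_of_lt ?_ h2
    refine setLIntegral_congr_fun (measurableSet_Ioi.prod measurableSet_Ioo) fun p hp => ?_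
    simp only [enorm_smul, smul_eq_mul]
    rw [Real.enorm_eq_ofReal (le_of_lt hp.1)]

end Radial

section Mollify

variable {E : Type*} [NormedAddCommGroup E] [NormedSpace ℝ E]

/-- The convolution `∫ k(t) f(x - t) dt`. -/
def mollify (k : ℂ → ℝ) (f : ℂ → E) : ℂ → E :=
  convolution k f (ContinuousLinearMap.lsmul ℝ ℝ) volume

theorem mollify_apply (k : ℂ → ℝ) (f : ℂ → E) (x : ℂ) :
    mollify k f x = ∫ t, k t • f (x - t) := rfl

/-- The derivative falls on the kernel. The integral is arranged so that t ↦ k(x - t) can serve as a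
test function against f. -/
theorem hasFDerivAt_mollify {k : ℂ → ℝ} {f : ℂ → E} (hk : ContDiff ℝ 1 k)
    (hkc : HasCompactSupport k) (hf : LocallyIntegrable f) (x : ℂ) :
    ∃ L : ℂ →L[ℝ] E, HasFDerivAt (mollify k f) L x ∧
      ∀ v, L v = ∫ t, fderiv ℝ k (x - t) v • f t := by
  refine ⟨_, hkc.hasFDerivAt_convolution_left (ContinuousLinearMap.lsmul ℝ ℝ) hk hf x, fun v => ?_⟩
  have hex := (hkc.fderiv ℝ).convolutionExists_left
    ((ContinuousLinearMap.lsmul ℝ ℝ : ℝ →L[ℝ] E →L[ℝ] E).precompL ℂ)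
    (hk.continuous_fderiv one_ne_zero) hf x
  rw [convolution_def, ContinuousLinearMap.integral_apply hex,
    ← integral_sub_left_eq_self _ volume x]
  simp [ContinuousLinearMap.precompL_apply]

theorem mollify_comm [CompleteSpace E] {k l : ℂ → ℝ} {f : ℂ → E} (hk : Continuous k) (hkc : HasCompactSupport k)
    (hl : Continuous l) (hlc : HasCompactSupport l) (hf : LocallyIntegrable f) :
    mollify k (mollify l f) = mollify l (mollify k f) := by
  have key : ∀ k l : ℂ → ℝ, Continuous k → HasCompactSupport k → Continuous l →
      HasCompactSupport l →
      mollify (convolution k l (ContinuousLinearMap.lsmul ℝ ℝ) volume) f =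
      mollify k (mollify l f) := by
    intro k l hk hkc hl hlc
    ext x
    refine convolution_assoc _ _ _ _ (fun a b c => ?_) hk.aestronglyMeasurable
      hl.aestronglyMeasurable hf.aestronglyMeasurable ?_ ?_ ?_
    · simp [smul_smul, mul_comm]
    · exact ae_of_all _ fun y => hkc.convolutionExists_left _ hk hl.locallyIntegrable y
    · exact ae_of_all _ fun y => hlc.norm.convolutionExists_left _ hl.norm
        (fun x => (hf x).norm) y
    · refine hkc.norm.convolutionExists_left _ hk.norm ?_ x
      exact (hlc.norm.continuous_convolution_left _ hl.norm (fun x => (hf x).norm)).locallyIntegrable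
  rw [← key k l hk hkc hl hlc, ← key l k hl hlc hk hkc]
  congr 1
  rw [← convolution_flip]
  congr 1
  ext; simp

theorem continuous_mollify {k : ℂ → ℝ} {f : ℂ → E} (hk : Continuous k)
    (hkc : HasCompactSupport k) (hf : LocallyIntegrable f) : Continuous (mollify k f) :=
  hkc.continuous_convolution_left _ hk hf

/-- A sequence of bump functions shrinking to the origin. -/
def bumpSeq (n : ℕ) : ContDiffBump (0 : ℂ) :=
  ⟨1 / (2 * (n + 1)), 1 / (n + 1), by positivity, by
    apply one_div_lt_one_div_of_lt <;> linarith [(n.cast_nonneg : (0 : ℝ) ≤ n)]⟩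

theorem tendsto_bumpSeq : Tendsto (fun n => (bumpSeq n).rOut) atTop (𝓝 0) :=
  tendsto_one_div_add_atTop_nhds_zero_nat

theorem ae_tendsto_mollify [CompleteSpace E] {f : ℂ → E} (hf : LocallyIntegrable f) :
    ∀ᵐ x, Tendsto (fun n => mollify ((bumpSeq n).normed volume) f x) atTop (𝓝 (f x)) :=
  ContDiffBump.ae_convolution_tendsto_right_of_locallyIntegrable (K := 2) tendsto_bumpSeq
    (Eventually.of_forall fun n => by simp only [bumpSeq]; field_simp; exact le_rfl) hf

end Mollify

/-- A smooth radial profile. -/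
def radialProfile (a : ℝ) : ℝ := Real.smoothTransition (1 - a ^ 2)

theorem radial_contDiff : ContDiff ℝ 2 (fun z : ℂ => radialProfile ‖z‖) := by
  unfold radialProfile
  refine Real.smoothTransition.contDiff.comp (contDiff_const.sub ?_)
  exact contDiff_norm_sq ℝ

theorem radial_support : HasCompactSupport (fun z : ℂ => radialProfile ‖z‖) := by
  refine HasCompactSupport.intro (isCompact_closedBall (0 : ℂ) 1) fun z hz => ?_
  rw [mem_closedBall_zero_iff, not_le] at hz
  exact Real.smoothTransition.zero_of_nonpos (by nlinarith)

/-- The mass of the radial profile. -/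
def radialMass : ℝ := ∫ z : ℂ, radialProfile ‖z‖

theorem radialMass_pos : 0 < radialMass := by
  refine radial_contDiff.continuous.integral_pos_of_hasCompactSupport_nonneg_nonzero
    radial_support (fun z => Real.smoothTransition.nonneg _) (x := 0) ?_
  simp [radialProfile]

/-- A smooth compactly supported radial probability density. -/
def radialBump (z : ℂ) : ℝ := radialProfile ‖z‖ / radialMass

/-- The mean value property: every circle average of F about x equals F(x), and the radial density
has total mass 1. -/
theorem mollify_radialBump_of_entire {F : ℂ → ℂ} (hF : Differentiable ℂ F) :
    mollify radialBump F = F := by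
  ext x
  have hc : Continuous fun z => F (x - z) := hF.continuous.comp (by fun_prop)
  have hint : Integrable fun z : ℂ => radialProfile ‖z‖ • F (x - z) :=
    Continuous.integrable_of_hasCompactSupport (radial_contDiff.continuous.smul hc)
      radial_support.smul_right
  have hmeas : Measurable radialProfile := by
    unfold radialProfile
    exact Real.smoothTransition.continuous.measurable.comp (by fun_prop)
  have h1 := integral_norm_smul hmeas hc.stronglyMeasurable hint
  have h2 := integral_norm_smul (f := fun _ => (1 : ℝ)) hmeas stronglyMeasurable_const (by
    simpa using radial_contDiff.continuous.integrable_of_hasCompactSupport radial_support)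
  simp only [circleAverage_const, smul_eq_mul, mul_one] at h2
  have h3 : ∀ a : ℝ, circleAverage (fun z => F (x - z)) 0 a = F x := by
    intro a
    have hd : Differentiable ℂ fun z => F (x - z) := by fun_prop
    have := hd.diffContOnCl.circleAverage (c := 0) (R := a)
    simpa using this
  simp only [h3] at h1
  rw [integral_smul_const, ← h2] at h1
  rw [mollify_apply]
  have : ∀ t, radialBump t • F (x - t) = radialMass⁻¹ • (radialProfile ‖t‖ • F (x - t)) := by
    intro t; rw [smul_smul, radialBump, div_eq_inv_mul]
  simp only [this]
  rw [integral_smul, h1, smul_smul]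
  change (radialMass⁻¹ * radialMass) • F x = F x
  rw [inv_mul_cancel₀ radialMass_pos.ne', one_smul]

/-- Testing the weak equation on t ↦ k(x - t) yields the Cauchy–Riemann equation of the
mollification at x. -/
theorem differentiable_mollify {G : ℂ → ℂ} (hG : LocallyIntegrable G)
    (h0 : ∀ h : ℂ → ℂ, ContDiff ℝ 2 h → HasCompactSupport h → ∫ z, dbar h z * G z = 0)
    {k : ℂ → ℝ} (hk : ContDiff ℝ 2 k) (hkc : HasCompactSupport k) :
    Differentiable ℂ (mollify k G) := by
  intro x
  have hk1 := hk.of_le one_le_two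
  obtain ⟨L, hL, hLv⟩ := hasFDerivAt_mollify hk1 hkc hG x
  rw [differentiableAt_complex_iff_differentiableAt_real]
  refine ⟨hL.differentiableAt, ?_⟩
  rw [hL.fderiv]
  set h : ℂ → ℂ := fun t => (k (x - t) : ℂ) with hh
  have hhd : ContDiff ℝ 2 h := Complex.ofRealCLM.contDiff.comp (hk.comp (contDiff_const.sub contDiff_id))
  have hhc : HasCompactSupport h := by
    have h1 : HasCompactSupport fun t => k (x - t) :=
      hkc.comp_homeomorph (Homeomorph.subLeft x)
    exact h1.comp_left (g := fun r : ℝ => (r : ℂ)) (by simp)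
  have hfd : ∀ t v, fderiv ℝ h t v = -((fderiv ℝ k (x - t) v : ℝ) : ℂ) := by
    intro t v
    have d1 : HasFDerivAt (fun t => x - t) (-ContinuousLinearMap.id ℝ ℂ) t := by
      simpa using (hasFDerivAt_id (𝕜 := ℝ) t).const_sub x
    have d2 := (hk1.differentiable one_ne_zero (x - t)).hasFDerivAt.comp t d1
    have d3 := (Complex.ofRealCLM.hasFDerivAt).comp t d2
    have d4 : fderiv ℝ h t = _ := d3.fderiv
    rw [d4]; simp
  have hint : ∀ v, Integrable fun t => fderiv ℝ h t v * G t := by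
    intro v
    have hc1 : Continuous fun t => fderiv ℝ h t v :=
      ((hhd.of_le one_le_two).continuous_fderiv one_ne_zero).clm_apply continuous_const
    have := hG.integrable_smul_left_of_hasCompactSupport (f := G) hc1 (hhc.fderiv_apply ℝ v)
    simpa using this
  have key := h0 h hhd hhc
  have e1 : ∀ z, dbar h z * G z = (fderiv ℝ h z 1 * G z + I * (fderiv ℝ h z I * G z)) / 2 := by
    intro z; rw [dbar]; ring
  simp only [e1] at key
  rw [integral_div, integral_add (hint 1) ((hint I).const_mul I), integral_const_mul] at key
  have e2 : ∀ v, L v = -∫ t, fderiv ℝ h t v * G t := by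
    intro v
    rw [hLv, ← integral_neg]
    congr 1; ext t
    rw [hfd, real_smul]; ring
  rw [e2 1, e2 I, smul_eq_mul]
  linear_combination (2 * I) * key + (-∫ t, fderiv ℝ h t I * G t) * I_mul_I

/-- **Weyl's lemma** for `∂/∂z̄`, with a bound for the holomorphic representative. -/
theorem exists_entire_ae_eq {G : ℂ → ℂ} (hG : LocallyIntegrable G)
    (h0 : ∀ h : ℂ → ℂ, ContDiff ℝ 2 h → HasCompactSupport h → ∫ z, dbar h z * G z = 0) :
    ∃ R : ℂ → ℂ, Differentiable ℂ R ∧ G =ᵐ[volume] R ∧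
      ∃ M : ℝ, 0 < M ∧ ∀ z, ‖R z‖ₑ ≤ ENNReal.ofReal M * ∫⁻ w in ball 0 (‖z‖ + 2), ‖G w‖ₑ := by
  have hrc : ContDiff ℝ 2 radialBump := radial_contDiff.div_const _
  have hrs : HasCompactSupport radialBump := by
    unfold radialBump; simp only [div_eq_mul_inv]; exact radial_support.mul_right
  refine ⟨mollify radialBump G, differentiable_mollify hG h0 hrc hrs, ?_, ?_⟩
  · have hcont := continuous_mollify hrc.continuous hrs hG
    -- Smoothing G by the n-th bump gives an entire function, which radial mollification fixes.
    -- After commuting the two mollifications, one sequence converges both to G and to its radial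
    -- mollification.
    filter_upwards [ae_tendsto_mollify hG, ae_tendsto_mollify hcont.locallyIntegrable] with x h1 h2
    refine tendsto_nhds_unique h1 (h2.congr fun n => ?_)
    have b1 := (bumpSeq n).contDiff_normed (μ := volume) (n := 2)
    have b2 := (bumpSeq n).hasCompactSupport_normed (μ := volume)
    rw [mollify_comm b1.continuous b2 hrc.continuous hrs hG,
      mollify_radialBump_of_entire (differentiable_mollify hG h0 (by exact_mod_cast b1) b2)]
  · obtain ⟨M, -, hM0, -, hM, -⟩ := exists_bound_support hrc.continuous hrs
    refine ⟨M, hM0, fun z => ?_⟩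
    rw [mollify_apply]
    refine (enorm_integral_le_lintegral_enorm _).trans ?_
    have e1 : ∫⁻ t, ‖radialBump t • G (z - t)‖ₑ = ∫⁻ t, ‖radialBump (z - t) • G t‖ₑ := by
      rw [← lintegral_sub_left_eq_self _ z]
      simp
    rw [e1, ← lintegral_const_mul' _ _ ENNReal.ofReal_ne_top, ← lintegral_indicator measurableSet_ball]
    refine lintegral_mono fun t => ?_
    by_cases ht : t ∈ ball (0 : ℂ) (‖z‖ + 2)
    · rw [indicator_of_mem ht, enorm_smul]
      gcongr
      rw [← ofReal_norm]
      exact ENNReal.ofReal_le_ofReal (hM _)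
    · have : radialBump (z - t) = 0 := by
        simp at ht
        have h1 : ‖t‖ ≤ ‖z‖ + ‖z - t‖ := by
          have := norm_sub_le z (z - t); simpa using this
        unfold radialBump radialProfile
        rw [Real.smoothTransition.zero_of_nonpos (by nlinarith), zero_div]
      simp [this]

/-- An entire function of polynomial growth is a polynomial. -/
theorem exists_polynomial_of_growth {F : ℂ → ℂ} (hF : Differentiable ℂ F) {A : ℝ} {k : ℕ}
    (hA : ∀ z, ‖F z‖ ≤ A * (1 + ‖z‖) ^ k) : ∃ p : Polynomial ℂ, ∀ z, F z = p.eval z := by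
  have hz : ∀ n, k < n → iteratedDeriv n F 0 = 0 := by
    intro n hn
    have hA0 : 0 ≤ A := by have := (norm_nonneg _).trans (hA 0); simpa using this
    -- Cauchy's estimate on the circle of radius r; n > k leaves at least one spare power of r.
    have hb : ∀ r : ℝ, 1 ≤ r → ‖iteratedDeriv n F 0‖ ≤ (n.factorial * (A * 2 ^ k)) / r := by
      intro r hr
      have hr0 : 0 < r := by linarith
      have := Complex.norm_iteratedDeriv_le_of_forall_mem_sphere_norm_le (c := 0)
        (C := A * (2 * r) ^ k) n hr0 hF.diffContOnCl (fun z hz => by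
          refine (hA z).trans ?_
          have : ‖z‖ = r := by simpa using hz
          rw [this]
          gcongr
          linarith)
      refine this.trans ?_
      rw [div_le_div_iff₀ (by positivity) hr0, mul_pow]
      have : r ^ k * r ≤ r ^ n := by
        rw [← pow_succ]; exact pow_le_pow_right₀ hr hn
      calc n.factorial * (A * (2 ^ k * r ^ k)) * r = n.factorial * (A * 2 ^ k) * (r ^ k * r) := by ring
        _ ≤ _ := by gcongr
    have hlim : Tendsto (fun r : ℝ => (n.factorial * (A * 2 ^ k)) / r) atTop (𝓝 0) :=
      tendsto_const_nhds.div_atTop tendsto_id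
    have := ge_of_tendsto hlim ((eventually_ge_atTop 1).mono hb)
    exact norm_le_zero_iff.1 this
  refine ⟨∑ n ∈ Finset.range (k + 1), Polynomial.C ((n.factorial : ℂ)⁻¹ * iteratedDeriv n F 0) *
    Polynomial.X ^ n, fun z => ?_⟩
  rw [← Complex.taylorSeries_eq_of_entire' 0 z hF, tsum_eq_sum (s := Finset.range (k + 1))]
  · simp [Polynomial.eval_finsetSum]
  · intro n hn
    rw [Finset.mem_range, not_lt] at hn
    rw [hz n hn]; simp

/-! ### The squared complex gradient is a polynomial. -/

theorem polynomial_growth (p : Polynomial ℂ) :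
    ∃ A : ℝ, 0 ≤ A ∧ ∃ k : ℕ, ∀ z, ‖p.eval z‖ ≤ A * (1 + ‖z‖) ^ k := by
  refine ⟨∑ i ∈ Finset.range (p.natDegree + 1), ‖p.coeff i‖,
    Finset.sum_nonneg fun _ _ => norm_nonneg _, p.natDegree, fun z => ?_⟩
  rw [Polynomial.eval_eq_sum_range, Finset.sum_mul]
  refine norm_sum_le_of_le _ fun i hi => ?_
  rw [norm_mul, norm_pow]
  gcongr
  have h1 : ‖z‖ ^ i ≤ (1 + ‖z‖) ^ i := by gcongr; linarith
  refine h1.trans (pow_le_pow_right₀ (by linarith [norm_nonneg z]) ?_)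
  rw [Finset.mem_range] at hi; omega

theorem enorm_add_sq_le (a b : ℂ) : ‖(a + b) ^ 2‖ₑ ≤ 2 * ‖a‖ₑ ^ 2 + 2 * ‖b‖ₑ ^ 2 := by
  rw [← ofReal_norm, ← ofReal_norm, ← ofReal_norm, ← ENNReal.ofReal_pow (norm_nonneg _),
    ← ENNReal.ofReal_pow (norm_nonneg _), (by simp : (2 : ENNReal) = ENNReal.ofReal 2),
    ← ENNReal.ofReal_mul zero_le_two, ← ENNReal.ofReal_mul zero_le_two,
    ← ENNReal.ofReal_add (by positivity) (by positivity)]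
  apply ENNReal.ofReal_le_ofReal
  rw [norm_pow]
  have := norm_add_le a b
  nlinarith [norm_nonneg (a + b), sq_nonneg (‖a‖ - ‖b‖)]

/-- The complex gradient `∫ dμ(x)/(x-z) + V'(z)/2` of `U^μ + φ/2`. -/
def gradientField (V : Polynomial ℂ) (μ : Measure ℂ) (z : ℂ) : ℂ :=
  cauchyTransform μ z + V.derivative.eval z / 2

theorem stronglyMeasurable_gradientField (V : Polynomial ℂ) (μ : Measure ℂ) [SFinite μ] :
    StronglyMeasurable (gradientField V μ) :=
  (stronglyMeasurable_cauchyTransform μ).add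
    (Continuous.stronglyMeasurable (by fun_prop : Continuous fun z => V.derivative.eval z / 2))

theorem lintegral_gradientField_sq_le (V : Polynomial ℂ) {μ : Measure ℂ} [IsProbabilityMeasure μ]
    (hfin : HasFiniteLogEnergy μ) : ∃ B : ℝ, 0 ≤ B ∧ ∃ k : ℕ, ∀ r : ℝ, 1 ≤ r →
      ∫⁻ z in ball (0 : ℂ) r, ‖gradientField V μ z ^ 2‖ₑ ≤ ENNReal.ofReal (B * (1 + r) ^ k) := by
  obtain ⟨E, hE0, hE⟩ := lintegral_rieszPotential_sq_le hfin
  obtain ⟨A, hA0, k, hA⟩ := polynomial_growth V.derivative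
  refine ⟨40 * π + 2 * E + 2 * A ^ 2 * π, by positivity, 2 * k + 2, fun r hr => ?_⟩
  have hr0 : 0 ≤ r := by linarith
  calc ∫⁻ z in ball (0 : ℂ) r, ‖gradientField V μ z ^ 2‖ₑ
      ≤ ∫⁻ z in ball (0 : ℂ) r, (2 * rieszPotential μ z ^ 2 +
          ENNReal.ofReal (2 * A ^ 2 * (1 + r) ^ (2 * k))) := by
        refine setLIntegral_mono (((measurable_rieszPotential μ).pow_const 2).const_mul 2
          |>.add measurable_const) fun z hz => ?_
        refine (enorm_add_sq_le _ _).trans ?_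
        gcongr
        · exact enorm_cauchyTransform_le μ z
        · rw [← ofReal_norm, ← ENNReal.ofReal_pow (norm_nonneg _),
            (by simp : (2 : ENNReal) = ENNReal.ofReal 2), ← ENNReal.ofReal_mul zero_le_two]
          apply ENNReal.ofReal_le_ofReal
          have h1 : ‖V.derivative.eval z / 2‖ ≤ A * (1 + r) ^ k := by
            rw [norm_div]
            have h2 := hA z
            have h3 : A * (1 + ‖z‖) ^ k ≤ A * (1 + r) ^ k := by
              gcongr; simp at hz; exact hz.le
            have h4 : ‖V.derivative.eval z‖ / ‖(2 : ℂ)‖ ≤ ‖V.derivative.eval z‖ :=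
              div_le_self (norm_nonneg _) (by simp)
            linarith
          calc 2 * ‖V.derivative.eval z / 2‖ ^ 2 ≤ 2 * (A * (1 + r) ^ k) ^ 2 := by gcongr
            _ = _ := by ring
    _ = 2 * (∫⁻ z in ball (0 : ℂ) r, rieszPotential μ z ^ 2) +
          ENNReal.ofReal (2 * A ^ 2 * (1 + r) ^ (2 * k)) * volume (ball (0 : ℂ) r) := by
        rw [lintegral_add_right _ measurable_const, lintegral_const_mul _
          ((measurable_rieszPotential μ).pow_const 2)]
        simp
    _ ≤ ENNReal.ofReal 2 * ENNReal.ofReal (20 * π * r + E) +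
          ENNReal.ofReal (2 * A ^ 2 * (1 + r) ^ (2 * k)) * ENNReal.ofReal (π * r ^ 2) := by
        gcongr
        · simp
        · exact hE r hr
        · rw [Complex.volume_ball, mul_comm π, ENNReal.ofReal_mul (by positivity),
            ENNReal.ofReal_pow hr0]
          apply le_of_eq
          congr 1
          exact (ENNReal.ofReal_coe_nnreal (p := NNReal.pi)).symm
    _ ≤ _ := by
        rw [← ENNReal.ofReal_mul (by positivity), ← ENNReal.ofReal_mul (by positivity),
          ← ENNReal.ofReal_add (by positivity) (by positivity)]
        apply ENNReal.ofReal_le_ofReal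
        have h1 : r ≤ (1 + r) ^ (2 * k + 2) := by
          have := le_self_pow₀ (by linarith : 1 ≤ 1 + r) (n := 2 * k + 2) (by omega)
          linarith
        have h2 : 1 ≤ (1 + r) ^ (2 * k + 2) := one_le_pow₀ (by linarith)
        have h3 : (1 + r) ^ (2 * k) * r ^ 2 ≤ (1 + r) ^ (2 * k + 2) := by
          rw [pow_add]; gcongr; linarith
        calc 2 * (20 * π * r + E) + 2 * A ^ 2 * (1 + r) ^ (2 * k) * (π * r ^ 2)
            = 40 * π * r + 2 * E * 1 + 2 * A ^ 2 * π * ((1 + r) ^ (2 * k) * r ^ 2) := by ring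
          _ ≤ 40 * π * (1 + r) ^ (2 * k + 2) + 2 * E * (1 + r) ^ (2 * k + 2) +
              2 * A ^ 2 * π * (1 + r) ^ (2 * k + 2) := by gcongr
          _ = _ := by ring

theorem locallyIntegrable_of_ball {f : ℂ → ℂ} (hf : AEStronglyMeasurable f)
    (h : ∀ r : ℝ, 1 ≤ r → ∫⁻ z in ball (0 : ℂ) r, ‖f z‖ₑ < ⊤) : LocallyIntegrable f := by
  intro x
  refine ⟨ball 0 (‖x‖ + 1), isOpen_ball.mem_nhds (by simp), hf.restrict, ?_⟩
  exact h _ (by linarith [norm_nonneg x])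

theorem measure_ball_eq_zero_of_integral_bump {μ : Measure ℂ} [IsFiniteMeasure μ] {c : ℂ}
    (φ : ContDiffBump c) (h : ∫ x, φ x ∂μ = 0) : μ (ball c φ.rIn) = 0 := by
  have hi : Integrable φ μ := φ.continuous.integrable_of_hasCompactSupport φ.hasCompactSupport
  have h1 := (integral_eq_zero_iff_of_nonneg (fun x => φ.nonneg) hi).1 h
  refine measure_mono_null (fun x hx => ?_) h1
  have : φ x = 1 := φ.one_of_mem_closedBall (ball_subset_closedBall hx)
  simp [this]

/-- For a critical measure, the square of the complex gradient is a nonzero polynomial. -/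
theorem exists_polynomial_gradientField_sq {V : Polynomial ℂ} {μ : Measure ℂ}
    (hcrit : IsCriticalMeasure V μ) :
    ∃ p : Polynomial ℂ, p ≠ 0 ∧ ∀ᵐ z, gradientField V μ z ^ 2 = p.eval z := by
  have hprob := hcrit.1.isProbabilityMeasure
  have hfin := hcrit.1.finite_energy
  obtain ⟨B, hB0, k, hB⟩ := lintegral_gradientField_sq_le V hfin
  have hloc : LocallyIntegrable (fun z => gradientField V μ z ^ 2) :=
    locallyIntegrable_of_ball ((stronglyMeasurable_gradientField V μ).pow 2).aestronglyMeasurable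
      fun r hr => (hB r hr).trans_lt ENNReal.ofReal_lt_top
  obtain ⟨R, hR, hGR, M, hM0, hM⟩ := exists_entire_ae_eq hloc
    (fun h hh hc => integral_dbar_mul_sq hcrit hh hc)
  have hgrow : ∀ z, ‖R z‖ ≤ (M * B * 3 ^ k) * (1 + ‖z‖) ^ k := by
    intro z
    have h1 := (hM z).trans (mul_le_mul_right (hB (‖z‖ + 2) (by linarith [norm_nonneg z])) _)
    rw [← ENNReal.ofReal_mul hM0.le, ← ofReal_norm, ENNReal.ofReal_le_ofReal_iff (by positivity)] at h1
    refine h1.trans ?_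
    calc M * (B * (1 + (‖z‖ + 2)) ^ k) ≤ M * (B * (3 * (1 + ‖z‖)) ^ k) := by
          gcongr; linarith [norm_nonneg z]
      _ = _ := by rw [mul_pow]; ring
  obtain ⟨p, hp⟩ := exists_polynomial_of_growth hR hgrow
  refine ⟨p, ?_, by filter_upwards [hGR] with z hz; rw [hz, hp]⟩
  -- If p = 0, then C = -V'/2 almost everywhere. Its ∂̄-derivative -πμ then vanishes as a
  -- distribution, which contradicts μ having mass 1.
  rintro rfl
  have hC : ∀ᵐ z, cauchyTransform μ z = -(V.derivative.eval z / 2) := by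
    filter_upwards [hGR] with z hz
    rw [hp] at hz
    have : gradientField V μ z = 0 := by simpa using hz
    exact eq_neg_of_add_eq_zero_left this
  have hzero : ∀ h : ℂ → ℂ, ContDiff ℝ 1 h → HasCompactSupport h → ∫ x, h x ∂μ = 0 := by
    intro h hh hc
    have h1 := integral_dbar_mul_cauchyTransform (μ := μ) hh hc
    have h2 : ∫ z, dbar h z * cauchyTransform μ z =
        ∫ z, -(1 / 2) * dbar (fun w => V.derivative.eval w * h w) z := by
      refine integral_congr_ae ?_
      filter_upwards [hC] with z hz
      rw [dbar_holomorphic_mul V.derivative.differentiableAt (hh.differentiable one_ne_zero z), hz]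
      ring
    have h3 : ContDiff ℝ 1 fun w => V.derivative.eval w * h w :=
      (V.derivative.differentiable.contDiff.restrict_scalars ℝ).mul hh
    rw [h2, integral_const_mul, integral_dbar h3 hc.mul_left, mul_zero] at h1
    simpa [pi_ne_zero] using h1.symm
  have hnull : ∀ n : ℕ, μ (ball 0 (n + 1 : ℝ)) = 0 := by
    intro n
    let φ : ContDiffBump (0 : ℂ) := ⟨n + 1, n + 2, by positivity, by linarith⟩
    refine measure_ball_eq_zero_of_integral_bump φ ?_
    have h1 := hzero (fun x => (φ x : ℂ)) (Complex.ofRealCLM.contDiff.comp φ.contDiff)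
      (φ.hasCompactSupport.comp_left (g := fun r : ℝ => (r : ℂ)) (by simp))
    rw [integral_complex_ofReal] at h1
    exact_mod_cast h1
  have : μ univ = 0 := by
    have h1 : (univ : Set ℂ) = ⋃ n : ℕ, ball 0 (n + 1 : ℝ) := by
      symm
      rw [eq_univ_iff_forall]
      intro x
      obtain ⟨n, hn⟩ := exists_nat_gt ‖x‖
      exact mem_iUnion.2 ⟨n, by simp; linarith⟩
    rw [h1]
    exact measure_iUnion_null hnull
  simp at this

/-! ### From weak to almost everywhere monotonicity. -/

/-- A weakly monotone function is monotone on its Lebesgue set. -/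
theorem exists_ae_monotone {f : ℂ → ℝ} (hf : LocallyIntegrable f) :
    ∃ A : Set ℂ, (∀ᵐ z, z ∈ A) ∧ ∀ (c : ℂ) (ρ : ℝ), ∀ w ∈ A, ∀ w' ∈ A, w ∈ ball c ρ →
      w' ∈ ball c ρ → (∀ ψ : ℂ → ℝ, ContDiff ℝ 2 ψ → HasCompactSupport ψ →
        tsupport ψ ⊆ ball c ρ → (∀ z, 0 ≤ ψ z) → 0 ≤ ∫ z, f z * fderiv ℝ ψ z (w' - w)) →
      f w' ≤ f w := by
  -- The full-measure set, where the mollifications converge to f, is fixed before the ball and the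
  -- direction; one set serves all comparisons.
  refine ⟨_, ae_tendsto_mollify hf, ?_⟩
  intro c ρ w hw w' hw' hwb hwb' hψ
  refine le_of_tendsto_of_tendsto hw' hw ?_
  set m := max (dist w c) (dist w' c) with hm
  have hmρ : m < ρ := max_lt hwb hwb'
  -- The segment from w to w' lies in `closedBall c m`. Bumps of radius below ρ - m, translated to
  -- its points, are supported in `ball c ρ` and so are admissible test functions.
  filter_upwards [tendsto_bumpSeq.eventually_lt_const (sub_pos.2 hmρ)] with n hn
  set k := (bumpSeq n).normed (volume : Measure ℂ) with hk
  have hkd : ContDiff ℝ 2 k := by exact_mod_cast (bumpSeq n).contDiff_normed (μ := volume) (n := 2)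
  have hkc : HasCompactSupport k := (bumpSeq n).hasCompactSupport_normed
  have hkd1 := hkd.of_le one_le_two
  have hder : ∀ x ∈ closedBall c m, ∃ L : ℂ →L[ℝ] ℝ, HasFDerivAt (mollify k f) L x ∧
      L (w' - w) ≤ 0 := by
    intro x hx
    obtain ⟨L, hL, hLv⟩ := hasFDerivAt_mollify hkd1 hkc hf x
    refine ⟨L, hL, ?_⟩
    have hsupp : tsupport (fun t => k (x - t)) ⊆ closedBall x (bumpSeq n).rOut := by
      refine closure_minimal (fun t ht => ?_) isClosed_closedBall
      have h1 : x - t ∈ Function.support k := ht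
      rw [hk, ContDiffBump.support_normed_eq] at h1
      rw [mem_ball_zero_iff] at h1
      rw [mem_closedBall, dist_eq_norm, norm_sub_rev]
      exact h1.le
    have h1 := hψ (fun t => k (x - t)) (hkd.comp (contDiff_const.sub contDiff_id))
      (hkc.comp_homeomorph (Homeomorph.subLeft x)) (hsupp.trans (closedBall_subset_ball' ?_))
      (fun t => (bumpSeq n).nonneg_normed _)
    · rw [hLv]
      have h2 : ∀ t, fderiv ℝ k (x - t) (w' - w) • f t =
          -(f t * fderiv ℝ (fun t => k (x - t)) t (w' - w)) := by
        intro t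
        have d1 : HasFDerivAt (fun t => x - t) (-ContinuousLinearMap.id ℝ ℂ) t := by
          simpa using (hasFDerivAt_id (𝕜 := ℝ) t).const_sub x
        have d2 := (hkd1.differentiable one_ne_zero (x - t)).hasFDerivAt.comp t d1
        have d4 : fderiv ℝ (fun t => k (x - t)) t = _ := d2.fderiv
        rw [d4]; simp; ring
      simp only [h2]
      rw [integral_neg]
      linarith
    · have : dist x c ≤ m := hx
      linarith
  have hseg : ∀ t ∈ Icc (0 : ℝ) 1, w + (t : ℂ) * (w' - w) ∈ closedBall c m := by
    intro t ht
    have := (convex_closedBall c m).add_smul_sub_mem (x := w) (y := w') (t := t)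
      (by simp [hm]) (by simp [hm]) ht
    simpa using this
  have hd : ∀ t ∈ Icc (0 : ℝ) 1, ∃ d : ℝ, d ≤ 0 ∧
      HasDerivAt (fun t : ℝ => mollify k f (w + (t : ℂ) * (w' - w))) d t := by
    intro t ht
    obtain ⟨L, hL, hL0⟩ := hder _ (hseg t ht)
    refine ⟨L (w' - w), hL0, ?_⟩
    have h1 : HasDerivAt (fun t : ℝ => w + (t : ℂ) * (w' - w)) (w' - w) t := by
      simpa using ((Complex.ofRealCLM.hasDerivAt (x := t)).mul_const (w' - w)).const_add w
    exact hL.comp_hasDerivAt t h1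
  have hanti : AntitoneOn (fun t : ℝ => mollify k f (w + (t : ℂ) * (w' - w))) (Icc 0 1) := by
    refine antitoneOn_of_deriv_nonpos (convex_Icc 0 1) ?_ ?_ ?_
    · intro t ht
      obtain ⟨d, -, hd⟩ := hd t ht
      exact hd.continuousAt.continuousWithinAt
    · intro t ht
      obtain ⟨d, -, hd⟩ := hd t (interior_subset ht)
      exact hd.differentiableAt.differentiableWithinAt
    · intro t ht
      obtain ⟨d, hd0, hd⟩ := hd t (interior_subset ht)
      rw [hd.deriv]; exact hd0
  have := hanti (left_mem_Icc.2 zero_le_one) (right_mem_Icc.2 zero_le_one) zero_le_one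
  simpa using this

/-! ### Flat coordinates of the quadratic differential R dz². -/

/-- A conformal coordinate `e` near `z₀` in which the quadratic differential `R dz²` is flat:
`e' = S` with `S² = R`. The inverse coordinate is `κ`. -/
structure FlatChart (R : ℂ → ℂ) (z₀ : ℂ) where
  (S e κ : ℂ → ℂ)
  D : Set ℂ
  ρ : ℝ
  ρ_pos : 0 < ρ
  isOpen_D : IsOpen D
  mem_D : z₀ ∈ D
  e_center : e z₀ = 0
  hasDerivAt_e : ∀ z ∈ D, HasDerivAt e (S z) z
  S_sq : ∀ z ∈ D, S z ^ 2 = R z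
  S_ne : ∀ z ∈ D, S z ≠ 0
  differentiableOn_S : DifferentiableOn ℂ S D
  e_mem : ∀ z ∈ D, e z ∈ ball (0 : ℂ) ρ
  κ_mem : ∀ w ∈ ball (0 : ℂ) ρ, κ w ∈ D
  κ_e : ∀ z ∈ D, κ (e z) = z
  e_κ : ∀ w ∈ ball (0 : ℂ) ρ, e (κ w) = w
  hasDerivAt_κ : ∀ w ∈ ball (0 : ℂ) ρ, HasDerivAt κ (S (κ w))⁻¹ w

/-- Dividing R by R(z₀) keeps it in the slit plane near z₀, so half a logarithm gives a holomorphic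
root S. A primitive of S on a disc has nonzero derivative at z₀ and is inverted by the inverse
function theorem. -/
theorem exists_flatChart {R : ℂ → ℂ} (hR : Differentiable ℂ R) {z₀ : ℂ} (h0 : R z₀ ≠ 0) :
    Nonempty (FlatChart R z₀) := by
  have hslit : ∀ᶠ z in 𝓝 z₀, R z / R z₀ ∈ slitPlane := by
    have hc : ContinuousAt (fun z => R z / R z₀) z₀ := (hR.continuous.div_const _).continuousAt
    apply hc.eventually_mem
    rw [div_self h0]
    exact isOpen_slitPlane.mem_nhds one_mem_slitPlane
  obtain ⟨r, hr0, hr⟩ := Metric.eventually_nhds_iff_ball.1 hslit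
  set S : ℂ → ℂ := fun z => Complex.exp (Complex.log (R z₀) / 2 + Complex.log (R z / R z₀) / 2)
    with hS
  have hSsq : ∀ z ∈ ball z₀ r, S z ^ 2 = R z := by
    intro z hz
    have h1 : R z / R z₀ ≠ 0 := slitPlane_ne_zero (hr z hz)
    rw [hS, ← Complex.exp_nat_mul]
    have : ((2 : ℕ) : ℂ) * (Complex.log (R z₀) / 2 + Complex.log (R z / R z₀) / 2) =
        Complex.log (R z₀) + Complex.log (R z / R z₀) := by push_cast; ring
    rw [this, Complex.exp_add, Complex.exp_log h0, Complex.exp_log h1]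
    field_simp
  have hSd : DifferentiableOn ℂ S (ball z₀ r) := by
    intro z hz
    have h2 : DifferentiableAt ℂ (fun z => R z / R z₀) z := (hR z).div_const _
    have h3 := h2.clog (hr z hz)
    exact ((h3.div_const 2).const_add (Complex.log (R z₀) / 2)).cexp.differentiableWithinAt
  obtain ⟨e, he0, he⟩ := hSd.isExactOn_ball.with_val_at z₀ 0
  have hz₀ : z₀ ∈ ball z₀ r := mem_ball_self hr0
  have hstrict : HasStrictDerivAt e (S z₀) z₀ := by
    have h1 : DifferentiableOn ℂ e (ball z₀ r) :=
      fun z hz => (he z hz).differentiableAt.differentiableWithinAt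
    have h2 := (h1.analyticAt (isOpen_ball.mem_nhds hz₀)).hasStrictDerivAt
    rwa [(he z₀ hz₀).deriv] at h2
  have hstrict2 := hstrict.hasStrictFDerivAt_equiv (Complex.exp_ne_zero _)
  set Φ := hstrict2.toOpenPartialHomeomorph e with hΦ
  have hΦe : ∀ z, Φ z = e z := fun z => rfl
  have hsrc : z₀ ∈ Φ.source := hstrict2.mem_toOpenPartialHomeomorph_source
  set Ψ := Φ.restrOpen (ball z₀ r) isOpen_ball with hΨ
  have hΨe : ∀ z, Ψ z = e z := fun z => rfl
  have hΨs : Ψ.source = Φ.source ∩ ball z₀ r := Φ.restrOpen_source _ _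
  have hsrc' : z₀ ∈ Ψ.source := by rw [hΨs]; exact ⟨hsrc, hz₀⟩
  have htgt : (0 : ℂ) ∈ Ψ.target := by
    have := Ψ.map_source hsrc'
    rwa [hΨe, he0] at this
  obtain ⟨ρ, hρ0, hρ⟩ := Metric.isOpen_iff.1 Ψ.open_target 0 htgt
  have hsub : Ψ.source ⊆ ball z₀ r := by rw [hΨs]; exact inter_subset_right
  exact ⟨{
    S := S
    e := e
    κ := Ψ.symm
    -- Restricting to the preimage of a disc makes e a bijection of `D` onto that whole disc.
    D := Ψ.source ∩ Ψ ⁻¹' ball 0 ρ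
    ρ := ρ
    ρ_pos := hρ0
    isOpen_D := Ψ.isOpen_inter_preimage isOpen_ball
    mem_D := ⟨hsrc', by simp [hΨe, he0, hρ0]⟩
    e_center := he0
    hasDerivAt_e := fun z hz => he z (hsub hz.1)
    S_sq := fun z hz => hSsq z (hsub hz.1)
    S_ne := fun z _ => Complex.exp_ne_zero _
    differentiableOn_S := hSd.mono (inter_subset_left.trans hsub)
    e_mem := fun z hz => hz.2
    κ_mem := fun w hw => ⟨Ψ.map_target (hρ hw), by
      rw [mem_preimage, Ψ.right_inv (hρ hw)]; exact hw⟩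
    κ_e := fun z hz => Ψ.left_inv hz.1
    e_κ := fun w hw => Ψ.right_inv (hρ hw)
    hasDerivAt_κ := fun w hw => Ψ.hasDerivAt_symm (hρ hw) (Complex.exp_ne_zero _)
      (he _ (hsub (Ψ.map_target (hρ hw)))) }⟩

namespace FlatChart

variable {R : ℂ → ℂ} {z₀ : ℂ} (T : FlatChart R z₀)

theorem continuousOn_κ : ContinuousOn T.κ (ball 0 T.ρ) := fun w hw =>
  (T.hasDerivAt_κ w hw).continuousAt.continuousWithinAt

theorem continuousOn_e : ContinuousOn T.e T.D := fun w hw =>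
  (T.hasDerivAt_e w hw).continuousAt.continuousWithinAt

theorem κ_zero : T.κ 0 = z₀ := by rw [← T.e_center, T.κ_e _ T.mem_D]

theorem injOn_e : InjOn T.e T.D := fun x hx y hy h => by
  rw [← T.κ_e x hx, h, T.κ_e y hy]

theorem image_e : T.e '' T.D = ball 0 T.ρ := by
  ext w
  constructor
  · rintro ⟨z, hz, rfl⟩; exact T.e_mem z hz
  · intro hw; exact ⟨T.κ w, T.κ_mem w hw, T.e_κ w hw⟩

theorem isOpen_preimage {O : Set ℂ} (hO : IsOpen O) : IsOpen (T.D ∩ T.e ⁻¹' O) :=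
  T.continuousOn_e.isOpen_inter_preimage T.isOpen_D hO

/-- Pull-back to the `z`-plane of a function of the flat coordinate. -/
def pullback {E : Type*} [Zero E] (ψ : ℂ → E) : ℂ → E := T.D.indicator fun z => ψ (T.e z)

theorem pullback_of_mem {E : Type*} [Zero E] (ψ : ℂ → E) {z : ℂ} (hz : z ∈ T.D) :
    T.pullback ψ z = ψ (T.e z) := indicator_of_mem hz _

theorem pullback_eventuallyEq {E : Type*} [Zero E] (ψ : ℂ → E) {z : ℂ} (hz : z ∈ T.D) :
    T.pullback ψ =ᶠ[𝓝 z] fun z => ψ (T.e z) := by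
  filter_upwards [T.isOpen_D.mem_nhds hz] with w hw using T.pullback_of_mem ψ hw

section

variable {E : Type*} [NormedAddCommGroup E] {ψ : ℂ → E}

theorem isCompact_image_tsupport (hc : HasCompactSupport ψ) (hs : tsupport ψ ⊆ ball 0 T.ρ) :
    IsCompact (T.κ '' tsupport ψ) :=
  hc.isCompact.image_of_continuousOn (T.continuousOn_κ.mono hs)

theorem support_pullback_subset : Function.support (T.pullback ψ) ⊆ T.κ '' tsupport ψ := by
  intro z hz
  have hzD : z ∈ T.D := by
    by_contra h; exact hz (indicator_of_notMem h _)
  rw [Function.mem_support, T.pullback_of_mem ψ hzD] at hz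
  exact ⟨T.e z, subset_tsupport _ hz, T.κ_e z hzD⟩

theorem tsupport_pullback_subset (hc : HasCompactSupport ψ) (hs : tsupport ψ ⊆ ball 0 T.ρ) :
    tsupport (T.pullback ψ) ⊆ T.κ '' tsupport ψ :=
  closure_minimal T.support_pullback_subset (T.isCompact_image_tsupport hc hs).isClosed

theorem hasCompactSupport_pullback (hc : HasCompactSupport ψ) (hs : tsupport ψ ⊆ ball 0 T.ρ) :
    HasCompactSupport (T.pullback ψ) :=
  (T.isCompact_image_tsupport hc hs).of_isClosed_subset (isClosed_tsupport _)
    (T.tsupport_pullback_subset hc hs)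

theorem tsupport_pullback_subset_D (hc : HasCompactSupport ψ) (hs : tsupport ψ ⊆ ball 0 T.ρ) :
    tsupport (T.pullback ψ) ⊆ T.D := by
  refine (T.tsupport_pullback_subset hc hs).trans ?_
  rintro _ ⟨w, hw, rfl⟩
  exact T.κ_mem w (hs hw)

/-- Extension by zero is harmless: the support is contained in a compact subset of `D`, the image of
the support of ψ under κ. -/
theorem contDiff_pullback [NormedSpace ℝ E] (hc : HasCompactSupport ψ)
    (hs : tsupport ψ ⊆ ball 0 T.ρ) (hψ : ContDiff ℝ 1 ψ) :
    ContDiff ℝ 1 (T.pullback ψ) := by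
  refine contDiff_iff_contDiffAt.2 fun z => ?_
  by_cases hz : z ∈ T.D
  · refine ContDiffAt.congr_of_eventuallyEq ?_ (T.pullback_eventuallyEq ψ hz)
    have h1 : DifferentiableOn ℂ T.e T.D := fun z hz =>
      (T.hasDerivAt_e z hz).differentiableAt.differentiableWithinAt
    have h2 : ContDiffAt ℂ 1 T.e z := (h1.contDiffOn T.isOpen_D).contDiffAt (T.isOpen_D.mem_nhds hz)
    exact hψ.contDiffAt.comp z (h2.restrict_scalars ℝ)
  · have h1 : z ∉ tsupport (T.pullback ψ) := fun h => hz (T.tsupport_pullback_subset_D hc hs h)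
    exact contDiffAt_const.congr_of_eventuallyEq (notMem_tsupport_iff_eventuallyEq.1 h1)

end

theorem dbar_pullback {ψ : ℂ → ℂ} (hψ : ContDiff ℝ 1 ψ) {z : ℂ} (hz : z ∈ T.D) :
    dbar (T.pullback ψ) z = (starRingEnd ℂ) (T.S z) * dbar ψ (T.e z) := by
  rw [dbar_of_eventuallyEq (T.pullback_eventuallyEq ψ hz)]
  exact dbar_comp_holomorphic (T.hasDerivAt_e z hz) (hψ.differentiable one_ne_zero _)

theorem det_mul_real (a : ℂ) :
    ((ContinuousLinearMap.toSpanSingleton ℂ a).restrictScalars ℝ : ℂ →L[ℝ] ℂ).det = ‖a‖ ^ 2 := by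
  simp [ContinuousLinearMap.det, LinearMap.det_restrictScalars, Algebra.norm_complex_eq,
    Complex.normSq_eq_norm_sq]

theorem setIntegral_ball (F : ℂ → ℂ) :
    ∫ w in ball (0 : ℂ) T.ρ, F w = ∫ z in T.D, (‖T.S z‖ ^ 2 : ℝ) • F (T.e z) := by
  rw [← T.image_e, integral_image_eq_integral_abs_det_fderiv_smul volume T.isOpen_D.measurableSet
    (fun z hz => ((T.hasDerivAt_e z hz).hasFDerivAt.restrictScalars ℝ).hasFDerivWithinAt) T.injOn_e]
  refine setIntegral_congr_fun T.isOpen_D.measurableSet fun z hz => ?_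
  simp only [det_mul_real, abs_of_nonneg (sq_nonneg ‖T.S z‖)]

/-- The ratio of `g` to the branch `S` of `√R`, in the flat coordinate. -/
def ratio (g : ℂ → ℂ) : ℂ → ℂ := (ball (0 : ℂ) T.ρ).indicator fun w => g (T.κ w) / T.S (T.κ w)

theorem ratio_of_mem (g : ℂ → ℂ) {w : ℂ} (hw : w ∈ ball (0 : ℂ) T.ρ) :
    T.ratio g w = g (T.κ w) / T.S (T.κ w) := indicator_of_mem hw _

theorem measurable_ratio {g : ℂ → ℂ} (hg : Measurable g) : Measurable (T.ratio g) := by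
  classical
  have hκ : Measurable ((ball (0 : ℂ) T.ρ).piecewise T.κ 0) := by
    refine ContinuousOn.measurable_piecewise T.continuousOn_κ continuousOn_const measurableSet_ball
  have hS : Measurable ((ball (0 : ℂ) T.ρ).piecewise (fun w => T.S (T.κ w)) 0) := by
    refine ContinuousOn.measurable_piecewise ?_ continuousOn_const measurableSet_ball
    exact T.differentiableOn_S.continuousOn.comp T.continuousOn_κ T.κ_mem
  have h1 : T.ratio g = (ball (0 : ℂ) T.ρ).indicator fun w =>
      g ((ball (0 : ℂ) T.ρ).piecewise T.κ 0 w) /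
        (ball (0 : ℂ) T.ρ).piecewise (fun w => T.S (T.κ w)) 0 w := by
    ext w
    by_cases hw : w ∈ ball (0 : ℂ) T.ρ
    · rw [T.ratio_of_mem g hw, indicator_of_mem hw, piecewise_eq_of_mem _ _ _ hw,
        piecewise_eq_of_mem _ _ _ hw]
    · rw [ratio, indicator_of_notMem hw, indicator_of_notMem hw]
  rw [h1]
  exact ((hg.comp hκ).div hS).indicator measurableSet_ball

theorem ae_ball_of_ae {P : ℂ → Prop} (hP : ∀ᵐ z, P z) :
    ∀ᵐ w, w ∈ ball (0 : ℂ) T.ρ → P (T.κ w) := by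
  have h1 : volume (T.e '' (T.D ∩ {z | ¬ P z})) = 0 := by
    refine addHaar_image_eq_zero_of_differentiableOn_of_addHaar_eq_zero volume ?_
      (measure_mono_null inter_subset_right hP)
    intro z hz
    exact ((T.hasDerivAt_e z hz.1).differentiableAt.restrictScalars ℝ).differentiableWithinAt
  refine measure_mono_null (fun w hw => ?_) h1
  simp only [mem_compl_iff, mem_ofPred_eq, Classical.not_imp] at hw
  exact ⟨T.κ w, ⟨T.κ_mem w hw.1, hw.2⟩, T.e_κ w hw.1⟩

theorem ae_ratio {g : ℂ → ℂ} (hg : ∀ᵐ z, g z ^ 2 = R z) :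
    ∀ᵐ w, w ∈ ball (0 : ℂ) T.ρ → T.ratio g w = 1 ∨ T.ratio g w = -1 := by
  filter_upwards [T.ae_ball_of_ae hg] with w hw hwb
  have hD := T.κ_mem w hwb
  have h1 := T.S_ne _ hD
  rw [T.ratio_of_mem g hwb]
  have h2 : (g (T.κ w) / T.S (T.κ w)) ^ 2 = 1 := by
    rw [div_pow, hw hwb, T.S_sq _ hD, div_self]
    rw [← T.S_sq _ hD]; exact pow_ne_zero 2 h1
  exact by
    rw [← sub_eq_zero, ← sub_eq_zero (b := (-1 : ℂ)), ← mul_eq_zero]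
    linear_combination h2

/-- The Jacobian of e is |S|² = S·S̄: the factor S cancels the denominator of the ratio, and S̄ is
the factor from the chain rule for ∂̄. -/
theorem integral_ratio_mul_dbar (g : ℂ → ℂ) {ψ : ℂ → ℂ} (hψ : ContDiff ℝ 1 ψ)
    (hc : HasCompactSupport ψ) (hs : tsupport ψ ⊆ ball 0 T.ρ) :
    ∫ w, T.ratio g w * dbar ψ w = ∫ z, dbar (T.pullback ψ) z * g z := by
  have h1 : ∫ w, T.ratio g w * dbar ψ w =
      ∫ w in ball (0 : ℂ) T.ρ, g (T.κ w) / T.S (T.κ w) * dbar ψ w := by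
    rw [← integral_indicator measurableSet_ball]
    congr 1; ext w
    by_cases hw : w ∈ ball (0 : ℂ) T.ρ
    · rw [T.ratio_of_mem g hw, indicator_of_mem hw]
    · rw [ratio, indicator_of_notMem hw, indicator_of_notMem hw, zero_mul]
  rw [h1, T.setIntegral_ball, ← integral_indicator T.isOpen_D.measurableSet]
  congr 1; ext z
  by_cases hz : z ∈ T.D
  · rw [indicator_of_mem hz, T.dbar_pullback hψ hz, T.κ_e z hz, real_smul]
    have h2 := T.S_ne z hz
    have h3 : ((‖T.S z‖ ^ 2 : ℝ) : ℂ) = T.S z * (starRingEnd ℂ) (T.S z) := by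
      rw [Complex.mul_conj, Complex.normSq_eq_norm_sq]
    rw [h3]
    field_simp
  · rw [indicator_of_notMem hz]
    have h3 : T.pullback ψ =ᶠ[𝓝 z] 0 := notMem_tsupport_iff_eventuallyEq.1
      fun h => hz (T.tsupport_pullback_subset_D hc hs h)
    rw [dbar_of_eventuallyEq h3]
    simp [dbar]

end FlatChart

/-! ### The sign function and the local shape of the support. -/

theorem integral_dbar_mul_gradientField (V : Polynomial ℂ) {μ : Measure ℂ} [IsProbabilityMeasure μ]
    {h : ℂ → ℂ} (hh : ContDiff ℝ 1 h) (hc : HasCompactSupport h) :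
    ∫ z, dbar h z * gradientField V μ z = π * ∫ x, h x ∂μ := by
  have h3 : ContDiff ℝ 1 fun w => V.derivative.eval w * h w :=
    (V.derivative.differentiable.contDiff.restrict_scalars ℝ).mul hh
  have e1 : ∀ z, dbar h z * gradientField V μ z = dbar h z * cauchyTransform μ z +
      (1 / 2) * dbar (fun w => V.derivative.eval w * h w) z := by
    intro z
    rw [dbar_holomorphic_mul V.derivative.differentiableAt (hh.differentiable one_ne_zero z),
      gradientField]
    ring
  simp only [e1]
  rw [integral_add (integrable_mul_cauchyTransform (continuous_dbar hh) (hasCompactSupport_dbar hc))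
    (((continuous_dbar h3).integrable_of_hasCompactSupport
      (hasCompactSupport_dbar hc.mul_left)).const_mul _),
    integral_const_mul, integral_dbar h3 hc.mul_left, integral_dbar_mul_cauchyTransform hh hc]
  simp

theorem fderiv_ofReal_comp {ψ : ℂ → ℝ} (hψ : ContDiff ℝ 1 ψ) (z v : ℂ) :
    fderiv ℝ (fun w => (ψ w : ℂ)) z v = ((fderiv ℝ ψ z v : ℝ) : ℂ) := by
  have d3 := (Complex.ofRealCLM.hasFDerivAt).comp z
    (hψ.differentiable one_ne_zero z).hasFDerivAt
  have d4 : fderiv ℝ (fun w => (ψ w : ℂ)) z = _ := d3.fderiv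
  rw [d4]; simp

namespace FlatChart

variable {R : ℂ → ℂ} {z₀ : ℂ} (T : FlatChart R z₀) {V : Polynomial ℂ} {μ : Measure ℂ}

/-- The sign relating the complex gradient to the chosen branch of `√R`. -/
def sign (V : Polynomial ℂ) (μ : Measure ℂ) (w : ℂ) : ℝ := (T.ratio (gradientField V μ) w).re

theorem measurable_sign [SFinite μ] : Measurable (T.sign V μ) :=
  Complex.measurable_re.comp
    (T.measurable_ratio (stronglyMeasurable_gradientField V μ).measurable)

theorem ae_ratio_eq_sign (hg : ∀ᵐ z, gradientField V μ z ^ 2 = R z) :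
    ∀ᵐ w, T.ratio (gradientField V μ) w = (T.sign V μ w : ℂ) ∧
      (w ∈ ball (0 : ℂ) T.ρ → T.sign V μ w = 1 ∨ T.sign V μ w = -1) ∧ ‖T.sign V μ w‖ ≤ 1 := by
  filter_upwards [T.ae_ratio hg] with w hw
  unfold sign
  by_cases hwb : w ∈ ball (0 : ℂ) T.ρ
  · rcases hw hwb with h | h <;> rw [h] <;> simp
  · simp [ratio, hwb]

theorem locallyIntegrable_sign [SFinite μ] (hg : ∀ᵐ z, gradientField V μ z ^ 2 = R z) :
    LocallyIntegrable (T.sign V μ) := by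
  refine (locallyIntegrable_const (1 : ℝ)).mono T.measurable_sign.aestronglyMeasurable ?_
  filter_upwards [T.ae_ratio_eq_sign hg] with w hw
  simpa using hw.2.2

/-- The sign and ψ are real, so the single complex equation ∂̄g = -πμ splits into two real ones: the
weak derivative of the sign in the imaginary direction is 0, and in the real direction it is -2π
times the image of μ, hence nonpositive. -/
theorem integral_sign_mul_fderiv [IsProbabilityMeasure μ]
    (hg : ∀ᵐ z, gradientField V μ z ^ 2 = R z) {ψ : ℂ → ℝ} (hψ : ContDiff ℝ 1 ψ)
    (hc : HasCompactSupport ψ) (hs : tsupport ψ ⊆ ball 0 T.ρ) (v : ℂ) :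
    ∫ w, T.sign V μ w * fderiv ℝ ψ w v = 2 * π * v.re * ∫ x, T.pullback ψ x ∂μ := by
  set ψc : ℂ → ℂ := fun w => (ψ w : ℂ) with hψc
  have hψcd : ContDiff ℝ 1 ψc := Complex.ofRealCLM.contDiff.comp hψ
  have hcc : HasCompactSupport ψc := hc.comp_left (g := fun r : ℝ => (r : ℂ)) (by simp)
  have hsc : tsupport ψc ⊆ ball 0 T.ρ := (closure_mono fun w hw => by
    intro h; apply hw; simp [hψc, h]).trans hs
  have h1 := T.integral_ratio_mul_dbar (gradientField V μ) hψcd hcc hsc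
  rw [integral_dbar_mul_gradientField V (T.contDiff_pullback hcc hsc hψcd)
    (T.hasCompactSupport_pullback hcc hsc)] at h1
  have hpb : T.pullback ψc = fun z => ((T.pullback ψ z : ℝ) : ℂ) := by
    ext z
    by_cases hz : z ∈ T.D
    · rw [T.pullback_of_mem _ hz, T.pullback_of_mem _ hz]
    · rw [pullback, pullback, indicator_of_notMem hz, indicator_of_notMem hz]; simp
  rw [hpb, integral_complex_ofReal] at h1
  have hint : ∀ u, Integrable fun w => T.sign V μ w * fderiv ℝ ψ w u := by
    intro u
    have := (T.locallyIntegrable_sign hg).integrable_smul_left_of_hasCompactSupport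
      ((hψ.continuous_fderiv one_ne_zero).clm_apply continuous_const) (hc.fderiv_apply ℝ u)
    simpa [mul_comm] using this
  have h2 : ∫ w, T.ratio (gradientField V μ) w * dbar ψc w =
      ∫ w, (((T.sign V μ w * fderiv ℝ ψ w 1 : ℝ) : ℂ) +
        I * ((T.sign V μ w * fderiv ℝ ψ w I : ℝ) : ℂ)) / 2 := by
    refine integral_congr_ae ?_
    filter_upwards [T.ae_ratio_eq_sign hg] with w hw
    rw [hw.1, dbar, fderiv_ofReal_comp hψ, fderiv_ofReal_comp hψ]
    push_cast; ring
  have i1 : Integrable fun w => ((T.sign V μ w * fderiv ℝ ψ w 1 : ℝ) : ℂ) := (hint 1).ofReal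
  have i2 : Integrable fun w => I * ((T.sign V μ w * fderiv ℝ ψ w I : ℝ) : ℂ) :=
    (hint I).ofReal.const_mul I
  rw [h2, integral_div, integral_add i1 i2,
    integral_const_mul, integral_complex_ofReal, integral_complex_ofReal] at h1
  have hre := congrArg Complex.re h1
  have him := congrArg Complex.im h1
  simp only [div_ofNat_re, add_re, ofReal_re, mul_re, I_re, zero_mul, I_im, ofReal_im, mul_zero,
    sub_zero, add_zero, div_ofNat_im, add_im, mul_im, zero_add, one_mul] at hre him
  have h3 : ∀ w, T.sign V μ w * fderiv ℝ ψ w v = v.re * (T.sign V μ w * fderiv ℝ ψ w 1) +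
      v.im * (T.sign V μ w * fderiv ℝ ψ w I) := by
    intro w
    have : v = v.re • (1 : ℂ) + v.im • I := by simp
    conv_lhs => rw [this, map_add, map_smul, map_smul]
    simp only [smul_eq_mul]; ring
  simp only [h3]
  rw [integral_add ((hint 1).const_mul _) ((hint I).const_mul _), integral_const_mul,
    integral_const_mul]
  linear_combination (2 * v.re) * hre + (2 * v.im) * him

theorem pullback_nonneg {ψ : ℂ → ℝ} (h : ∀ w, 0 ≤ ψ w) (z : ℂ) : 0 ≤ T.pullback ψ z :=
  indicator_nonneg (fun _ _ => h _) z

/-- A constant has zero weak derivative, so μ gives zero integral to the pullback of a bump function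
equal to 1 on the smaller ball. -/
theorem measure_preimage_ball_eq_zero [IsProbabilityMeasure μ]
    (hg : ∀ᵐ z, gradientField V μ z ^ 2 = R z) {c : ℂ} {r a : ℝ} (hr : 0 < r)
    (hsub : ball c r ⊆ ball 0 T.ρ) (ha : ∀ᵐ w, w ∈ ball c r → T.sign V μ w = a) :
    μ (T.D ∩ T.e ⁻¹' ball c (r / 4)) = 0 := by
  let φ : ContDiffBump c := ⟨r / 4, r / 2, by positivity, by linarith⟩
  have hφ : ContDiff ℝ 1 φ := φ.contDiff
  have hts : tsupport φ ⊆ ball c r := by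
    rw [φ.tsupport_eq]
    exact closedBall_subset_ball (by simp only [φ]; linarith)
  have h1 := T.integral_sign_mul_fderiv hg hφ φ.hasCompactSupport (hts.trans hsub) 1
  have h2 : ∫ w, T.sign V μ w * fderiv ℝ φ w 1 = ∫ w, a * fderiv ℝ φ w 1 := by
    refine integral_congr_ae ?_
    filter_upwards [ha] with w hw
    by_cases hwb : w ∈ ball c r
    · rw [hw hwb]
    · have : φ =ᶠ[𝓝 w] 0 := notMem_tsupport_iff_eventuallyEq.1 fun h => hwb (hts h)
      rw [this.fderiv_eq]; simp
  rw [h2, integral_const_mul, integral_fderiv_apply_eq_zero hφ φ.hasCompactSupport] at h1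
  have h3 : ∫ x, T.pullback φ x ∂μ = 0 := by
    simpa [pi_ne_zero] using h1.symm
  have hi : Integrable (T.pullback φ) μ :=
    (T.contDiff_pullback φ.hasCompactSupport (hts.trans hsub) hφ).continuous
      |>.integrable_of_hasCompactSupport
        (T.hasCompactSupport_pullback φ.hasCompactSupport (hts.trans hsub))
  have h4 := (integral_eq_zero_iff_of_nonneg (T.pullback_nonneg fun w => φ.nonneg) hi).1 h3
  refine measure_mono_null (fun x hx => ?_) h4
  have h5 : φ (T.e x) = 1 := φ.one_of_mem_closedBall (ball_subset_closedBall hx.2)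
  simp only [mem_compl_iff, mem_ofPred_eq, T.pullback_of_mem _ hx.1, h5]
  simp

theorem notMem_support_of_sign_const [IsProbabilityMeasure μ]
    (hg : ∀ᵐ z, gradientField V μ z ^ 2 = R z) {z : ℂ} (hz : z ∈ T.D) {r a : ℝ} (hr : 0 < r)
    (hsub : ball (T.e z) r ⊆ ball 0 T.ρ) (ha : ∀ᵐ w, w ∈ ball (T.e z) r → T.sign V μ w = a) :
    z ∉ μ.support := by
  rw [Measure.notMem_support_iff_exists]
  refine ⟨T.D ∩ T.e ⁻¹' ball (T.e z) (r / 4), (T.isOpen_preimage isOpen_ball).mem_nhds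
    ⟨hz, mem_ball_self (by positivity)⟩, T.measure_preimage_ball_eq_zero hg hr hsub ha⟩

/-- Near a point of the support, the sign is a step function in the flat coordinate. -/
theorem ae_sign [IsProbabilityMeasure μ] (hg : ∀ᵐ z, gradientField V μ z ^ 2 = R z)
    (hz₀ : z₀ ∈ μ.support) :
    ∀ᵐ w, w ∈ ball (0 : ℂ) T.ρ → (w.re < 0 → T.sign V μ w = 1) ∧ (0 < w.re → T.sign V μ w = -1) := by
  obtain ⟨A, hA, hmono⟩ := exists_ae_monotone (T.locallyIntegrable_sign hg)
  have hmono' : ∀ w ∈ A, ∀ w' ∈ A, w ∈ ball 0 T.ρ → w' ∈ ball 0 T.ρ → w.re ≤ w'.re →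
      T.sign V μ w' ≤ T.sign V μ w := by
    intro w hw w' hw' hwb hwb' hre
    refine hmono 0 T.ρ w hw w' hw' hwb hwb' fun ψ hψ hc hs hpos => ?_
    rw [T.integral_sign_mul_fderiv hg (hψ.of_le one_le_two) hc hs]
    have h1 : 0 ≤ ∫ x, T.pullback ψ x ∂μ := integral_nonneg (T.pullback_nonneg hpos)
    have h2 : 0 ≤ (w' - w).re := by rw [sub_re]; linarith
    positivity
  filter_upwards [hA, T.ae_ratio_eq_sign hg] with w hwA hw hwb
  have hball : ∀ b : ℝ, ball (T.e z₀) (min T.ρ b) ⊆ ball 0 T.ρ := fun b => by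
    rw [T.e_center]; exact ball_subset_ball (min_le_left _ _)
  constructor
  · intro hneg
    -- If the sign were -1 at w with Re w < 0, monotonicity would make it -1 almost everywhere to
    -- the right of w. That region contains a disc about e(z₀) = 0, so z₀ would lie off the support.
    -- The other half is symmetric.
    refine (hw.2.1 hwb).resolve_right fun hm => ?_
    refine T.notMem_support_of_sign_const (a := -1) hg T.mem_D (r := min T.ρ (-w.re))
      (lt_min T.ρ_pos (by linarith)) (hball _) ?_ hz₀
    filter_upwards [hA, T.ae_ratio_eq_sign hg] with w' hwA' hw' hwb'
    have h1 := hball _ hwb'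
    rcases hw'.2.1 h1 with h | h
    · have hre : w.re ≤ w'.re := by
        rw [T.e_center, mem_ball_zero_iff, lt_min_iff] at hwb'
        have := (Complex.abs_re_le_norm w').trans hwb'.2.le
        linarith [neg_abs_le w'.re]
      have := hmono' w hwA w' hwA' hwb h1 hre
      linarith
    · exact h
  · intro hpos
    refine (hw.2.1 hwb).resolve_left fun hm => ?_
    refine T.notMem_support_of_sign_const (a := 1) hg T.mem_D (r := min T.ρ w.re)
      (lt_min T.ρ_pos (by linarith)) (hball _) ?_ hz₀
    filter_upwards [hA, T.ae_ratio_eq_sign hg] with w' hwA' hw' hwb'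
    have h1 := hball _ hwb'
    rcases hw'.2.1 h1 with h | h
    · exact h
    · have hre : w'.re ≤ w.re := by
        rw [T.e_center, mem_ball_zero_iff, lt_min_iff] at hwb'
        have := (Complex.abs_re_le_norm w').trans hwb'.2.le
        linarith [le_abs_self w'.re]
      have := hmono' w' hwA' w hwA h1 hwb hre
      linarith

theorem exists_mem_of_ae {A : Set ℂ} (hA : ∀ᵐ z, z ∈ A) {O : Set ℂ} (hO : IsOpen O)
    (hne : O.Nonempty) : ∃ w ∈ O, w ∈ A := by
  by_contra! h
  have h1 : volume O = 0 := measure_mono_null (fun w hw => h w hw) hA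
  exact (hO.measure_pos volume hne).ne' h1

/-- Near a point of the support off the zeros of `R`, the support is the curve `Re e = 0`. -/
theorem mem_support_iff [IsProbabilityMeasure μ] (hg : ∀ᵐ z, gradientField V μ z ^ 2 = R z)
    (hz₀ : z₀ ∈ μ.support) {z : ℂ} (hz : z ∈ T.D) : z ∈ μ.support ↔ (T.e z).re = 0 := by
  have hstep := T.ae_sign hg hz₀
  have hwρ := T.e_mem z hz
  obtain ⟨r, hr0, hr⟩ := Metric.isOpen_iff.1 isOpen_ball (T.e z) hwρ
  constructor
  · intro hsupp
    by_contra hne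
    have hpos : 0 < |(T.e z).re| := abs_pos.2 hne
    have hsub : ball (T.e z) (min r |(T.e z).re|) ⊆ ball 0 T.ρ :=
      (ball_subset_ball (min_le_left _ _)).trans hr
    refine T.notMem_support_of_sign_const (a := if (T.e z).re < 0 then 1 else -1) hg hz
      (lt_min hr0 hpos) hsub ?_ hsupp
    filter_upwards [hstep] with w hw hwb
    have h1 := hw (hsub hwb)
    rw [mem_ball, dist_eq_norm, lt_min_iff] at hwb
    have h2 := (Complex.abs_re_le_norm _).trans_lt hwb.2
    rw [sub_re] at h2
    split_ifs with h
    · apply h1.1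
      rw [abs_of_neg h] at h2
      linarith [le_abs_self (w.re - (T.e z).re)]
    · have h3 : 0 < (T.e z).re := lt_of_le_of_ne (not_lt.1 h) (Ne.symm hne)
      apply h1.2
      rw [abs_of_pos h3] at h2
      linarith [neg_abs_le (w.re - (T.e z).re)]
  -- If μ vanished near z, the weak derivative of the sign would vanish near e(z). Comparing in both
  -- directions makes it constant there, while the step takes both values arbitrarily close to the
  -- line Re = 0.
  · intro hre
    by_contra hns
    rw [Measure.notMem_support_iff_exists] at hns
    obtain ⟨O, hO, hμO⟩ := hns
    have hcont : ContinuousAt T.κ (T.e z) := (T.hasDerivAt_κ _ hwρ).continuousAt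
    have hO' : ∀ᶠ w in 𝓝 (T.e z), T.κ w ∈ O := hcont.eventually (by rwa [T.κ_e z hz])
    obtain ⟨q, hq0, hq⟩ := Metric.eventually_nhds_iff_ball.1 hO'
    set r' := min r q with hr'
    have hr'0 : 0 < r' := lt_min hr0 hq0
    have hsub : ball (T.e z) r' ⊆ ball 0 T.ρ := (ball_subset_ball (min_le_left _ _)).trans hr
    obtain ⟨A, hA, hmono⟩ := exists_ae_monotone (T.locallyIntegrable_sign hg)
    have hconst : ∀ w ∈ A, ∀ w' ∈ A, w ∈ ball (T.e z) r' → w' ∈ ball (T.e z) r' →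
        T.sign V μ w' ≤ T.sign V μ w := by
      intro w hw w' hw' hwb hwb'
      refine hmono _ r' w hw w' hw' hwb hwb' fun ψ hψ hc hs hpos => ?_
      rw [T.integral_sign_mul_fderiv hg (hψ.of_le one_le_two) hc (hs.trans hsub)]
      have h1 : ∫ x, T.pullback ψ x ∂μ = 0 := by
        refine integral_eq_zero_of_ae ?_
        have h2 : ∀ᵐ x ∂μ, x ∉ O := by
          rw [ae_iff]; simpa using hμO
        filter_upwards [h2] with x hx
        by_contra hne
        obtain ⟨w, hw, rfl⟩ := T.support_pullback_subset hne
        exact hx (hq w (ball_subset_ball (min_le_right _ _) (hs hw)))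
      rw [h1, mul_zero]
    have hAs : ∀ᵐ w, w ∈ A ∩ {w | w ∈ ball (0 : ℂ) T.ρ → (w.re < 0 → T.sign V μ w = 1) ∧
        (0 < w.re → T.sign V μ w = -1)} := by
      filter_upwards [hA, hstep] with w h1 h2 using ⟨h1, h2⟩
    have hmem : ∀ t : ℝ, |t| < r' → T.e z + t ∈ ball (T.e z) r' := by
      intro t ht; simpa [dist_eq_norm] using ht
    obtain ⟨w₁, hw₁, hw₁A, hw₁s⟩ := exists_mem_of_ae hAs
      (isOpen_ball (x := T.e z) (ε := r') |>.inter (isOpen_lt continuous_re (continuous_const (y := (0 : ℝ)))))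
      ⟨T.e z + (-(r' / 2) : ℝ), hmem _ (by rw [abs_neg, abs_of_pos (by positivity)]; linarith), by
        simp only [mem_ofPred_eq, add_re, hre, ofReal_re]; linarith⟩
    obtain ⟨w₂, hw₂, hw₂A, hw₂s⟩ := exists_mem_of_ae hAs
      (isOpen_ball (x := T.e z) (ε := r') |>.inter (isOpen_lt (continuous_const (y := (0 : ℝ))) continuous_re))
      ⟨T.e z + ((r' / 2) : ℝ), hmem _ (by rw [abs_of_pos (by positivity)]; linarith), by
        simp only [mem_ofPred_eq, add_re, hre, ofReal_re]; linarith⟩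
    have h1 := (hw₁s (hsub hw₁.1)).1 hw₁.2
    have h2 := (hw₂s (hsub hw₂.1)).2 hw₂.2
    have h3 := hconst w₂ hw₂A w₁ hw₁A hw₂.1 hw₁.1
    rw [h1, h2] at h3
    norm_num at h3

/-- The arc `t ↦ κ (i t)`. -/
def arc (t : ℝ) : ℂ := T.κ (I * t)

theorem mem_ball_of_lt {t : ℝ} (ht : |t| < T.ρ) : I * (t : ℂ) ∈ ball (0 : ℂ) T.ρ := by
  simpa using ht

theorem hasDerivAt_arc {t : ℝ} (ht : |t| < T.ρ) :
    HasDerivAt T.arc (I / T.S (T.arc t)) t := by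
  have h1 : HasDerivAt (fun t : ℝ => I * (t : ℂ)) I t := by
    simpa using (Complex.ofRealCLM.hasDerivAt (x := t)).const_mul I
  have h2 := (T.hasDerivAt_κ _ (T.mem_ball_of_lt ht)).comp_of_eq t h1 rfl
  rw [inv_mul_eq_div] at h2
  exact h2

theorem isLocalAnalyticArc [IsProbabilityMeasure μ] (hg : ∀ᵐ z, gradientField V μ z ^ 2 = R z)
    (hz₀ : z₀ ∈ μ.support) : IsLocalAnalyticArc μ.support z₀ T.arc := by
  have hρ := T.ρ_pos
  have hlt : ∀ t ∈ Icc (-(T.ρ / 2)) (T.ρ / 2), |t| < T.ρ := fun t ht =>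
    (abs_le.2 ht).trans_lt (by linarith)
  -- Half the radius keeps the closed parameter interval inside the chart.
  refine ⟨by simp [arc, T.κ_zero], T.ρ / 2, by positivity, ?_, ?_, ?_,
    T.D ∩ T.e ⁻¹' ball 0 (T.ρ / 2), T.isOpen_preimage isOpen_ball,
    ⟨T.mem_D, by simp [T.e_center, hρ]⟩, ?_⟩
  · intro t ht
    have h1 : DifferentiableOn ℂ T.κ (ball 0 T.ρ) := fun w hw =>
      (T.hasDerivAt_κ w hw).differentiableAt.differentiableWithinAt
    have h2 : AnalyticAt ℂ T.κ (I * t) :=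
      h1.analyticAt (isOpen_ball.mem_nhds (T.mem_ball_of_lt (hlt t ht)))
    have h3 : AnalyticAt ℝ (fun t : ℝ => I * (t : ℂ)) t :=
      analyticAt_const.mul (Complex.ofRealCLM.analyticAt t)
    exact h2.restrictScalars.comp_of_eq h3 rfl
  · intro t ht
    rw [(T.hasDerivAt_arc (hlt t ht)).deriv]
    exact div_ne_zero I_ne_zero (T.S_ne _ (T.κ_mem _ (T.mem_ball_of_lt (hlt t ht))))
  · intro t ht t' ht' h
    have h1 := congrArg T.e h
    unfold arc at h1
    rw [T.e_κ _ (T.mem_ball_of_lt (hlt t ht)), T.e_κ _ (T.mem_ball_of_lt (hlt t' ht'))] at h1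
    simpa using h1
  · ext z
    constructor
    · rintro ⟨hzs, hz, hzb⟩
      have hre := (T.mem_support_iff hg hz₀ hz).1 hzs
      have hez : T.e z = I * ((T.e z).im : ℂ) := by
        apply Complex.ext <;> simp [hre]
      refine ⟨(T.e z).im, ?_, ?_⟩
      · rw [mem_preimage, mem_ball_zero_iff, hez] at hzb
        have : |(T.e z).im| < T.ρ / 2 := by simpa using hzb
        exact abs_lt.1 this
      · rw [arc, ← hez, T.κ_e z hz]
    · rintro ⟨t, ht, rfl⟩
      have htρ := T.mem_ball_of_lt (hlt t ⟨ht.1.le, ht.2.le⟩)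
      have hD := T.κ_mem _ htρ
      refine ⟨(T.mem_support_iff hg hz₀ hD).2 ?_, hD, ?_⟩
      · rw [T.e_κ _ htρ]; simp
      · rw [mem_preimage, arc, T.e_κ _ htρ]
        simpa using abs_lt.2 ht

end FlatChart

/-! ### The weak gradient of the logarithmic potential. -/

theorem abs_log_le_inv_add {t : ℝ} (ht : 0 ≤ t) : |Real.log t| ≤ t⁻¹ + Real.log (1 + t) := by
  rcases ht.eq_or_lt with rfl | ht
  · simp
  have h1 := Real.one_sub_inv_le_log_of_pos ht
  have h2 : Real.log t ≤ Real.log (1 + t) := Real.log_le_log ht (by linarith)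
  have h3 : 0 ≤ Real.log (1 + t) := Real.log_nonneg (by linarith)
  have h4 : 0 < t⁻¹ := inv_pos.2 ht
  rw [abs_le]; constructor <;> linarith

theorem log_one_add_norm_sub_le (z y : ℂ) :
    Real.log (1 + ‖z - y‖) ≤ Real.log (1 + ‖z‖) + Real.log (1 + ‖y‖) := by
  rw [← Real.log_mul (by positivity) (by positivity)]
  apply Real.log_le_log (by positivity)
  have := norm_sub_le z y
  nlinarith [norm_nonneg z, norm_nonneg y, mul_nonneg (norm_nonneg z) (norm_nonneg y)]

theorem abs_log_norm_sub_le (z y : ℂ) :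
    |Real.log ‖z - y‖| ≤ ‖(y - z)⁻¹‖ + (Real.log (1 + ‖z‖) + Real.log (1 + ‖y‖)) := by
  rw [norm_inv, norm_sub_rev y z]
  exact (abs_log_le_inv_add (norm_nonneg _)).trans
    (add_le_add le_rfl (log_one_add_norm_sub_le z y))

/-- The logarithmic kernel is the limit of smooth kernels; integration by parts. -/
theorem integral_log_mul_fderiv {ψ : ℂ → ℝ} (hψ : ContDiff ℝ 1 ψ) (hc : HasCompactSupport ψ)
    (v y : ℂ) :
    ∫ z, Real.log ‖z - y‖ * fderiv ℝ ψ z v = -∫ z, (v / (z - y)).re * ψ z := by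
  set δ : ℕ → ℝ := fun n => (1 / ((n : ℝ) + 1)) ^ 2 with hδ
  have hδpos : ∀ n, 0 < δ n := fun n => by positivity
  have hδ1 : ∀ n, δ n ≤ 1 := fun n => by
    have : 1 / ((n : ℝ) + 1) ≤ 1 := by
      rw [div_le_one (by positivity)]; linarith [(n.cast_nonneg : (0 : ℝ) ≤ n)]
    exact pow_le_one₀ (by positivity) this
  have hδlim : Tendsto δ atTop (𝓝 0) := by
    have := (tendsto_one_div_add_atTop_nhds_zero_nat (𝕜 := ℝ)).pow 2
    rw [zero_pow two_ne_zero] at this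
    exact this
  set L : ℕ → ℂ → ℝ := fun n z => Real.log (‖z - y‖ ^ 2 + δ n) / 2 with hL
  set L' : ℕ → ℂ → ℝ := fun n z => ((starRingEnd ℂ) (z - y) * v).re / (‖z - y‖ ^ 2 + δ n) with hL'
  have hpos : ∀ n z, 0 < ‖z - y‖ ^ 2 + δ n := fun n z => by have := hδpos n; positivity
  have hLd : ∀ n, ContDiff ℝ 1 (L n) := by
    intro n
    refine ContDiff.div_const (ContDiff.log ?_ fun z => (hpos n z).ne') 2
    exact ((contDiff_norm_sq ℝ).comp (contDiff_id.sub contDiff_const)).add contDiff_const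
  have hLf : ∀ n z, fderiv ℝ (L n) z v = L' n z := by
    intro n z
    have h1 : HasFDerivAt (fun z : ℂ => ‖z - y‖ ^ 2) (2 • (innerSL ℝ (z - y))) z := by
      have := (hasStrictFDerivAt_norm_sq (z - y)).hasFDerivAt.comp z
        ((hasFDerivAt_id (𝕜 := ℝ) z).sub_const y)
      exact this
    have h2 := ((h1.add_const (δ n)).log (hpos n z).ne').const_smul (1 / 2 : ℝ)
    have h3 : L n = fun z => (1 / 2 : ℝ) • Real.log (‖z - y‖ ^ 2 + δ n) := by
      ext z; simp only [hL, smul_eq_mul]; ring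
    have h5 : fderiv ℝ (fun z => (1 / 2 : ℝ) • Real.log (‖z - y‖ ^ 2 + δ n)) z = _ := h2.fderiv
    rw [h3, h5]
    have h4 : inner ℝ (z - y) v = ((starRingEnd ℂ) (z - y) * v).re := by
      rw [Complex.inner]; ring_nf
    simp only [_root_.smul_apply, innerSL_apply_apply, h4, hL', smul_eq_mul,
      nsmul_eq_mul]
    push_cast
    field_simp
  have hfd : Continuous fun z => fderiv ℝ ψ z v :=
    (hψ.continuous_fderiv one_ne_zero).clm_apply continuous_const
  have hfdc : HasCompactSupport fun z => fderiv ℝ ψ z v := hc.fderiv_apply ℝ v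
  have hL'c : ∀ n, Continuous (L' n) := fun n => by
    refine Continuous.div (by fun_prop) (by fun_prop) fun z => (hpos n z).ne'
  have hparts : ∀ n, ∫ z, L n z * fderiv ℝ ψ z v = -∫ z, L' n z * ψ z := by
    intro n
    have := integral_mul_fderiv_eq_neg_fderiv_mul_of_integrable (μ := (volume : Measure ℂ))
      (f := L n) (g := ψ) (v := v)
      (by
        simp only [hLf]
        exact ((hL'c n).mul hψ.continuous).integrable_of_hasCompactSupport hc.mul_left)
      (((hLd n).continuous.mul hfd).integrable_of_hasCompactSupport hfdc.mul_left)
      (((hLd n).continuous.mul hψ.continuous).integrable_of_hasCompactSupport hc.mul_left)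
      (fun x _ => (hLd n).differentiable one_ne_zero x)
      (fun x _ => hψ.differentiable one_ne_zero x)
    simp only [hLf] at this
    exact this
  have hae : ∀ᵐ z : ℂ, z ≠ y := by
    have := (Set.countable_singleton y).ae_notMem (volume : Measure ℂ)
    simpa using this
  have hinvint : ∀ D : ℂ → ℝ, Continuous D → HasCompactSupport D →
      Integrable fun z => ‖z - y‖⁻¹ * |D z| := by
    intro D hD hDc
    have := (integrable_div_sub (D := fun z => (D z : ℂ)) (by fun_prop)
      (hDc.comp_left (g := fun r : ℝ => (r : ℂ)) (by simp)) y).norm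
    refine this.congr (ae_of_all _ fun z => ?_)
    simp only [norm_div, norm_real, Real.norm_eq_abs]
    rw [norm_sub_rev, div_eq_inv_mul]
  -- With t = |z - y|, the regularised logarithm is at least log t ≥ 1 - 1/t, and at most t²/2
  -- because log x ≤ x - 1 and δ ≤ 1; this gives the majorant.
  have lim1 : Tendsto (fun n => ∫ z, L n z * fderiv ℝ ψ z v) atTop
      (𝓝 (∫ z, Real.log ‖z - y‖ * fderiv ℝ ψ z v)) := by
    refine tendsto_integral_of_dominated_convergence
      (fun z => ‖z - y‖⁻¹ * |fderiv ℝ ψ z v| + ‖z - y‖ ^ 2 * |fderiv ℝ ψ z v|)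
      (fun n => ((hLd n).continuous.mul hfd).aestronglyMeasurable) ?_ ?_ ?_
    · refine (hinvint _ hfd hfdc).add ?_
      refine Continuous.integrable_of_hasCompactSupport (by fun_prop) ?_
      exact (hfdc.comp_left (g := fun r : ℝ => |r|) (by simp)).mul_left
    · intro n
      filter_upwards [hae] with z hz
      rw [norm_mul, ← add_mul, Real.norm_eq_abs, Real.norm_eq_abs]
      gcongr
      have ht : 0 < ‖z - y‖ := norm_pos_iff.2 (sub_ne_zero.2 hz)
      simp only [hL]
      have h1 := Real.one_sub_inv_le_log_of_pos ht
      have h2 : 2 * Real.log ‖z - y‖ ≤ Real.log (‖z - y‖ ^ 2 + δ n) := by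
        have := Real.log_le_log (pow_pos ht 2) (by linarith [hδpos n] :
          ‖z - y‖ ^ 2 ≤ ‖z - y‖ ^ 2 + δ n)
        rwa [Real.log_pow] at this
      have h3 := Real.log_le_sub_one_of_pos (hpos n z)
      have h4 := hδ1 n
      have h5 : 0 < ‖z - y‖⁻¹ := inv_pos.2 ht
      have h6 : 0 < ‖z - y‖ ^ 2 := pow_pos ht 2
      rw [abs_le]; constructor <;> linarith
    · filter_upwards [hae] with z hz
      have ht : 0 < ‖z - y‖ := norm_pos_iff.2 (sub_ne_zero.2 hz)
      refine Tendsto.mul_const _ ?_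
      have h1 : Tendsto (fun n => ‖z - y‖ ^ 2 + δ n) atTop (𝓝 (‖z - y‖ ^ 2)) := by
        simpa using tendsto_const_nhds.add hδlim
      have h2 := (h1.log (pow_pos ht 2).ne').div_const 2
      rw [Real.log_pow] at h2
      simpa using h2
  have lim2 : Tendsto (fun n => ∫ z, L' n z * ψ z) atTop
      (𝓝 (∫ z, (v / (z - y)).re * ψ z)) := by
    refine tendsto_integral_of_dominated_convergence
      (fun z => ‖v‖ * (‖z - y‖⁻¹ * |ψ z|))
      (fun n => ((hL'c n).mul hψ.continuous).aestronglyMeasurable) ?_ ?_ ?_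
    · exact (hinvint _ hψ.continuous hc).const_mul _
    · intro n
      filter_upwards [hae] with z hz
      have ht : 0 < ‖z - y‖ := norm_pos_iff.2 (sub_ne_zero.2 hz)
      rw [norm_mul, ← mul_assoc, Real.norm_eq_abs, Real.norm_eq_abs]
      gcongr
      simp only [hL']
      rw [abs_div, abs_of_pos (hpos n z), div_le_iff₀ (hpos n z)]
      have h1 := Complex.abs_re_le_norm ((starRingEnd ℂ) (z - y) * v)
      rw [norm_mul, RCLike.norm_conj] at h1
      have h2 : ‖v‖ * ‖z - y‖⁻¹ * (‖z - y‖ ^ 2 + δ n) =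
          ‖z - y‖ * ‖v‖ + ‖v‖ * ‖z - y‖⁻¹ * δ n := by
        field_simp
      rw [h2]
      have := hδpos n
      have h3 : 0 ≤ ‖v‖ * ‖z - y‖⁻¹ * δ n := by positivity
      linarith
    · filter_upwards [hae] with z hz
      have ht : 0 < ‖z - y‖ := norm_pos_iff.2 (sub_ne_zero.2 hz)
      refine Tendsto.mul_const _ ?_
      have h1 : Tendsto (fun n => ‖z - y‖ ^ 2 + δ n) atTop (𝓝 (‖z - y‖ ^ 2)) := by
        simpa using tendsto_const_nhds.add hδlim
      have h2 : (v / (z - y)).re = ((starRingEnd ℂ) (z - y) * v).re / ‖z - y‖ ^ 2 := by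
        rw [div_eq_mul_inv, Complex.inv_def, Complex.normSq_eq_norm_sq, ← mul_assoc, mul_comm v,
          re_mul_ofReal, div_eq_mul_inv]
      rw [h2]
      exact tendsto_const_nhds.div h1 (pow_pos ht 2).ne'
  simp only [hparts] at lim1
  exact tendsto_nhds_unique lim1 lim2.neg

section Probability

variable {μ : Measure ℂ} [IsProbabilityMeasure μ]

theorem integrable_log_norm_sub_prod (hlog : Integrable (fun x : ℂ => Real.log (1 + ‖x‖)) μ)
    {r : ℝ} (hr : 0 < r) :
    Integrable (fun p : ℂ × ℂ => Real.log ‖p.1 - p.2‖)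
      ((volume.restrict (ball (0 : ℂ) r)).prod μ) := by
  have hfin : IsFiniteMeasure (volume.restrict (ball (0 : ℂ) r)) :=
    ⟨by rw [Measure.restrict_apply_univ]; exact measure_ball_lt_top⟩
  have i1 : Integrable (fun p : ℂ × ℂ => (p.2 - p.1)⁻¹)
      ((volume.restrict (ball (0 : ℂ) r)).prod μ) := by
    have hm : Measurable fun p : ℂ × ℂ => (p.2 - p.1)⁻¹ := by fun_prop
    refine ⟨hm.aestronglyMeasurable, ?_⟩
    unfold HasFiniteIntegral
    rw [lintegral_prod _ hm.enorm.aemeasurable]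
    exact (lintegral_rieszPotential_le hr).trans_lt ENNReal.ofReal_lt_top
  have i2 : Integrable (fun z : ℂ => Real.log (1 + ‖z‖)) (volume.restrict (ball (0 : ℂ) r)) := by
    have hc : Continuous fun z : ℂ => Real.log (1 + ‖z‖) :=
      Continuous.log (by fun_prop) fun z => by positivity
    exact (hc.continuousOn.integrableOn_compact (isCompact_closedBall 0 r)).mono_set
      ball_subset_closedBall
  have i3 := i1.norm.add ((i2.comp_fst μ).add (hlog.comp_snd (volume.restrict (ball (0 : ℂ) r))))
  refine i3.mono' (Measurable.aestronglyMeasurable (by fun_prop)) (ae_of_all _ fun p => ?_)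
  exact abs_log_norm_sub_le p.1 p.2

theorem logPotential_eq (μ : Measure ℂ) (z : ℂ) :
    logPotential μ z = -∫ y, Real.log ‖z - y‖ ∂μ := by
  rw [logPotential, ← integral_neg]
  simp

theorem locallyIntegrable_logPotential
    (hlog : Integrable (fun x : ℂ => Real.log (1 + ‖x‖)) μ) :
    LocallyIntegrable (logPotential μ) := by
  intro x
  refine ⟨ball 0 (‖x‖ + 1), isOpen_ball.mem_nhds (by simp), ?_⟩
  have := (integrable_log_norm_sub_prod hlog (r := ‖x‖ + 1) (by positivity)).integral_prod_left
  refine this.neg.congr (ae_of_all _ fun z => ?_)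
  simp [logPotential_eq]

/-- Integrate by parts in z for each fixed y, with Fubini before and after. Since 1/(z - y) = -1/(y
- z), the weak derivative of U^μ along v is Re(v C). -/
theorem integral_logPotential_mul_fderiv (hlog : Integrable (fun x : ℂ => Real.log (1 + ‖x‖)) μ)
    {ψ : ℂ → ℝ} (hψ : ContDiff ℝ 1 ψ) (hc : HasCompactSupport ψ) (v : ℂ) :
    ∫ z, logPotential μ z * fderiv ℝ ψ z v = -∫ z, (v * cauchyTransform μ z).re * ψ z := by
  have hfd : Continuous fun z => fderiv ℝ ψ z v :=
    (hψ.continuous_fderiv one_ne_zero).clm_apply continuous_const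
  have hfdc : HasCompactSupport fun z => fderiv ℝ ψ z v := hc.fderiv_apply ℝ v
  obtain ⟨M, r, hM0, hr1, hM, hr⟩ := exists_bound_support hfd hfdc
  have hr0 : 0 < r := by linarith
  have hball : ∀ F : ℂ → ℝ, ∫ z in ball 0 r, F z * fderiv ℝ ψ z v = ∫ z, F z * fderiv ℝ ψ z v := by
    intro F
    refine setIntegral_eq_integral_of_forall_compl_eq_zero fun z hz => ?_
    rw [hr z (by simpa using hz), mul_zero]
  have i1 : Integrable (fun p : ℂ × ℂ => Real.log ‖p.1 - p.2‖ * fderiv ℝ ψ p.1 v)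
      ((volume.restrict (ball (0 : ℂ) r)).prod μ) := by
    refine (integrable_log_norm_sub_prod hlog hr0).mul_bdd
      (Continuous.aestronglyMeasurable (by fun_prop)) (c := M) (ae_of_all _ fun p => hM p.1)
  have h1 := integral_integral_swap (f := fun z y => Real.log ‖z - y‖ * fderiv ℝ ψ z v) i1
  simp only [integral_mul_const, hball] at h1
  simp only [logPotential_eq, neg_mul]
  rw [integral_neg, ← hball, ]
  simp only [hball]
  rw [h1]
  have i2 := integrable_mul_inv_prod (μ := μ) (D := fun z => v * (ψ z : ℂ))
    (by have := hψ.continuous; fun_prop)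
    ((hc.comp_left (g := fun r : ℝ => (r : ℂ)) (by simp)).mul_left)
  have h2 := integral_integral_swap (f := fun z x => v * (ψ z : ℂ) * (x - z)⁻¹) i2
  have h3 : ∀ y, ∫ z, Real.log ‖z - y‖ * fderiv ℝ ψ z v =
      (∫ z, v * (ψ z : ℂ) * (y - z)⁻¹).re := by
    intro y
    have i3 : Integrable fun z => v * (ψ z : ℂ) * (y - z)⁻¹ := by
      simp only [← div_eq_mul_inv]
      exact integrable_div_sub (by have := hψ.continuous; fun_prop)
        ((hc.comp_left (g := fun r : ℝ => (r : ℂ)) (by simp)).mul_left) y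
    have e1 := Complex.reCLM.integral_comp_comm i3
    simp only [reCLM_apply] at e1
    rw [integral_log_mul_fderiv hψ hc, ← e1, ← integral_neg]
    congr 1; ext z
    have : v * (ψ z : ℂ) * (y - z)⁻¹ = -(v / (z - y)) * (ψ z : ℂ) := by
      rw [← neg_sub z y, inv_neg, div_eq_mul_inv]; ring
    rw [this, re_mul_ofReal, neg_re]; ring
  simp only [h3]
  have e2 := Complex.reCLM.integral_comp_comm i2.integral_prod_right
  have e3 := Complex.reCLM.integral_comp_comm i2.integral_prod_left
  simp only [reCLM_apply] at e2 e3
  rw [e2, ← h2, ← e3]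
  congr 2; ext z
  rw [integral_const_mul, ← re_mul_ofReal]
  congr 1
  rw [cauchyTransform]; ring

theorem contDiff_field (V : Polynomial ℂ) : ContDiff ℝ 1 (field V) :=
  Complex.reCLM.contDiff.comp (V.differentiable.contDiff.restrict_scalars ℝ)

theorem fderiv_field (V : Polynomial ℂ) (z v : ℂ) :
    fderiv ℝ (field V) z v = (v * V.derivative.eval z).re := by
  have h1 := Complex.reCLM.hasFDerivAt.comp z ((V.hasDerivAt z).hasFDerivAt.restrictScalars ℝ)
  have h2 : fderiv ℝ (field V) z = _ := h1.fderiv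
  rw [h2]; simp

theorem integral_potential_mul_fderiv (V : Polynomial ℂ)
    (hlog : Integrable (fun x : ℂ => Real.log (1 + ‖x‖)) μ)
    {ψ : ℂ → ℝ} (hψ : ContDiff ℝ 1 ψ) (hc : HasCompactSupport ψ) (v : ℂ) :
    ∫ z, (logPotential μ z + field V z / 2) * fderiv ℝ ψ z v =
      -∫ z, (v * gradientField V μ z).re * ψ z := by
  have hfd : Continuous fun z => fderiv ℝ ψ z v :=
    (hψ.continuous_fderiv one_ne_zero).clm_apply continuous_const
  have hfdc : HasCompactSupport fun z => fderiv ℝ ψ z v := hc.fderiv_apply ℝ v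
  have hφ := contDiff_field V
  have hφc := hφ.continuous
  have hψc := hψ.continuous
  have h1 := integral_mul_fderiv_eq_neg_fderiv_mul_of_integrable (μ := (volume : Measure ℂ))
      (f := field V) (g := ψ) (v := v)
      (by
        simp only [fderiv_field]
        exact Continuous.integrable_of_hasCompactSupport (by fun_prop) hc.mul_left)
      ((hφc.mul hfd).integrable_of_hasCompactSupport hfdc.mul_left)
      ((hφc.mul hψc).integrable_of_hasCompactSupport hc.mul_left)
      (fun x _ => hφ.differentiable one_ne_zero x)
      (fun x _ => hψ.differentiable one_ne_zero x)
  simp only [fderiv_field] at h1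
  have i1 : Integrable fun z => logPotential μ z * fderiv ℝ ψ z v := by
    have := (locallyIntegrable_logPotential hlog).integrable_smul_left_of_hasCompactSupport hfd hfdc
    simpa [mul_comm] using this
  have i2 : Integrable fun z => field V z * fderiv ℝ ψ z v :=
    (hφc.mul hfd).integrable_of_hasCompactSupport hfdc.mul_left
  have i3 : Integrable fun z => (v * cauchyTransform μ z).re * ψ z := by
    have := (integrable_mul_cauchyTransform (μ := μ) (D := fun z => v * (ψ z : ℂ)) (by fun_prop)
      ((hc.comp_left (g := fun r : ℝ => (r : ℂ)) (by simp)).mul_left)).re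
    refine this.congr (ae_of_all _ fun z => ?_)
    simp only [RCLike.re_eq_complex_re]
    rw [← re_mul_ofReal]; congr 1; ring
  have i4 : Integrable fun z => (v * V.derivative.eval z).re * ψ z :=
    Continuous.integrable_of_hasCompactSupport (by fun_prop) hc.mul_left
  have e1 : ∀ z, (logPotential μ z + field V z / 2) * fderiv ℝ ψ z v =
      logPotential μ z * fderiv ℝ ψ z v + (1 / 2) * (field V z * fderiv ℝ ψ z v) := by
    intro z; ring
  have e2 : ∀ z, (v * gradientField V μ z).re * ψ z = (v * cauchyTransform μ z).re * ψ z +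
      (1 / 2) * ((v * V.derivative.eval z).re * ψ z) := by
    intro z
    rw [gradientField, mul_add, add_re, ← mul_div_assoc, div_ofNat_re]; ring
  simp only [e1, e2]
  rw [integral_add i1 (i2.const_mul _), integral_add i3 (i4.const_mul _), integral_const_mul,
    integral_const_mul, h1, integral_logPotential_mul_fderiv hlog hψ hc]
  ring

end Probability

/-! ### The total potential near the support, almost everywhere. -/

theorem ae_re_ne_zero : ∀ᵐ w : ℂ, w.re ≠ 0 := by
  have h1 : LinearMap.ker reCLM.toLinearMap ≠ ⊤ := by
    intro h
    have h2 : (1 : ℂ) ∈ LinearMap.ker reCLM.toLinearMap := by rw [h]; trivial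
    simp at h2
  have h3 := Measure.addHaar_submodule (volume : Measure ℂ) _ h1
  refine measure_mono_null (fun w hw => ?_) h3
  simpa using hw

namespace FlatChart

variable {V : Polynomial ℂ} {μ : Measure ℂ} {R : ℂ → ℂ} {z₀ : ℂ} (T : FlatChart R z₀)

theorem ae_of_ae_ball {P : ℂ → Prop} (hP : ∀ᵐ w, w ∈ ball (0 : ℂ) T.ρ → P w) :
    ∀ᵐ z, z ∈ T.D → P (T.e z) := by
  have h1 : volume (T.κ '' (ball (0 : ℂ) T.ρ ∩ {w | ¬ P w})) = 0 := by
    refine addHaar_image_eq_zero_of_differentiableOn_of_addHaar_eq_zero volume ?_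
      (measure_mono_null (fun w hw => ?_) hP)
    · intro w hw
      exact ((T.hasDerivAt_κ w hw.1).differentiableAt.restrictScalars ℝ).differentiableWithinAt
    · exact fun h => hw.2 (h hw.1)
  refine measure_mono_null (fun z hz => ?_) h1
  have hz' : z ∈ T.D ∧ ¬ P (T.e z) := by simpa using hz
  exact ⟨T.e z, ⟨T.e_mem z hz'.1, hz'.2⟩, T.κ_e z hz'.1⟩

/-- The step function is minus the sign of Re e; the quotient t/|t| represents that sign off the
null line Re = 0. -/
theorem ae_gradientField [IsProbabilityMeasure μ]
    (hg : ∀ᵐ z, gradientField V μ z ^ 2 = R z) (hz₀ : z₀ ∈ μ.support) :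
    ∀ᵐ z, z ∈ T.D → gradientField V μ z + ((T.e z).re / |(T.e z).re| : ℝ) * T.S z = 0 := by
  have h1 : ∀ᵐ w, w ∈ ball (0 : ℂ) T.ρ →
      gradientField V μ (T.κ w) + (w.re / |w.re| : ℝ) * T.S (T.κ w) = 0 := by
    filter_upwards [T.ae_ratio_eq_sign hg, T.ae_sign hg hz₀, ae_re_ne_zero] with w h1 h2 h3 hw
    have h4 := h1.1
    have hS := T.S_ne _ (T.κ_mem w hw)
    rw [T.ratio_of_mem _ hw, div_eq_iff hS] at h4
    rw [h4]
    rcases lt_or_gt_of_ne h3 with h | h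
    · rw [(h2 hw).1 h, abs_of_neg h, div_neg, div_self h3]; push_cast; ring
    · rw [(h2 hw).2 h, abs_of_pos h, div_self h3]; push_cast; ring
  filter_upwards [T.ae_of_ae_ball h1] with z hz hD
  simpa only [T.κ_e z hD] using hz hD

/-- The weak gradient of `|Re e|`. -/
theorem integral_abs_re_mul_fderiv {ψ : ℂ → ℝ} (hψ : ContDiff ℝ 1 ψ)
    (hc : HasCompactSupport ψ) (hs : tsupport ψ ⊆ T.D) (v : ℂ) :
    ∫ z, |(T.e z).re| * fderiv ℝ ψ z v =
      -∫ z, (T.e z).re / |(T.e z).re| * (T.S z * v).re * ψ z := by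
  set δ : ℕ → ℝ := fun n => 1 / ((n : ℝ) + 1) with hδ
  have hδpos : ∀ n, 0 < δ n := fun n => by positivity
  have hδ1 : ∀ n, δ n ≤ 1 := fun n => by
    simp only [hδ]
    rw [div_le_one (by positivity)]; linarith [(n.cast_nonneg : (0 : ℝ) ≤ n)]
  have hδlim : Tendsto δ atTop (𝓝 0) := tendsto_one_div_add_atTop_nhds_zero_nat (𝕜 := ℝ)
  set a : ℂ → ℝ := fun z => (T.e z).re with ha
  -- A smooth approximation of |t| whose derivative t/q is bounded by 1.
  set q : ℕ → ℝ → ℝ := fun n t => √(t ^ 2 + δ n) with hq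
  have hpos : ∀ n t, 0 < t ^ 2 + δ n := fun n t => by have := hδpos n; positivity
  have hqpos : ∀ n t, 0 < q n t := fun n t => Real.sqrt_pos.2 (hpos n t)
  have hqc : ∀ n, Continuous (q n) := fun n => by fun_prop
  have hqd : ∀ n, ContDiff ℝ 1 (q n) := fun n =>
    ContDiff.sqrt (by fun_prop) fun t => (hpos n t).ne'
  have hqder : ∀ n t, HasDerivAt (q n) (t / q n t) t := by
    intro n t
    have := ((hasDerivAt_pow 2 t).add_const (δ n)).sqrt (hpos n t).ne'
    convert this using 1
    simp only [hq]; push_cast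
    field_simp
  have hae : ∀ z ∈ T.D, HasFDerivAt a (reCLM.comp
      ((ContinuousLinearMap.toSpanSingleton ℂ (T.S z)).restrictScalars ℝ)) z := fun z hz =>
    reCLM.hasFDerivAt.comp z ((T.hasDerivAt_e z hz).hasFDerivAt.restrictScalars ℝ)
  have hac : ContinuousOn a T.D := continuous_re.comp_continuousOn T.continuousOn_e
  have had : ∀ z ∈ T.D, ContDiffAt ℝ 1 a z := by
    intro z hz
    have h1 : DifferentiableOn ℂ T.e T.D := fun z hz =>
      (T.hasDerivAt_e z hz).differentiableAt.differentiableWithinAt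
    have h2 := (h1.contDiffOn (n := 1) T.isOpen_D).contDiffAt (T.isOpen_D.mem_nhds hz)
    exact reCLM.contDiff.contDiffAt.comp z (h2.restrict_scalars ℝ)
  have hSc : ContinuousOn (fun z => (T.S z * v).re) T.D :=
    continuous_re.comp_continuousOn (T.differentiableOn_S.continuousOn.mul continuousOn_const)
  have hfd : Continuous fun z => fderiv ℝ ψ z v :=
    (hψ.continuous_fderiv one_ne_zero).clm_apply continuous_const
  have hfdc : HasCompactSupport fun z => fderiv ℝ ψ z v := hc.fderiv_apply ℝ v
  have hfds : tsupport (fun z => fderiv ℝ ψ z v) ⊆ T.D :=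
    (tsupport_fderiv_apply_subset ℝ v).trans hs
  have hcont : ∀ {F χ : ℂ → ℝ}, ContinuousOn F T.D → Continuous χ → tsupport χ ⊆ T.D →
      Continuous fun z => F z * χ z := by
    intro F χ hF hχ hsχ
    refine ContinuousOn.continuous_of_tsupport_subset (hF.mul hχ.continuousOn) T.isOpen_D ?_
    exact (tsupport_mul_subset_right).trans hsχ
  have hint : ∀ {F χ : ℂ → ℝ}, ContinuousOn F T.D → Continuous χ → HasCompactSupport χ →
      tsupport χ ⊆ T.D → Integrable fun z => F z * χ z := fun hF hχ hχc hsχ =>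
    (hcont hF hχ hsχ).integrable_of_hasCompactSupport hχc.mul_left
  have hq1 : ∀ n, ContinuousOn (fun z => q n (a z)) T.D := fun n =>
    (hqc n).comp_continuousOn hac
  have hq2 : ∀ n, ContinuousOn (fun z => a z / q n (a z) * (T.S z * v).re) T.D := fun n =>
    (hac.div (hq1 n) fun z _ => (hqpos n _).ne').mul hSc
  have hparts : ∀ n, ∫ z, q n (a z) * fderiv ℝ ψ z v =
      -∫ z, a z / q n (a z) * (T.S z * v).re * ψ z := by
    intro n
    have hs' : tsupport (fun z => q n (a z) * ψ z) ⊆ tsupport ψ := tsupport_mul_subset_right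
    have hcd : ContDiff ℝ 1 fun z => q n (a z) * ψ z := by
      refine contDiff_iff_contDiffAt.2 fun z => ?_
      by_cases hz : z ∈ tsupport fun z => q n (a z) * ψ z
      · exact ((hqd n).contDiffAt.comp z (had z (hs (hs' hz)))).mul hψ.contDiffAt
      · exact contDiffAt_const.congr_of_eventuallyEq
          (notMem_tsupport_iff_eventuallyEq.1 hz)
    have h0 := integral_fderiv_apply_eq_zero hcd hc.mul_left v
    have hder : ∀ z, fderiv ℝ (fun z => q n (a z) * ψ z) z v =
        q n (a z) * fderiv ℝ ψ z v + a z / q n (a z) * (T.S z * v).re * ψ z := by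
      intro z
      by_cases hz : z ∈ tsupport ψ
      · have h1 := ((hqder n (a z)).comp_hasFDerivAt z (hae z (hs hz))).mul
          (hψ.differentiable one_ne_zero z).hasFDerivAt
        have h2 : fderiv ℝ (fun z => q n (a z) * ψ z) z = _ := h1.fderiv
        rw [h2]
        simp
        ring
      · have h1 : z ∉ tsupport (fun z => q n (a z) * ψ z) := fun h => hz (hs' h)
        rw [image_eq_zero_of_notMem_tsupport hz,
          image_eq_zero_of_notMem_tsupport (f := fderiv ℝ ψ)
            (fun h => hz (tsupport_fderiv_subset ℝ h)),
          image_eq_zero_of_notMem_tsupport (f := fderiv ℝ (fun z => q n (a z) * ψ z))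
            (fun h => h1 (tsupport_fderiv_subset ℝ h))]
        simp
    simp only [hder] at h0
    rw [integral_add (hint (hq1 n) hfd hfdc hfds) (hint (hq2 n) hψ.continuous hc hs)] at h0
    linarith
  have hqlim : ∀ t, Tendsto (fun n => q n t) atTop (𝓝 |t|) := by
    intro t
    have h1 : Tendsto (fun n => t ^ 2 + δ n) atTop (𝓝 (t ^ 2 + 0)) := hδlim.const_add _
    have h2 := (Real.continuous_sqrt.tendsto _).comp h1
    rw [add_zero, Real.sqrt_sq_eq_abs] at h2
    exact h2
  have habs : ∀ n t, |t| ≤ q n t := fun n t =>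
    Real.abs_le_sqrt (by linarith [hδpos n])
  have hqle : ∀ n t, q n t ≤ |t| + 1 := by
    intro n t
    refine Real.sqrt_le_iff.2 ⟨by positivity, ?_⟩
    have := hδ1 n
    nlinarith [abs_nonneg t, sq_abs t]
  have lim1 : Tendsto (fun n => ∫ z, q n (a z) * fderiv ℝ ψ z v) atTop
      (𝓝 (∫ z, |a z| * fderiv ℝ ψ z v)) := by
    refine tendsto_integral_of_dominated_convergence
      (fun z => (|a z| + 1) * |fderiv ℝ ψ z v|)
      (fun n => (hint (hq1 n) hfd hfdc hfds).aestronglyMeasurable) ?_ ?_ ?_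
    · have h1 := (hint (F := fun z => |a z| + 1) (hac.abs.add continuousOn_const)
        hfd hfdc hfds).norm
      refine h1.congr (ae_of_all _ fun z => ?_)
      simp only [norm_mul, Real.norm_eq_abs]
      rw [abs_of_nonneg (by positivity : 0 ≤ |a z| + 1)]
    · intro n
      refine ae_of_all _ fun z => ?_
      rw [norm_mul, Real.norm_eq_abs, Real.norm_eq_abs, abs_of_pos (hqpos n _)]
      gcongr
      exact hqle n _
    · exact ae_of_all _ fun z => (hqlim _).mul_const _
  have lim2 : Tendsto (fun n => ∫ z, a z / q n (a z) * (T.S z * v).re * ψ z) atTop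
      (𝓝 (∫ z, a z / |a z| * (T.S z * v).re * ψ z)) := by
    refine tendsto_integral_of_dominated_convergence
      (fun z => |(T.S z * v).re * ψ z|)
      (fun n => (hint (hq2 n) hψ.continuous hc hs).aestronglyMeasurable)
      (hint hSc hψ.continuous hc hs).abs ?_ ?_
    · intro n
      refine ae_of_all _ fun z => ?_
      rw [mul_assoc, norm_mul, Real.norm_eq_abs, Real.norm_eq_abs]
      refine mul_le_of_le_one_left (abs_nonneg _) ?_
      rw [abs_div, abs_of_pos (hqpos n _), div_le_one (hqpos n _)]
      exact habs n _
    · refine ae_of_all _ fun z => ((Tendsto.mul_const _ ?_).mul_const _)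
      -- On the zero line both quotients are 0, the limit one by `0 / 0 = 0`, so convergence holds
      -- everywhere.
      by_cases h : a z = 0
      · simp [h]
      · exact (tendsto_const_nhds).div (hqlim _) (abs_ne_zero.2 h)
  simp only [hparts] at lim1
  exact tendsto_nhds_unique lim1 lim2.neg

/-- Near a point of the support, the total potential is `c - |Re e|` almost everywhere. -/
theorem exists_ae_potential_eq [IsProbabilityMeasure μ]
    (hlog : Integrable (fun x : ℂ => Real.log (1 + ‖x‖)) μ)
    (hg : ∀ᵐ z, gradientField V μ z ^ 2 = R z) (hz₀ : z₀ ∈ μ.support) :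
    ∃ r > 0, ball z₀ r ⊆ T.D ∧ ∃ c : ℝ, ∀ᵐ z, z ∈ ball z₀ r →
      logPotential μ z + field V z / 2 = c - |(T.e z).re| := by
  obtain ⟨r, hr, hrD⟩ := Metric.nhds_basis_closedBall.mem_iff.1 (T.isOpen_D.mem_nhds T.mem_D)
  refine ⟨r, hr, ball_subset_closedBall.trans hrD, ?_⟩
  set F : ℂ → ℝ := fun z => (logPotential μ z + field V z / 2) + |(T.e z).re| with hF
  have hu : LocallyIntegrable fun z => logPotential μ z + field V z / 2 :=
    (locallyIntegrable_logPotential hlog).add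
      ((contDiff_field V).continuous.div_const 2).locallyIntegrable
  have habs : ContinuousOn (fun z => |(T.e z).re|) T.D :=
    (continuous_re.comp_continuousOn T.continuousOn_e).abs
  have hFi : IntegrableOn F (closedBall z₀ r) :=
    (hu.integrableOn_isCompact (isCompact_closedBall _ _)).add
      ((habs.mono hrD).integrableOn_compact (isCompact_closedBall _ _))
  -- F is controlled only inside the chart; test functions supported in the open ball do not see the
  -- truncation.
  have hf : LocallyIntegrable ((closedBall z₀ r).indicator F) :=
    (hFi.integrable_indicator measurableSet_closedBall).locallyIntegrable
  obtain ⟨A, hA, hmono⟩ := exists_ae_monotone hf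
  have hzero : ∀ (v : ℂ) (ψ : ℂ → ℝ), ContDiff ℝ 2 ψ → HasCompactSupport ψ →
      tsupport ψ ⊆ ball z₀ r →
      ∫ z, (closedBall z₀ r).indicator F z * fderiv ℝ ψ z v = 0 := by
    intro v ψ hψ hc hs
    have hsD : tsupport ψ ⊆ T.D := hs.trans (ball_subset_closedBall.trans hrD)
    have hψ1 : ContDiff ℝ 1 ψ := hψ.of_le one_le_two
    have hfd : Continuous fun z => fderiv ℝ ψ z v :=
      (hψ1.continuous_fderiv one_ne_zero).clm_apply continuous_const
    have hfdc : HasCompactSupport fun z => fderiv ℝ ψ z v := hc.fderiv_apply ℝ v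
    have hfds : tsupport (fun z => fderiv ℝ ψ z v) ⊆ T.D :=
      (tsupport_fderiv_apply_subset ℝ v).trans hsD
    have e1 : ∀ z, (closedBall z₀ r).indicator F z * fderiv ℝ ψ z v =
        (logPotential μ z + field V z / 2) * fderiv ℝ ψ z v +
          |(T.e z).re| * fderiv ℝ ψ z v := by
      intro z
      by_cases hz : z ∈ closedBall z₀ r
      · rw [indicator_of_mem hz]; simp only [hF]; ring
      · rw [image_eq_zero_of_notMem_tsupport (f := fderiv ℝ ψ)
            (fun h => hz (ball_subset_closedBall (hs (tsupport_fderiv_subset ℝ h))))]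
        simp
    have i1 : Integrable fun z => (logPotential μ z + field V z / 2) * fderiv ℝ ψ z v := by
      have := hu.integrable_smul_left_of_hasCompactSupport hfd hfdc
      simpa [mul_comm] using this
    have i2 : Integrable fun z => |(T.e z).re| * fderiv ℝ ψ z v := by
      refine Continuous.integrable_of_hasCompactSupport ?_ hfdc.mul_left
      exact ContinuousOn.continuous_of_tsupport_subset (habs.mul hfd.continuousOn) T.isOpen_D
        ((tsupport_mul_subset_right).trans hfds)
    simp only [e1]
    rw [integral_add i1 i2, integral_potential_mul_fderiv V hlog hψ1 hc,
      T.integral_abs_re_mul_fderiv hψ1 hc hsD, ← neg_add, neg_eq_zero]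
    have e2 : ∫ z, (v * gradientField V μ z).re * ψ z =
        ∫ z, -((T.e z).re / |(T.e z).re| * (T.S z * v).re * ψ z) := by
      refine integral_congr_ae ?_
      filter_upwards [T.ae_gradientField hg hz₀] with z hz
      by_cases hzs : z ∈ tsupport ψ
      · have h1 : v * gradientField V μ z =
            -(((T.e z).re / |(T.e z).re| : ℝ) * (T.S z * v)) := by
          rw [eq_neg_of_add_eq_zero_left (hz (hsD hzs))]; ring
        rw [h1, neg_re, re_ofReal_mul, neg_mul]
      · rw [image_eq_zero_of_notMem_tsupport hzs]; simp
    rw [e2, integral_neg, neg_add_cancel]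
  obtain ⟨w, hwb, hwA⟩ := exists_mem_of_ae hA (isOpen_ball (x := z₀) (ε := r))
    (nonempty_ball.2 hr)
  refine ⟨F w, ?_⟩
  filter_upwards [hA] with z hzA hzb
  -- The weak gradient of F is zero, so F is monotone both ways between any two good points, hence
  -- constant.
  have h1 := hmono z₀ r w hwA z hzA hwb hzb fun ψ h1 h2 h3 _ => (hzero _ ψ h1 h2 h3).ge
  have h2 := hmono z₀ r z hzA w hwA hzb hwb fun ψ h1 h2 h3 _ => (hzero _ ψ h1 h2 h3).ge
  rw [indicator_of_mem (ball_subset_closedBall hzb),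
    indicator_of_mem (ball_subset_closedBall hwb)] at h1 h2
  have h3 : F z = F w := le_antisymm h1 h2
  rw [← h3]; simp [hF]

end FlatChart

/-! ### Disc averages and pointwise values of the potential. -/

theorem setIntegral_ball_eq_circleAverage {f : ℂ → ℝ} {r : ℝ} (hf : StronglyMeasurable f)
    (hi : IntegrableOn f (ball 0 r)) :
    ∫ z in ball 0 r, f z = ∫ a in Ioo 0 r, 2 * π * a * circleAverage f 0 a := by
  have hk : Measurable ((Iio r).indicator fun _ => (1 : ℝ)) :=
    measurable_const.indicator measurableSet_Iio
  have e1 : ∀ z, (Iio r).indicator (fun _ => (1 : ℝ)) ‖z‖ • f z = (ball 0 r).indicator f z := by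
    intro z
    by_cases hz : ‖z‖ < r
    · rw [indicator_of_mem (mem_Iio.2 hz), indicator_of_mem (by simpa using hz), one_smul]
    · rw [indicator_of_notMem (by simpa using hz), indicator_of_notMem (by simpa using hz),
        zero_smul]
  have h1 := integral_norm_smul hk hf (by
    simp only [e1]; exact hi.integrable_indicator measurableSet_ball)
  simp only [e1] at h1
  rw [integral_indicator measurableSet_ball] at h1
  rw [h1, ← Ioi_inter_Iio, ← setIntegral_indicator measurableSet_Iio]
  refine integral_congr_ae (ae_of_all _ fun a => ?_)
  by_cases ha : a < r
  · simp [indicator_of_mem (mem_Iio.2 ha)]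
  · simp [indicator_of_notMem (show a ∉ Iio r from ha)]

theorem measureReal_ball_mul (r c : ℝ) :
    volume.real (ball (0 : ℂ) r) * c = ∫ a in Ioo 0 r, 2 * π * a * c := by
  have h := setIntegral_ball_eq_circleAverage (f := fun _ => c) (r := r)
    stronglyMeasurable_const (integrableOn_const measure_ball_lt_top.ne)
  simpa [Real.circleAverage_const] using h

theorem stronglyMeasurable_log_norm_sub (b : ℂ) :
    StronglyMeasurable fun z : ℂ => Real.log ‖z - b‖ :=
  Measurable.stronglyMeasurable (by fun_prop)

theorem circleAverage_log_norm_sub_of_le {b : ℂ} {a : ℝ} (ha : 0 < a) (hab : a ≤ ‖b‖) :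
    circleAverage (fun z => Real.log ‖z - b‖) 0 a = Real.log ‖b‖ := by
  have hb : 0 < ‖b‖ := ha.trans_le hab
  rw [circleAverage_log_norm_sub_const_eq_log_radius_add_posLog ha.ne', zero_sub, norm_neg,
    Real.posLog_eq_log, Real.log_mul (inv_ne_zero ha.ne') hb.ne', Real.log_inv]
  · ring
  · rw [abs_of_nonneg (by positivity), inv_mul_eq_div, one_le_div ha]; exact hab

/-- Subharmonicity of the logarithm: the circle average is max(log a, log|b|). -/
theorem log_norm_le_circleAverage {b : ℂ} (hb : b ≠ 0) {a : ℝ} (ha : 0 < a) :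
    Real.log ‖b‖ ≤ circleAverage (fun z => Real.log ‖z - b‖) 0 a := by
  have hb' : 0 < ‖b‖ := norm_pos_iff.2 hb
  rw [circleAverage_log_norm_sub_const_eq_log_radius_add_posLog ha.ne', zero_sub, norm_neg,
    Real.posLog]
  have h1 : Real.log (a⁻¹ * ‖b‖) = Real.log ‖b‖ - Real.log a := by
    rw [Real.log_mul (inv_ne_zero ha.ne') hb'.ne', Real.log_inv]; ring
  have := le_max_right 0 (Real.log (a⁻¹ * ‖b‖))
  linarith

theorem setIntegral_log_norm_sub_of_lt {b : ℂ} {r : ℝ} (hr : r < ‖b‖) :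
    ∫ z in ball 0 r, Real.log ‖z - b‖ = volume.real (ball (0 : ℂ) r) * Real.log ‖b‖ := by
  have hi : IntegrableOn (fun z : ℂ => Real.log ‖z - b‖) (ball 0 r) := by
    have hc : ContinuousOn (fun z : ℂ => Real.log ‖z - b‖) (closedBall 0 r) := by
      refine ContinuousOn.log (by fun_prop) fun z hz h => ?_
      rw [norm_eq_zero, sub_eq_zero] at h
      rw [mem_closedBall_zero_iff, h] at hz
      linarith
    exact (hc.integrableOn_compact (isCompact_closedBall _ _)).mono_set ball_subset_closedBall
  rw [setIntegral_ball_eq_circleAverage (stronglyMeasurable_log_norm_sub b) hi,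
    measureReal_ball_mul]
  refine setIntegral_congr_fun measurableSet_Ioo fun a ha => ?_
  rw [circleAverage_log_norm_sub_of_le ha.1 (ha.2.le.trans hr.le)]

theorem le_setIntegral_log_norm_sub {b : ℂ} (hb : b ≠ 0) {r : ℝ} (hbr : ‖b‖ ≤ 1) :
    volume.real (ball (0 : ℂ) r) * Real.log ‖b‖ ≤ ∫ z in ball 0 r, Real.log ‖z - b‖ := by
  have hneg : volume.real (ball (0 : ℂ) r) * Real.log ‖b‖ ≤ 0 :=
    mul_nonpos_of_nonneg_of_nonpos measureReal_nonneg
      (Real.log_nonpos (norm_nonneg b) hbr)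
  -- A non-integrable integrand would have integral 0 by convention, and the left side is
  -- nonpositive because |b| ≤ 1.
  by_cases hi : IntegrableOn (fun z : ℂ => Real.log ‖z - b‖) (ball 0 r)
  swap
  · rw [integral_undef hi]; exact hneg
  rw [setIntegral_ball_eq_circleAverage (stronglyMeasurable_log_norm_sub b) hi]
  by_cases hi' : IntegrableOn
      (fun a : ℝ => 2 * π * a * circleAverage (fun z => Real.log ‖z - b‖) 0 a) (Ioo 0 r)
  swap
  · rw [integral_undef hi']; exact hneg
  rw [measureReal_ball_mul]
  refine setIntegral_mono_on ?_ hi' measurableSet_Ioo fun a ha => ?_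
  · exact (Continuous.integrableOn_Icc (by fun_prop)).mono_set Ioo_subset_Icc_self
  · have := ha.1
    exact mul_le_mul_of_nonneg_left (log_norm_le_circleAverage hb ha.1) (by positivity)

theorem setIntegral_log_norm_sub_nonpos {b : ℂ} {r : ℝ} (hr : r ≤ 1 / 2) (hb : ‖b‖ ≤ r) :
    ∫ z in ball 0 r, Real.log ‖z - b‖ ≤ 0 := by
  refine setIntegral_nonpos measurableSet_ball fun z hz => ?_
  rw [mem_ball_zero_iff] at hz
  exact Real.log_nonpos (norm_nonneg _) ((norm_sub_le z b).trans (by linarith))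

theorem measure_singleton_eq_zero {μ : Measure ℂ} [IsProbabilityMeasure μ]
    (hfin : HasFiniteLogEnergy μ) (z : ℂ) : μ {z} = 0 := by
  have h1 : (μ.prod μ) ({z} ×ˢ {z}) = 0 := by
    refine measure_mono_null ?_ (ae_iff.1 (ae_prod_ne hfin))
    rintro ⟨x, y⟩ ⟨hx, hy⟩
    rw [mem_singleton_iff] at hx hy
    simpa using hx.trans hy.symm
  rw [Measure.prod_prod] at h1
  exact mul_self_eq_zero.1 h1

/-- The logarithmic potential is finite at points of essential continuity, with the expected
value. -/
theorem logPotential_eq_of_ae_tendsto {μ : Measure ℂ} [IsProbabilityMeasure μ]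
    (hlog : Integrable (fun x : ℂ => Real.log (1 + ‖x‖)) μ) (hfin : HasFiniteLogEnergy μ)
    {z₁ : ℂ} {c : ℝ} (hlim : Tendsto (logPotential μ) (𝓝 z₁ ⊓ ae volume) (𝓝 c)) :
    Integrable (fun y => Real.log (1 / ‖z₁ - y‖)) μ ∧ logPotential μ z₁ = c := by
  -- Radii at most 1/2 make |z - y| < 1 for z in the disc and y in its closure, so the kernel is
  -- nonnegative there.
  set r : ℕ → ℝ := fun n => 1 / 2 * (1 / ((n : ℝ) + 1)) with hr
  have hr0 : ∀ n, 0 < r n := fun n => by positivity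
  have hr1 : ∀ n, r n ≤ 1 / 2 := fun n => by
    simp only [hr]
    have : 1 / ((n : ℝ) + 1) ≤ 1 := by
      rw [div_le_one (by positivity)]; linarith [(n.cast_nonneg : (0 : ℝ) ≤ n)]
    linarith
  have hrlim : Tendsto r atTop (𝓝 0) := by
    have := (tendsto_one_div_add_atTop_nhds_zero_nat (𝕜 := ℝ)).const_mul (1 / 2)
    rwa [mul_zero] at this
  set m : ℕ → ℝ := fun n => volume.real (ball (0 : ℂ) (r n)) with hm
  have hm0 : ∀ n, 0 < m n := fun n =>
    ENNReal.toReal_pos (measure_ball_pos _ _ (hr0 n)).ne' measure_ball_lt_top.ne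
  have hmball : ∀ n, volume.real (ball z₁ (r n)) = m n := fun n => by
    simp only [hm, measureReal_def, Complex.volume_ball]
  -- the truncated kernels
  set h : ℂ → ℝ := fun y => Real.log (1 / ‖z₁ - y‖) with hh
  -- The kernel averaged over the disc in z: it equals the kernel h when y is outside the closed
  -- disc, and otherwise lies between 0 and h (for y ≠ z₁).
  set H : ℕ → ℂ → ℝ := fun n y => -((m n)⁻¹ * ∫ z in ball z₁ (r n), Real.log ‖z - y‖) with hH
  have htrans : ∀ n y, ∫ z in ball z₁ (r n), Real.log ‖z - y‖ =
      ∫ z in ball 0 (r n), Real.log ‖z - (y - z₁)‖ := by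
    intro n y
    have h1 := (measurePreserving_add_right (volume : Measure ℂ) z₁).setIntegral_preimage_emb
      (Homeomorph.addRight z₁).measurableEmbedding (fun z => Real.log ‖z - y‖) (ball z₁ (r n))
    rw [← h1]
    have h2 : (fun x => x + z₁) ⁻¹' ball z₁ (r n) = ball 0 (r n) := by
      ext z; simp [dist_eq_norm]
    rw [h2]
    congr 1; ext z; congr 2; ring
  have hnorm : ∀ y, ‖y - z₁‖ = ‖z₁ - y‖ := fun y => norm_sub_rev y z₁
  have hh' : ∀ y, h y = -Real.log ‖y - z₁‖ := fun y => by
    simp only [hh, one_div, Real.log_inv, hnorm]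
  have Hout : ∀ n y, r n < ‖y - z₁‖ → H n y = h y := by
    intro n y hy
    simp only [hH, htrans, setIntegral_log_norm_sub_of_lt hy, hh']
    rw [inv_mul_cancel_left₀ (hm0 n).ne']
  have Hin : ∀ n y, ‖y - z₁‖ ≤ r n → 0 ≤ H n y := by
    intro n y hy
    simp only [hH, htrans]
    have := setIntegral_log_norm_sub_nonpos (hr1 n) hy
    have := mul_nonpos_of_nonneg_of_nonpos (inv_pos.2 (hm0 n)).le this
    linarith
  have Hle : ∀ n y, y ≠ z₁ → ‖y - z₁‖ ≤ r n → H n y ≤ h y := by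
    intro n y hy hyr
    simp only [hH, htrans, hh']
    have := le_setIntegral_log_norm_sub (sub_ne_zero.2 hy) (r := r n)
      (hyr.trans ((hr1 n).trans (by norm_num)))
    have h3 : Real.log ‖y - z₁‖ ≤ (m n)⁻¹ * ∫ z in ball 0 (r n), Real.log ‖z - (y - z₁)‖ := by
      rw [inv_mul_eq_div, le_div_iff₀ (hm0 n), mul_comm]; exact this
    linarith
  -- Fubini
  have hprod : ∀ n, Integrable (fun p : ℂ × ℂ => Real.log ‖p.1 - p.2‖)
      ((volume.restrict (ball z₁ (r n))).prod μ) := by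
    intro n
    refine (integrable_log_norm_sub_prod hlog (r := ‖z₁‖ + 1) (by positivity)).mono_measure ?_
    refine Measure.prod_mono (Measure.restrict_mono ?_ le_rfl) le_rfl
    intro z hz
    rw [mem_ball_zero_iff]
    have h1 := mem_ball_iff_norm.1 hz
    have h2 := norm_le_norm_add_norm_sub z₁ z
    linarith [hr1 n, norm_sub_rev z z₁]
  have Hint : ∀ n, Integrable (H n) μ := fun n => ((hprod n).integral_prod_right.const_mul _).neg
  have Hval : ∀ n, ∫ y, H n y ∂μ = (m n)⁻¹ * ∫ z in ball z₁ (r n), logPotential μ z := by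
    intro n
    simp only [hH, logPotential_eq]
    rw [integral_neg, integral_neg, integral_const_mul,
      integral_integral_swap (f := fun z y => Real.log ‖z - y‖) (hprod n)]
    ring
  -- By Fubini these integrals are the disc averages of U^μ, which depend only on its values almost
  -- everywhere.
  have Hlim : Tendsto (fun n => ∫ y, H n y ∂μ) atTop (𝓝 c) := by
    have hs : Tendsto (fun n => ball z₁ (r n)) atTop (𝓝 z₁).smallSets := by
      rw [nhds_basis_ball.smallSets.tendsto_right_iff]
      intro ε hε
      filter_upwards [hrlim.eventually_lt_const hε] with n hn
      exact ball_subset_ball hn.le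
    have h1 := hlim.integral_sub_linear_isLittleO_ae
      (stronglyMeasurable_logPotential μ).stronglyMeasurableAtFilter
      (volume.finiteAt_nhds z₁) hs m (Eventually.of_forall hmball)
    have h2 := h1.tendsto_div_nhds_zero
    have h3 := h2.add_const c
    rw [zero_add] at h3
    refine h3.congr fun n => ?_
    have := (hm0 n).ne'
    rw [Hval, smul_eq_mul]
    field_simp
    ring
  have hne : ∀ᵐ y ∂μ, y ≠ z₁ := by
    rw [ae_iff]; simpa using measure_singleton_eq_zero hfin z₁
  -- integrability of the kernel
  set W : ℂ → ℝ := fun y => Real.log (1 + ‖z₁‖) + Real.log (1 + ‖y‖) with hW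
  have hWi : Integrable W μ := (integrable_const _).add hlog
  have hW0 : ∀ y, 0 ≤ W y := fun y =>
    add_nonneg (Real.log_nonneg (by linarith [norm_nonneg z₁]))
      (Real.log_nonneg (by linarith [norm_nonneg y]))
  have hhW : ∀ y, 0 ≤ h y + W y := by
    intro y
    rw [hh', hnorm]
    have h1 := log_one_add_norm_sub_le z₁ y
    rcases (norm_nonneg (z₁ - y)).eq_or_lt with h2 | h2
    · rw [← h2]; simpa using hW0 y
    · have h3 : Real.log ‖z₁ - y‖ ≤ Real.log (1 + ‖z₁ - y‖) := Real.log_le_log h2 (by linarith)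
      simp only [hW]; linarith
  set φ : ℕ → Set ℂ := fun n => {y | r n < ‖y - z₁‖} with hφ
  have hφm : ∀ n, MeasurableSet (φ n) := fun n =>
    measurableSet_lt measurable_const (by fun_prop)
  have hev : ∀ y, y ≠ z₁ → ∀ᶠ n in atTop, y ∈ φ n := fun y hy =>
    hrlim.eventually_lt_const (norm_pos_iff.2 (sub_ne_zero.2 hy))
  have hcover : AECover μ atTop φ := ⟨hne.mono hev, hφm⟩
  -- W makes the kernel nonnegative. On the exhausting sets |y - z₁| > r_n the kernel equals `H n`,
  -- so its integrals stay bounded by those of `H n + W`.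
  have hi : Integrable (fun y => h y + W y) μ := by
    refine hcover.integrable_of_integral_bounded_of_nonneg_ae (c + 1 + ∫ y, W y ∂μ) (fun n => ?_)
      (ae_of_all _ hhW) ?_
    · refine (((Hint n).add hWi).integrableOn (s := φ n)).congr_fun (fun y hy => ?_) (hφm n)
      simp only [Pi.add_apply]
      rw [Hout n y hy]
    · filter_upwards [Hlim.eventually_le_const (lt_add_one c)] with n hn
      have e1 : ∫ y in φ n, (h y + W y) ∂μ = ∫ y in φ n, (H n y + W y) ∂μ :=
        setIntegral_congr_fun (hφm n) fun y hy => by simp only [Hout n y hy]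
      rw [e1]
      have e2 : ∫ y in φ n, (H n y + W y) ∂μ ≤ ∫ y, (H n y + W y) ∂μ := by
        refine setIntegral_le_integral ((Hint n).add hWi) (ae_of_all _ fun y => ?_)
        rcases lt_or_ge (r n) ‖y - z₁‖ with hy | hy
        · simp only [Pi.zero_apply, Hout n y hy]; exact hhW y
        · exact add_nonneg (Hin n y hy) (hW0 y)
      refine e2.trans ?_
      rw [integral_add (Hint n) hWi]
      linarith
  have hhi : Integrable h μ := by
    refine (hi.sub hWi).congr (ae_of_all _ fun y => ?_)
    simp
  refine ⟨hhi, tendsto_nhds_unique ?_ Hlim⟩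
  refine tendsto_integral_of_dominated_convergence (fun y => |h y|)
    (fun n => (Hint n).aestronglyMeasurable) hhi.abs (fun n => ?_) ?_
  · filter_upwards [hne] with y hy
    rw [Real.norm_eq_abs]
    rcases lt_or_ge (r n) ‖y - z₁‖ with hyr | hyr
    · rw [Hout n y hyr]
    · rw [abs_of_nonneg (Hin n y hyr)]
      exact (Hle n y hy hyr).trans (le_abs_self _)
  · filter_upwards [hne] with y hy
    exact tendsto_const_nhds.congr' ((hev y hy).mono fun n hn => (Hout n y hn).symm)

/-! ### Normal derivatives and the conclusion. -/

namespace FlatChart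

variable {V : Polynomial ℂ} {μ : Measure ℂ} {R : ℂ → ℂ} {z₀ : ℂ} (T : FlatChart R z₀)

/-- Near a point of the support, the potential is finite and the total potential is
`c - |Re e|`. -/
theorem exists_potential_eq [IsProbabilityMeasure μ]
    (hlog : Integrable (fun x : ℂ => Real.log (1 + ‖x‖)) μ) (hfin : HasFiniteLogEnergy μ)
    (hg : ∀ᵐ z, gradientField V μ z ^ 2 = R z) (hz₀ : z₀ ∈ μ.support) :
    ∃ c : ℝ, ∀ᶠ z in 𝓝 z₀, Integrable (fun y => Real.log (1 / ‖z - y‖)) μ ∧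
      logPotential μ z + field V z / 2 = c - |(T.e z).re| := by
  obtain ⟨r, hr, hrD, c, hae⟩ := T.exists_ae_potential_eq hlog hg hz₀
  refine ⟨c, ?_⟩
  filter_upwards [ball_mem_nhds z₀ hr] with z hz
  have hcont : ContinuousAt (fun z => c - |(T.e z).re| - field V z / 2) z := by
    have h1 : ContinuousAt T.e z := (T.hasDerivAt_e z (hrD hz)).continuousAt
    exact (continuousAt_const.sub (continuous_re.continuousAt.comp h1).abs).sub
      ((contDiff_field V).continuous.continuousAt.div_const 2)
  obtain ⟨h1, h2⟩ := logPotential_eq_of_ae_tendsto hlog hfin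
    ((hcont.tendsto.mono_left inf_le_left).congr' (by
      filter_upwards [mem_inf_of_left (isOpen_ball.mem_nhds hz), mem_inf_of_right hae] with w hw hw'
      rw [← hw' hw]; ring))
  exact ⟨h1, by rw [h2]; ring⟩

/-- Since e(z₀) = 0, the one-sided difference quotient is -|Re e(z₀ + s n)|/s, which tends to
-|Re(S(z₀) n)|. The absolute value makes n and -n give the same limit. -/
theorem hasNormalDeriv {u : ℂ → ℝ} {c : ℝ} (hu : ∀ᶠ z in 𝓝 z₀, u z = c - |(T.e z).re|)
    {n : ℂ} (hn : |(T.S z₀ * n).re| = ‖T.S z₀‖) : HasNormalDeriv u z₀ n (-‖T.S z₀‖) := by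
  have h1 : HasDerivAt (fun s : ℝ => z₀ + (s : ℂ) * n) n 0 := by
    simpa using ((Complex.ofRealCLM.hasDerivAt (x := 0)).mul_const n).const_add z₀
  have h2 : HasDerivAt (fun s : ℝ => T.e (z₀ + (s : ℂ) * n)) (T.S z₀ * n) 0 :=
    (T.hasDerivAt_e z₀ T.mem_D).comp_of_eq 0 h1 (by simp)
  have h3 : HasDerivAt (fun s : ℝ => (T.e (z₀ + (s : ℂ) * n)).re) (T.S z₀ * n).re 0 :=
    reCLM.hasFDerivAt.comp_hasDerivAt 0 h2
  have h4 := (h3.tendsto_slope.mono_left (nhdsGT_le_nhdsNE 0)).abs.neg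
  rw [hn] at h4
  have h5 : Tendsto (fun s : ℝ => z₀ + (s : ℂ) * n) (𝓝[>] 0) (𝓝 z₀) := by
    have := h1.continuousAt.tendsto
    simp only [ofReal_zero, zero_mul, add_zero] at this
    exact this.mono_left nhdsWithin_le_nhds
  refine h4.congr' ?_
  filter_upwards [h5.eventually hu, self_mem_nhdsWithin] with s hs hs0
  have hs0' : (0 : ℝ) < s := hs0
  rw [hs, hu.self_of_nhds, T.e_center, slope_def_field]
  simp only [ofReal_zero, zero_mul, add_zero, T.e_center, zero_re, sub_zero, abs_zero]
  rw [abs_div, abs_of_pos hs0']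
  ring

/-- The arc has tangent i/S(z₀), so its normal is a real direction in the flat coordinate. -/
theorem S_mul_unitNormal : T.S z₀ * unitNormal T.arc = -(‖T.S z₀‖ : ℂ) := by
  have h1 := (T.hasDerivAt_arc (t := 0) (by simpa using T.ρ_pos)).deriv
  have h2 : T.arc 0 = z₀ := by simp [arc, T.κ_zero]
  have h3 := T.S_ne _ T.mem_D
  have h4 : (‖T.S z₀‖ : ℂ) ≠ 0 := by simpa using h3
  rw [unitNormal, h1, h2, norm_div, norm_I]
  push_cast
  field_simp
  simp

end FlatChart

end SCurve

end

theorem corollary3p9 (V : Polynomial ℂ) (hV : 2 ≤ V.natDegree) (Γ : Set ℂ) (hΓ : IsClosed Γ)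
    (hgrowth : SCurve.GrowthCondition V Γ) (μ : MeasureTheory.Measure ℂ)
    (hμ : SCurve.IsEquilibriumMeasure V Γ μ) (hcrit : SCurve.IsCriticalMeasure V μ) :
    SCurve.HasSProperty V Γ := by
  have hprob := hcrit.1.isProbabilityMeasure
  obtain ⟨p, hp, hg⟩ := SCurve.exists_polynomial_gradientField_sq hcrit
  -- The flat coordinate is constructed only where p ≠ 0, so the exceptional set consists of the
  -- roots of p.
  refine ⟨hgrowth, μ, hμ, {z | p.IsRoot z}, Polynomial.finite_setOfPred_isRoot hp, ?_⟩
  rintro z ⟨hz, hzE⟩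
  obtain ⟨T⟩ := SCurve.exists_flatChart p.differentiable hzE
  obtain ⟨c, hc⟩ := T.exists_potential_eq hcrit.1.integrable_log hcrit.1.finite_energy hg hz
  have hS := T.S_mul_unitNormal
  refine ⟨T.arc, T.isLocalAnalyticArc hg hz, hc.self_of_nhds.1, -‖T.S z‖,
    T.hasNormalDeriv (hc.mono fun _ h => h.2) ?_, T.hasNormalDeriv (hc.mono fun _ h => h.2) ?_⟩
  · simp [hS]
  · simp [hS]
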